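/- **Conventions.** Let $\mathscr M$ be a monoidal bicategory (a one-object tricategory), with tensor product pseudofunctor $\otimes$, unit object $I$ and pseudonatural equivalences $a:(X\otimes Y)\otimes Z\to X\otimes(Y\otimes Z)$, $\ell:I\otimes X\to X$, $r:X\to X\otimes I$. Below, $1$-cells are composed right to left, and the constraint cells of $\mathscr M$ (associators and unitors, the constraints of $\otimes$, the pseudonaturality cells of $a,\ell,r$, the structural modifications, and the canonical $\ell_I r_I\cong 1_I$) are suppressed, as if $\mathscr M$ were a Gray monoid; in a general $\mathscr M$ they are to be inserted. A *left skew-monoidal structure* on an object $A$ consists of $1$-cells $p:A\otimes A\to A$, $j:I\to A$ and (not necessarily invertible) $2$-cells $\alpha:p(p\otimes1)\Rightarrow p(1\otimes p)$, $\lambda:p(j\otimes1)\Rightarrow 1_A$, $\rho:1_A\Rightarrow p(1\otimes j)$ such that 1. $p(1\otimes\alpha)\cdot\alpha(1\otimes p\otimes1)\cdot p(\alpha\otimes1)=\alpha(1\otimes1\otimes p)\cdot\alpha(p\otimes1\otimes1)$; 2. $p(1\otimes\lambda)\cdot\alpha(1\otimes j\otimes1)\cdot p(\rho\otimes1)=1_p$;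 3. $\lambda p\cdot\alpha(j\otimes1\otimes1)=p(\lambda\otimes1)$; 4. $\alpha(1\otimes1\otimes j)\cdot\rho p=p(1\otimes\rho)$; 5. $\lambda j\cdot\rho j=1_j$. An *opmonoidal morphism* $(f,\psi_0,\psi):(A,p,j)\to(A',p',j')$ is a $1$-cell $f:A\to A'$ with $2$-cells $\psi_0:fj\Rightarrow j'$ and $\psi:fp\Rightarrow p'(f\otimes f)$ such that - $p'(f\otimes\psi)\cdot\psi(1\otimes p)\cdot f\alpha=\alpha'(f\otimes f\otimes f)\cdot p'(\psi\otimes f)\cdot\psi(p\otimes1)$; - $\lambda' f\cdot p'(\psi_0\otimes f)\cdot\psi(j\otimes1)=f\lambda$; - $p'(f\otimes\psi_0)\cdot\psi(1\otimes j)\cdot f\rho=\rho' f$. Let $(A,p,j,\alpha,\lambda,\rho)$ be a left skew monoidale in $\mathscr M$. A *skew left warping* on it consists of $1$-cells $t:A\to A$, $k:I\to A$ and $2$-cells $v:tp(t\otimes1)\Rightarrow p(t\otimes t)$, $v_0:tk\Rightarrow j$, $\kappa:1_A\Rightarrow p(t\otimes k)$ satisfying, with $q=p(t\otimes 1)$,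 1. $\alpha(t\otimes t\otimes t)\cdot p(v\otimes t)\cdot v(q\otimes1)=p(t\otimes v)\cdot v(1\otimes q)\cdot t\alpha(t\otimes t\otimes1)\cdot tp(v\otimes1)$; 2. $\lambda t\cdot p(v_0\otimes t)\cdot v(k\otimes1)=t\lambda\cdot tp(v_0\otimes1)$; 3. $p(t\otimes v_0)\cdot v(1\otimes k)\cdot t\kappa=\rho t$; 4. $\alpha(t\otimes t\otimes k)\cdot p(v\otimes k)\cdot\kappa q=p(t\otimes\kappa)$; 5. $\lambda k\cdot p(v_0\otimes k)\cdot\kappa k=1_k$. **Proposition.** Let $(t,k,v,v_0,\kappa)$ be a skew left warping on a left skew monoidale $(A,p,j,\alpha,\lambda,\rho)$ in a monoidal bicategory $\mathscr M$. Then the following is a left skew-monoidal structure on $A$: - tensor product $p_t=p(t\otimes1_A):A\otimes A\to A$; - unit $k:I\to A$; - associativity constraint $$p(t\otimes1)(p\otimes1)(t\otimes1\otimes1)\xRightarrow{\;p(v\otimes1)\;}p(p\otimes1)(t\otimes t\otimes1)\xRightarrow{\;\alpha(t\otimes t\otimes1)\;}p(1\otimes p)(t\otimes t\otimes1);$$ -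 left unit constraint $p(tk\otimes1)\xRightarrow{\;p(v_0\otimes1)\;}p(j\otimes1)\xRightarrow{\;\lambda\;}1_A$; - right unit constraint $1_A\xRightarrow{\;\kappa\;}p(t\otimes k)$. Moreover $(t,v_0,v)$ is an opmonoidal morphism $(A,p_t,k)\to(A,p,j)$. -/

import Mathlib

open CategoryTheory CategoryTheory.Bicategory

universe w v u w₁ v₁ u₁ w₂ v₂ u₂ w₃ v₃ u₃

/- Makes `homCategory` the preferred category structure on `X ⟶ X`, instead of the (definitionally
equal) one that Mathlib declares on endomorphisms. -/
attribute [-instance] CategoryTheory.instCategoryEndMonoidal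

namespace SkewWarp

/-! ### Products of pseudofunctors -/

section ProductPseudofunctors

variable {B : Type u} [Bicategory.{w, v} B] {C : Type u₁} [Bicategory.{w₁, v₁} C]
  {D : Type u₂} [Bicategory.{w₂, v₂} D] {E : Type u₃} [Bicategory.{w₃, v₃} E]

/-- The pseudofunctor `F × G : B × D ⥤ᵖ C × E`. -/
def prodMap (F : Pseudofunctor B C) (G : Pseudofunctor D E) : Pseudofunctor (B × D) (C × E) where
  obj X := (F.obj X.1, G.obj X.2)
  map f := (F.map f.1, G.map f.2)
  map₂ η := (F.map₂ η.1, G.map₂ η.2)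
  map₂_id f := Prod.ext (F.map₂_id f.1) (G.map₂_id f.2)
  map₂_comp η θ := Prod.ext (F.map₂_comp η.1 θ.1) (G.map₂_comp η.2 θ.2)
  mapId X := Iso.prod (F.mapId X.1) (G.mapId X.2)
  mapComp f g := Iso.prod (F.mapComp f.1 g.1) (G.mapComp f.2 g.2)
  map₂_whisker_left f _ _ η :=
    Prod.ext (F.map₂_whisker_left f.1 η.1) (G.map₂_whisker_left f.2 η.2)
  map₂_whisker_right η h :=
    Prod.ext (F.map₂_whisker_right η.1 h.1) (G.map₂_whisker_right η.2 h.2)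
  map₂_associator f g h :=
    Prod.ext (F.map₂_associator f.1 g.1 h.1) (G.map₂_associator f.2 g.2 h.2)
  map₂_left_unitor f := Prod.ext (F.map₂_left_unitor f.1) (G.map₂_left_unitor f.2)
  map₂_right_unitor f := Prod.ext (F.map₂_right_unitor f.1) (G.map₂_right_unitor f.2)

variable (B C D) in
/-- The (strict) pseudofunctor `(B × C) × D ⥤ᵖ B × (C × D)` that moves the brackets. -/
def prodAssoc : Pseudofunctor ((B × C) × D) (B × (C × D)) where
  obj X := (X.1.1, (X.1.2, X.2))
  map f := (f.1.1, (f.1.2, f.2))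
  map₂ η := (η.1.1, (η.1.2, η.2))
  map₂_id _ := rfl
  map₂_comp _ _ := rfl
  mapId X := Iso.refl _
  mapComp f g := Iso.refl _
  map₂_whisker_left f _ _ η := by
    simp only [Iso.refl_hom, Iso.refl_inv]
    refine Prod.ext ?_ (Prod.ext ?_ ?_) <;> simp
  map₂_whisker_right η h := by
    simp only [Iso.refl_hom, Iso.refl_inv]
    refine Prod.ext ?_ (Prod.ext ?_ ?_) <;> simp
  map₂_associator f g h := by
    simp only [Iso.refl_hom, Iso.refl_inv]
    refine Prod.ext ?_ (Prod.ext ?_ ?_) <;> simp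
  map₂_left_unitor f := by
    simp only [Iso.refl_hom]
    refine Prod.ext ?_ (Prod.ext ?_ ?_) <;> simp
  map₂_right_unitor f := by
    simp only [Iso.refl_hom]
    refine Prod.ext ?_ (Prod.ext ?_ ?_) <;> simp

end ProductPseudofunctors

/-! ### Monoidal bicategories

A monoidal bicategory is a tricategory with one object.  Composition of 1-cells and of 2-cells is
written in diagrammatic order. -/

/-- An internal equivalence in a bicategory. -/
def IsEquivalence {B : Type u} [Bicategory.{w, v} B] {X Y : B} (f : X ⟶ Y) : Prop :=
  ∃ g : Y ⟶ X, Nonempty (f ≫ g ≅ 𝟙 X) ∧ Nonempty (g ≫ f ≅ 𝟙 Y)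

/-- A bicategory with a tensor product pseudofunctor and a unit object. -/
class TensorBicategory (B : Type u) [Bicategory.{w, v} B] where
  /-- the tensor product -/
  tensor : Pseudofunctor (B × B) B
  /-- the unit object -/
  unit : B

section Tensor

variable {B : Type u} [Bicategory.{w, v} B] [TensorBicategory B]

/-- The tensor product of objects. -/
abbrev tensorObj (X Y : B) : B := (TensorBicategory.tensor (B := B)).obj (X, Y)

infixr:90 " ⊠ " => tensorObj

/-- The tensor product of 1-cells. -/
abbrev tensorHom {X X' Y Y' : B} (f : X ⟶ X') (g : Y ⟶ Y') : X ⊠ Y ⟶ X' ⊠ Y' :=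
  (TensorBicategory.tensor (B := B)).map (X := (X, Y)) (Y := (X', Y')) (f, g)

infixr:90 " ⊠₁ " => tensorHom

/-- The tensor product of 2-cells. -/
abbrev tensorHom₂ {X X' Y Y' : B} {f f' : X ⟶ X'} {g g' : Y ⟶ Y'} (η : f ⟶ f') (θ : g ⟶ g') :
    f ⊠₁ g ⟶ f' ⊠₁ g' :=
  (TensorBicategory.tensor (B := B)).map₂ (a := (X, Y)) (b := (X', Y'))
    (f := (f, g)) (g := (f', g')) (η, θ)

infixr:90 " ⊠₂ " => tensorHom₂

/-- The tensor product of invertible 2-cells. -/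
abbrev tensorIso {X X' Y Y' : B} {f f' : X ⟶ X'} {g g' : Y ⟶ Y'} (η : f ≅ f') (θ : g ≅ g') :
    f ⊠₁ g ≅ f' ⊠₁ g' :=
  (TensorBicategory.tensor (B := B)).map₂Iso (a := (X, Y)) (b := (X', Y'))
    (f := (f, g)) (g := (f', g')) (Iso.prod η θ)

/-- The unit constraint `1 ⊗ 1 ≅ 1` of the pseudofunctor `⊗`. -/
abbrev tensorId (X Y : B) : 𝟙 X ⊠₁ 𝟙 Y ≅ 𝟙 (X ⊠ Y) :=
  (TensorBicategory.tensor (B := B)).mapId (X, Y)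

/-- The composition constraint of the pseudofunctor `⊗`. -/
abbrev tensorComp {X X' X'' Y Y' Y'' : B} (f : X ⟶ X') (f' : X' ⟶ X'') (g : Y ⟶ Y')
    (g' : Y' ⟶ Y'') : (f ≫ f') ⊠₁ (g ≫ g') ≅ (f ⊠₁ g) ≫ (f' ⊠₁ g') :=
  (TensorBicategory.tensor (B := B)).mapComp (a := (X, Y)) (b := (X', Y')) (c := (X'', Y''))
    (f, g) (f', g')

/-- The composition constraint of `⊗`, followed by the tensor product of two given 2-cells:
from `f f' ≅ h` and `g g' ≅ k` one gets `(f ⊗ g)(f' ⊗ g') ≅ h ⊗ k`. -/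
def fuse {X X' X'' Y Y' Y'' : B} {f : X ⟶ X'} {f' : X' ⟶ X''} {g : Y ⟶ Y'} {g' : Y' ⟶ Y''}
    {h : X ⟶ X''} {k : Y ⟶ Y''} (e : f ≫ f' ≅ h) (e' : g ≫ g' ≅ k) :
    (f ⊠₁ g) ≫ (f' ⊠₁ g') ≅ h ⊠₁ k :=
  (tensorComp f f' g g').symm ≪≫ tensorIso e e'

/-- `(f ⊗ 1)(g ⊗ 1) ≅ fg ⊗ 1`. -/
def fuseRight {X X' X'' : B} (f : X ⟶ X') (g : X' ⟶ X'') (Y : B) :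
    (f ⊠₁ 𝟙 Y) ≫ (g ⊠₁ 𝟙 Y) ≅ (f ≫ g) ⊠₁ 𝟙 Y :=
  fuse (Iso.refl _) (λ_ (𝟙 Y))

/-- `(1 ⊗ f)(1 ⊗ g) ≅ 1 ⊗ fg`. -/
def fuseLeft {X X' X'' : B} (Y : B) (f : X ⟶ X') (g : X' ⟶ X'') :
    (𝟙 Y ⊠₁ f) ≫ (𝟙 Y ⊠₁ g) ≅ 𝟙 Y ⊠₁ (f ≫ g) :=
  fuse (λ_ (𝟙 Y)) (Iso.refl _)

/-- `(f ⊗ 1)(1 ⊗ g) ≅ (1 ⊗ g)(f ⊗ 1)`. -/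
def interchange {X X' Y Y' : B} (f : X ⟶ X') (g : Y ⟶ Y') :
    (f ⊠₁ 𝟙 Y) ≫ (𝟙 X' ⊠₁ g) ≅ (𝟙 X ⊠₁ g) ≫ (f ⊠₁ 𝟙 Y') :=
  fuse (ρ_ f) (λ_ g) ≪≫ (fuse (λ_ f) (ρ_ g)).symm

/-- The identity square on a 1-cell. -/
def idSquare {X X' : B} (f : X ⟶ X') : f ≫ 𝟙 X' ≅ 𝟙 X ≫ f := ρ_ f ≪≫ (λ_ f).symm

/-- Pasting of two invertible squares along a common edge. -/
def pasteSquare {X X' Y Y' Z Z' : B} {f : X ⟶ X'} {g : Y ⟶ Y'} {h : Z ⟶ Z'} {x : X ⟶ Y}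
    {x' : X' ⟶ Y'} {y : Y ⟶ Z} {y' : Y' ⟶ Z'} (s : f ≫ x' ≅ x ≫ g) (t : g ≫ y' ≅ y ≫ h) :
    f ≫ x' ≫ y' ≅ (x ≫ y) ≫ h :=
  (α_ f x' y').symm ≪≫ whiskerRightIso s y' ≪≫ α_ x g y' ≪≫ whiskerLeftIso x t ≪≫ (α_ x y h).symm

/-- The tensor product of two invertible squares. -/
def tensorSquare {X X' Y Y' Z Z' W W' : B} {f : X ⟶ X'} {g : Y ⟶ Y'} {x : X ⟶ Y} {x' : X' ⟶ Y'}
    {h : Z ⟶ Z'} {k : W ⟶ W'} {z : Z ⟶ W} {z' : Z' ⟶ W'} (s : f ≫ x' ≅ x ≫ g)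
    (t : h ≫ z' ≅ z ≫ k) : (f ⊠₁ h) ≫ (x' ⊠₁ z') ≅ (x ⊠₁ z) ≫ (g ⊠₁ k) :=
  fuse s t ≪≫ tensorComp x g z k

end Tensor

/-- A bicategory with a tensor product, a unit object, and pseudonatural equivalences
`(X ⊗ Y) ⊗ Z ⟶ X ⊗ (Y ⊗ Z)`, `I ⊗ X ⟶ X` and `X ⟶ X ⊗ I`. -/
class PremonoidalBicategory (B : Type u) [Bicategory.{w, v} B] extends TensorBicategory B where
  /-- the associativity constraint, pseudonatural in three variables -/
  assoc : Pseudofunctor.StrongTrans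
    ((prodMap tensor (Pseudofunctor.id B)).comp tensor)
    ((prodAssoc B B B).comp ((prodMap (Pseudofunctor.id B) tensor).comp tensor))
  /-- the left unit constraint, pseudonatural in one variable -/
  leftUnit : Pseudofunctor.StrongTrans
    ((Bicategory.Prod.sectR unit B).toPseudofunctor.comp tensor) (Pseudofunctor.id B)
  /-- the right unit constraint, pseudonatural in one variable -/
  rightUnit : Pseudofunctor.StrongTrans
    (Pseudofunctor.id B) ((Bicategory.Prod.sectL B unit).toPseudofunctor.comp tensor)
  assoc_isEquivalence : ∀ X : (B × B) × B, IsEquivalence (assoc.app X)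
  leftUnit_isEquivalence : ∀ X : B, IsEquivalence (leftUnit.app X)
  rightUnit_isEquivalence : ∀ X : B, IsEquivalence (rightUnit.app X)

section Constraints

variable {B : Type u} [Bicategory.{w, v} B] [PremonoidalBicategory B]

variable (B) in
/-- The unit object. -/
abbrev unitObj : B := TensorBicategory.unit

/-- `a : (X ⊗ Y) ⊗ Z ⟶ X ⊗ (Y ⊗ Z)` -/
def asc (X Y Z : B) : (X ⊠ Y) ⊠ Z ⟶ X ⊠ (Y ⊠ Z) :=
  (PremonoidalBicategory.assoc (B := B)).app ((X, Y), Z)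

/-- `ℓ : I ⊗ X ⟶ X` -/
def lun (X : B) : unitObj B ⊠ X ⟶ X := (PremonoidalBicategory.leftUnit (B := B)).app X

/-- `r : X ⟶ X ⊗ I` -/
def run (X : B) : X ⟶ X ⊠ unitObj B := (PremonoidalBicategory.rightUnit (B := B)).app X

/-- The pseudonaturality 2-cells of `a`. -/
def ascNat {X X' Y Y' Z Z' : B} (f : X ⟶ X') (g : Y ⟶ Y') (h : Z ⟶ Z') :
    ((f ⊠₁ g) ⊠₁ h) ≫ asc X' Y' Z' ≅ asc X Y Z ≫ (f ⊠₁ (g ⊠₁ h)) :=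
  (PremonoidalBicategory.assoc (B := B)).naturality (a := ((X, Y), Z)) (b := ((X', Y'), Z'))
    ((f, g), h)

/-- The pseudonaturality 2-cells of `ℓ`. -/
def lunNat {X X' : B} (f : X ⟶ X') : (𝟙 (unitObj B) ⊠₁ f) ≫ lun X' ≅ lun X ≫ f :=
  (PremonoidalBicategory.leftUnit (B := B)).naturality f

/-- The pseudonaturality 2-cells of `r`. -/
def runNat {X X' : B} (f : X ⟶ X') : f ≫ run X' ≅ run X ≫ (f ⊠₁ 𝟙 (unitObj B)) :=
  (PremonoidalBicategory.rightUnit (B := B)).naturality f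

end Constraints

/-- A monoidal bicategory: the pseudonatural equivalences `a`, `ℓ`, `r` come with invertible
modifications `pent`, `mid`, `left`, `right`, subject to the non-abelian 4-cocycle condition and
two normalisation conditions. -/
class MonoidalBicategory (B : Type u) [Bicategory.{w, v} B] extends PremonoidalBicategory B where
  /-- the invertible modification in the associativity pentagon -/
  pent : ∀ W X Y Z : B, (asc W X Y ⊠₁ 𝟙 Z) ≫ asc W (X ⊠ Y) Z ≫ (𝟙 W ⊠₁ asc X Y Z) ≅
    asc (W ⊠ X) Y Z ≫ asc W X (Y ⊠ Z)
  /-- the invertible modification in the middle unit triangle -/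
  mid : ∀ X Y : B, (run X ⊠₁ 𝟙 Y) ≫ asc X (unitObj B) Y ≫ (𝟙 X ⊠₁ lun Y) ≅ 𝟙 (X ⊠ Y)
  /-- the invertible modification in the left unit triangle -/
  left : ∀ X Y : B, lun X ⊠₁ 𝟙 Y ≅ asc (unitObj B) X Y ≫ lun (X ⊠ Y)
  /-- the invertible modification in the right unit triangle -/
  right : ∀ X Y : B, 𝟙 X ⊠₁ run Y ≅ run (X ⊠ Y) ≫ asc X Y (unitObj B)
  pent_naturality : ∀ {W W' X X' Y Y' Z Z' : B} (f : W ⟶ W') (g : X ⟶ X') (h : Y ⟶ Y')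
    (k : Z ⟶ Z'),
    (((f ⊠₁ g) ⊠₁ h) ⊠₁ k) ◁ (pent W' X' Y' Z').hom ≫
        (pasteSquare (ascNat (f ⊠₁ g) h k) (ascNat f g (h ⊠₁ k))).hom =
      (pasteSquare (tensorSquare (ascNat f g h) (idSquare k))
        (pasteSquare (ascNat f (g ⊠₁ h) k) (tensorSquare (idSquare f) (ascNat g h k)))).hom ≫
        (pent W X Y Z).hom ▷ (f ⊠₁ (g ⊠₁ (h ⊠₁ k)))
  mid_naturality : ∀ {X X' Y Y' : B} (f : X ⟶ X') (g : Y ⟶ Y'),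
    (f ⊠₁ g) ◁ (mid X' Y').hom ≫ (idSquare (f ⊠₁ g)).hom =
      (pasteSquare (tensorSquare (runNat f) (idSquare g))
        (pasteSquare (ascNat f (𝟙 (unitObj B)) g) (tensorSquare (idSquare f) (lunNat g)))).hom ≫
        (mid X Y).hom ▷ (f ⊠₁ g)
  left_naturality : ∀ {X X' Y Y' : B} (f : X ⟶ X') (g : Y ⟶ Y'),
    ((𝟙 (unitObj B) ⊠₁ f) ⊠₁ g) ◁ (left X' Y').hom ≫
        (pasteSquare (ascNat (𝟙 (unitObj B)) f g) (lunNat (f ⊠₁ g))).hom =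
      (tensorSquare (lunNat f) (idSquare g)).hom ≫ (left X Y).hom ▷ (f ⊠₁ g)
  right_naturality : ∀ {X X' Y Y' : B} (f : X ⟶ X') (g : Y ⟶ Y'),
    (f ⊠₁ g) ◁ (right X' Y').hom ≫
        (pasteSquare (runNat (f ⊠₁ g)) (ascNat f g (𝟙 (unitObj B)))).hom =
      (tensorSquare (idSquare f) (runNat g)).hom ≫
        (right X Y).hom ▷ (f ⊠₁ (g ⊠₁ 𝟙 (unitObj B)))
  /-- The non-abelian 4-cocycle condition: two pastings of the faces of the associahedron for
  `(((V ⊗ W) ⊗ X) ⊗ Y) ⊗ Z ⟶ V ⊗ (W ⊗ (X ⊗ (Y ⊗ Z)))` agree. -/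
  cocycle : ∀ V W X Y Z : B,
    𝟙 (((asc V W X ⊠₁ 𝟙 Y) ⊠₁ 𝟙 Z) ≫ (asc V (W ⊠ X) Y ⊠₁ 𝟙 Z) ≫ ((𝟙 V ⊠₁ asc W X Y) ⊠₁ 𝟙 Z) ≫
        asc V (W ⊠ (X ⊠ Y)) Z ≫ (𝟙 V ⊠₁ asc W (X ⊠ Y) Z) ≫ (𝟙 V ⊠₁ (𝟙 W ⊠₁ asc X Y Z))) ⊗≫
      (((asc V W X ⊠₁ 𝟙 Y) ⊠₁ 𝟙 Z) ◁ (fuseRight (asc V (W ⊠ X) Y) (𝟙 V ⊠₁ asc W X Y) Z).hom ≫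
        (fuseRight (asc V W X ⊠₁ 𝟙 Y) (asc V (W ⊠ X) Y ≫ (𝟙 V ⊠₁ asc W X Y)) Z).hom ≫
        (pent V W X Y).hom ⊠₂ 𝟙 (𝟙 Z) ≫
        (fuseRight (asc (V ⊠ W) X Y) (asc V W (X ⊠ Y)) Z).inv) ▷
          (asc V (W ⊠ (X ⊠ Y)) Z ≫ (𝟙 V ⊠₁ asc W (X ⊠ Y) Z) ≫ (𝟙 V ⊠₁ (𝟙 W ⊠₁ asc X Y Z))) ⊗≫
      (asc (V ⊠ W) X Y ⊠₁ 𝟙 Z) ◁ (pent V W (X ⊠ Y) Z).hom ▷ (𝟙 V ⊠₁ (𝟙 W ⊠₁ asc X Y Z)) ⊗≫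
      ((asc (V ⊠ W) X Y ⊠₁ 𝟙 Z) ≫ asc (V ⊠ W) (X ⊠ Y) Z) ◁
        ((ascNat (𝟙 V) (𝟙 W) (asc X Y Z)).inv ≫
          ((tensorId V W).hom ⊠₂ 𝟙 (asc X Y Z)) ▷ asc V W (X ⊠ (Y ⊠ Z))) ⊗≫
      (pent (V ⊠ W) X Y Z).hom ▷ asc V W (X ⊠ (Y ⊠ Z)) ⊗≫
    𝟙 (asc ((V ⊠ W) ⊠ X) Y Z ≫ asc (V ⊠ W) X (Y ⊠ Z) ≫ asc V W (X ⊠ (Y ⊠ Z))) =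
    𝟙 (((asc V W X ⊠₁ 𝟙 Y) ⊠₁ 𝟙 Z) ≫ (asc V (W ⊠ X) Y ⊠₁ 𝟙 Z) ≫ ((𝟙 V ⊠₁ asc W X Y) ⊠₁ 𝟙 Z) ≫
        asc V (W ⊠ (X ⊠ Y)) Z ≫ (𝟙 V ⊠₁ asc W (X ⊠ Y) Z) ≫ (𝟙 V ⊠₁ (𝟙 W ⊠₁ asc X Y Z))) ⊗≫
      (((asc V W X ⊠₁ 𝟙 Y) ⊠₁ 𝟙 Z) ≫ (asc V (W ⊠ X) Y ⊠₁ 𝟙 Z)) ◁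
        (ascNat (𝟙 V) (asc W X Y) (𝟙 Z)).hom ▷
          ((𝟙 V ⊠₁ asc W (X ⊠ Y) Z) ≫ (𝟙 V ⊠₁ (𝟙 W ⊠₁ asc X Y Z))) ⊗≫
      (((asc V W X ⊠₁ 𝟙 Y) ⊠₁ 𝟙 Z) ≫ (asc V (W ⊠ X) Y ⊠₁ 𝟙 Z) ≫ asc V ((W ⊠ X) ⊠ Y) Z) ◁
        ((𝟙 V ⊠₁ (asc W X Y ⊠₁ 𝟙 Z)) ◁
            (fuseLeft V (asc W (X ⊠ Y) Z) (𝟙 W ⊠₁ asc X Y Z)).hom ≫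
          (fuseLeft V (asc W X Y ⊠₁ 𝟙 Z) (asc W (X ⊠ Y) Z ≫ (𝟙 W ⊠₁ asc X Y Z))).hom ≫
          𝟙 (𝟙 V) ⊠₂ (pent W X Y Z).hom ≫
          (fuseLeft V (asc (W ⊠ X) Y Z) (asc W X (Y ⊠ Z))).inv) ⊗≫
      ((asc V W X ⊠₁ 𝟙 Y) ⊠₁ 𝟙 Z) ◁ (pent V (W ⊠ X) Y Z).hom ▷ (𝟙 V ⊠₁ asc W X (Y ⊠ Z)) ⊗≫
      ((ascNat (asc V W X) (𝟙 Y) (𝟙 Z)).hom ≫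
          asc ((V ⊠ W) ⊠ X) Y Z ◁ (𝟙 (asc V W X) ⊠₂ (tensorId Y Z).hom)) ▷
        (asc V (W ⊠ X) (Y ⊠ Z) ≫ (𝟙 V ⊠₁ asc W X (Y ⊠ Z))) ⊗≫
      asc ((V ⊠ W) ⊠ X) Y Z ◁ (pent V W X (Y ⊠ Z)).hom ⊗≫
    𝟙 (asc ((V ⊠ W) ⊠ X) Y Z ≫ asc (V ⊠ W) X (Y ⊠ Z) ≫ asc V W (X ⊠ (Y ⊠ Z)))
  /-- The left normalisation condition. -/
  left_normalisation : ∀ X Y Z : B,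
    𝟙 (((run X ⊠₁ 𝟙 Y) ⊠₁ 𝟙 Z) ≫ (asc X (unitObj B) Y ⊠₁ 𝟙 Z) ≫ asc X (unitObj B ⊠ Y) Z ≫
        (𝟙 X ⊠₁ asc (unitObj B) Y Z) ≫ (𝟙 X ⊠₁ lun (Y ⊠ Z))) ⊗≫
      ((run X ⊠₁ 𝟙 Y) ⊠₁ 𝟙 Z) ◁ (pent X (unitObj B) Y Z).hom ▷ (𝟙 X ⊠₁ lun (Y ⊠ Z)) ⊗≫
      ((ascNat (run X) (𝟙 Y) (𝟙 Z)).hom ≫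
          asc X Y Z ◁ (𝟙 (run X) ⊠₂ (tensorId Y Z).hom)) ▷
        (asc X (unitObj B) (Y ⊠ Z) ≫ (𝟙 X ⊠₁ lun (Y ⊠ Z))) ⊗≫
      asc X Y Z ◁ (mid X (Y ⊠ Z)).hom ⊗≫
    𝟙 (asc X Y Z) =
    𝟙 (((run X ⊠₁ 𝟙 Y) ⊠₁ 𝟙 Z) ≫ (asc X (unitObj B) Y ⊠₁ 𝟙 Z) ≫ asc X (unitObj B ⊠ Y) Z ≫
        (𝟙 X ⊠₁ asc (unitObj B) Y Z) ≫ (𝟙 X ⊠₁ lun (Y ⊠ Z))) ⊗≫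
      (((run X ⊠₁ 𝟙 Y) ⊠₁ 𝟙 Z) ≫ (asc X (unitObj B) Y ⊠₁ 𝟙 Z) ≫ asc X (unitObj B ⊠ Y) Z) ◁
        ((fuseLeft X (asc (unitObj B) Y Z) (lun (Y ⊠ Z))).hom ≫ 𝟙 (𝟙 X) ⊠₂ (left Y Z).inv) ⊗≫
      (((run X ⊠₁ 𝟙 Y) ⊠₁ 𝟙 Z) ≫ (asc X (unitObj B) Y ⊠₁ 𝟙 Z)) ◁
        (ascNat (𝟙 X) (lun Y) (𝟙 Z)).inv ⊗≫
      (((run X ⊠₁ 𝟙 Y) ⊠₁ 𝟙 Z) ◁ (fuseRight (asc X (unitObj B) Y) (𝟙 X ⊠₁ lun Y) Z).hom ≫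
        (fuseRight (run X ⊠₁ 𝟙 Y) (asc X (unitObj B) Y ≫ (𝟙 X ⊠₁ lun Y)) Z).hom ≫
        (mid X Y).hom ⊠₂ 𝟙 (𝟙 Z) ≫ (tensorId (X ⊠ Y) Z).hom) ▷ asc X Y Z ⊗≫
    𝟙 (asc X Y Z)
  /-- The right normalisation condition. -/
  right_normalisation : ∀ X Y Z : B,
    𝟙 ((run (X ⊠ Y) ⊠₁ 𝟙 Z) ≫ (asc X Y (unitObj B) ⊠₁ 𝟙 Z) ≫ asc X (Y ⊠ unitObj B) Z ≫
        (𝟙 X ⊠₁ asc Y (unitObj B) Z) ≫ (𝟙 X ⊠₁ (𝟙 Y ⊠₁ lun Z))) ⊗≫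
      (run (X ⊠ Y) ⊠₁ 𝟙 Z) ◁ (pent X Y (unitObj B) Z).hom ▷ (𝟙 X ⊠₁ (𝟙 Y ⊠₁ lun Z)) ⊗≫
      ((run (X ⊠ Y) ⊠₁ 𝟙 Z) ≫ asc (X ⊠ Y) (unitObj B) Z) ◁
        ((ascNat (𝟙 X) (𝟙 Y) (lun Z)).inv ≫
          ((tensorId X Y).hom ⊠₂ 𝟙 (lun Z)) ▷ asc X Y Z) ⊗≫
      (mid (X ⊠ Y) Z).hom ▷ asc X Y Z ⊗≫
    𝟙 (asc X Y Z) =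
    𝟙 ((run (X ⊠ Y) ⊠₁ 𝟙 Z) ≫ (asc X Y (unitObj B) ⊠₁ 𝟙 Z) ≫ asc X (Y ⊠ unitObj B) Z ≫
        (𝟙 X ⊠₁ asc Y (unitObj B) Z) ≫ (𝟙 X ⊠₁ (𝟙 Y ⊠₁ lun Z))) ⊗≫
      ((fuseRight (run (X ⊠ Y)) (asc X Y (unitObj B)) Z).hom ≫ (right X Y).inv ⊠₂ 𝟙 (𝟙 Z)) ▷
        (asc X (Y ⊠ unitObj B) Z ≫ (𝟙 X ⊠₁ asc Y (unitObj B) Z) ≫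
          (𝟙 X ⊠₁ (𝟙 Y ⊠₁ lun Z))) ⊗≫
      (ascNat (𝟙 X) (run Y) (𝟙 Z)).hom ▷
        ((𝟙 X ⊠₁ asc Y (unitObj B) Z) ≫ (𝟙 X ⊠₁ (𝟙 Y ⊠₁ lun Z))) ⊗≫
      asc X Y Z ◁
        ((𝟙 X ⊠₁ (run Y ⊠₁ 𝟙 Z)) ◁ (fuseLeft X (asc Y (unitObj B) Z) (𝟙 Y ⊠₁ lun Z)).hom ≫
          (fuseLeft X (run Y ⊠₁ 𝟙 Z) (asc Y (unitObj B) Z ≫ (𝟙 Y ⊠₁ lun Z))).hom ≫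
          𝟙 (𝟙 X) ⊠₂ (mid Y Z).hom ≫ (tensorId X (Y ⊠ Z)).hom) ⊗≫
    𝟙 (asc X Y Z)

/-! ### Cancelling an equivalence -/

section Cancel

variable {B : Type u} [Bicategory.{w, v} B] {X : B}

theorem IsEquivalence.exists_iso {Y : B} {f : X ⟶ Y} (h : IsEquivalence f) :
    ∃ g : Y ⟶ X, Nonempty (f ≫ g ≅ 𝟙 X) := by
  obtain ⟨g, hg, -⟩ := h
  exact ⟨g, hg⟩

theorem IsEquivalence.comp {Y Z : B} {f : X ⟶ Y} {f' : Y ⟶ Z} (h : IsEquivalence f)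
    (h' : IsEquivalence f') : IsEquivalence (f ≫ f') := by
  obtain ⟨g, ⟨i⟩, ⟨j⟩⟩ := h
  obtain ⟨g', ⟨i'⟩, ⟨j'⟩⟩ := h'
  exact ⟨g' ≫ g,
    ⟨α_ f f' _ ≪≫ whiskerLeftIso f ((α_ f' g' g).symm ≪≫ whiskerRightIso i' g ≪≫ λ_ g) ≪≫ i⟩,
    ⟨α_ g' g _ ≪≫ whiskerLeftIso g' ((α_ g f f').symm ≪≫ whiskerRightIso j f' ≪≫ λ_ f') ≪≫ j'⟩⟩

/-- For an equivalence `e`, the 2-cell `e ≅ 1` obtained from a 2-cell `e e ≅ e` by cancelling `e`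
on the right.  It is the only 2-cell with the property in `cancelRight_spec`; in particular it
does not depend on the choice of an inverse of `e`. -/
noncomputable def cancelRight {e : X ⟶ X} (he : IsEquivalence e) (φ : e ≫ e ≅ e) : e ≅ 𝟙 X :=
  (ρ_ e).symm ≪≫ whiskerLeftIso e he.exists_iso.choose_spec.some.symm ≪≫ (α_ _ _ _).symm ≪≫
    whiskerRightIso φ he.exists_iso.choose ≪≫ he.exists_iso.choose_spec.some

theorem cancelRight_unique {e : X ⟶ X} (he : IsEquivalence e) (φ : e ≫ e ≅ e) (ψ : e ≅ 𝟙 X)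
    (h : ψ.hom ▷ e ≫ (λ_ e).hom = φ.hom) : cancelRight he φ = ψ := by
  ext
  have key : ∀ (g : X ⟶ X) (i : e ≫ g ≅ 𝟙 X), (ρ_ e).inv ≫ e ◁ i.inv ≫ (α_ _ _ _).inv ≫
      (ψ.hom ▷ e ≫ (λ_ e).hom) ▷ g ≫ i.hom = ψ.hom := by
    intro g i
    have h₁ : e ◁ i.inv ≫ (α_ _ _ _).inv ≫ (ψ.hom ▷ e ≫ (λ_ e).hom) ▷ g ≫ i.hom =
        (e ◁ i.inv ≫ ψ.hom ▷ (e ≫ g)) ≫ (λ_ _).hom ≫ i.hom := by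
      simp
    rw [h₁, whisker_exchange]
    simp
  have h₂ := key _ he.exists_iso.choose_spec.some
  rw [h] at h₂
  exact h₂

theorem cancelRight_spec {e : X ⟶ X} (he : IsEquivalence e) (φ : e ≫ e ≅ e) :
    (cancelRight he φ).hom ▷ e ≫ (λ_ e).hom = φ.hom := by
  obtain ⟨g, ⟨i⟩, ⟨i'⟩⟩ := id he
  have h₁ : ∀ (x y : X ⟶ X) (η : x ⟶ y), η ≫ (ρ_ y).inv ≫ y ◁ i.inv ≫ (α_ y e g).inv =
      (ρ_ x).inv ≫ x ◁ i.inv ≫ (α_ x e g).inv ≫ η ▷ e ▷ g := by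
    intro x y η
    rw [← associator_inv_naturality_left, whisker_exchange_assoc,
      ← rightUnitor_inv_naturality_assoc]
  have h₂ : ∀ (x y : X ⟶ X) (η : x ⟶ y), η ▷ g ▷ e ≫ (α_ y g e).hom ≫ y ◁ i'.hom ≫ (ρ_ y).hom =
      (α_ x g e).hom ≫ x ◁ i'.hom ≫ (ρ_ x).hom ≫ η := by
    intro x y η
    rw [associator_naturality_left_assoc, ← whisker_exchange_assoc, rightUnitor_naturality]
  let F : (X ⟶ X) ⥤ (X ⟶ X) := { obj := fun x => x ≫ e, map := fun η => η ▷ e }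
  let G : (X ⟶ X) ⥤ (X ⟶ X) := { obj := fun x => x ≫ g, map := fun η => η ▷ g }
  let Q : (X ⟶ X) ≌ (X ⟶ X) :=
    CategoryTheory.Equivalence.mk F G
      (NatIso.ofComponents (fun x => (ρ_ x).symm ≪≫ whiskerLeftIso x i.symm ≪≫ (α_ _ _ _).symm)
        (by
          intro x y η
          simpa [F, G] using h₁ x y η))
      (NatIso.ofComponents (fun x => α_ _ _ _ ≪≫ whiskerLeftIso x i' ≪≫ ρ_ x)
        (by
          intro x y η
          simpa [F, G] using h₂ x y η))
  let hF : F.FullyFaithful := Q.fullyFaithfulFunctor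
  let ψ : e ≅ 𝟙 X := hF.preimageIso (φ ≪≫ (λ_ e).symm)
  have h : ψ.hom ▷ e = φ.hom ≫ (λ_ e).inv := hF.map_preimage _
  have h' : ψ.hom ▷ e ≫ (λ_ e).hom = φ.hom := by
    rw [h]; simp
  rw [cancelRight_unique he φ ψ h', h']

end Cancel

/-! ### The canonical 2-cell `r_I ℓ_I ≅ 1` -/

section UnitCell

variable (B : Type u) [Bicategory.{w, v} B] [MonoidalBicategory B]

/-- The composite `e : I ⟶ I ⊗ I ⟶ I` of `r` and `ℓ`. -/
def unitLoop : unitObj B ⟶ unitObj B := run (unitObj B) ≫ lun (unitObj B)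

/-- The constraint 2-cell `e e ≅ e`, built from the pseudonaturality of `r` at `e`, the cell
`left` at `I, I`, the pseudonaturality of `ℓ` at `ℓ`, and the cell `mid` at `I, I`. -/
def unitLoopComp : unitLoop B ≫ unitLoop B ≅ unitLoop B :=
  (α_ (unitLoop B) (run (unitObj B)) (lun (unitObj B))).symm ≪≫
  whiskerRightIso (runNat (unitLoop B)) (lun (unitObj B)) ≪≫
  α_ (run (unitObj B)) (unitLoop B ⊠₁ 𝟙 (unitObj B)) (lun (unitObj B)) ≪≫
  whiskerLeftIso (run (unitObj B))
    (whiskerRightIso ((fuseRight (run (unitObj B)) (lun (unitObj B)) (unitObj B)).symm ≪≫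
        whiskerLeftIso (run (unitObj B) ⊠₁ 𝟙 (unitObj B))
          (MonoidalBicategory.left (unitObj B) (unitObj B))) (lun (unitObj B)) ≪≫
      α_ _ _ _ ≪≫
      whiskerLeftIso (run (unitObj B) ⊠₁ 𝟙 (unitObj B)) (α_ _ _ _ ≪≫
        whiskerLeftIso (asc (unitObj B) (unitObj B) (unitObj B))
          (lunNat (lun (unitObj B))).symm ≪≫ (α_ _ _ _).symm) ≪≫
      (α_ _ _ _).symm ≪≫
      whiskerRightIso (MonoidalBicategory.mid (unitObj B) (unitObj B)) (lun (unitObj B)) ≪≫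
      λ_ (lun (unitObj B)))

theorem unitLoop_isEquivalence : IsEquivalence (unitLoop B) :=
  IsEquivalence.comp (PremonoidalBicategory.rightUnit_isEquivalence (unitObj B))
    (PremonoidalBicategory.leftUnit_isEquivalence (unitObj B))

/-- The canonical 2-cell `r_I ℓ_I ≅ 1`, obtained from `e e ≅ e` by cancelling the equivalence
`e = r_I ℓ_I` on the right. -/
noncomputable def unitCell : run (unitObj B) ≫ lun (unitObj B) ≅ 𝟙 (unitObj B) :=
  cancelRight (unitLoop_isEquivalence B) (unitLoopComp B)

end UnitCell

/-! ### Left skew monoidales -/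

section Skew

variable {B : Type u} [Bicategory.{w, v} B] [MonoidalBicategory B]

/-- The data of a left skew-monoidal structure on an object `A`. -/
@[ext]
structure SkewMonoidalData (A : B) where
  /-- the tensor product -/
  p : A ⊠ A ⟶ A
  /-- the unit -/
  j : unitObj B ⟶ A
  /-- the associativity constraint -/
  assoc : (p ⊠₁ 𝟙 A) ≫ p ⟶ asc A A A ≫ (𝟙 A ⊠₁ p) ≫ p
  /-- the left unit constraint -/
  left : (j ⊠₁ 𝟙 A) ≫ p ⟶ lun A
  /-- the right unit constraint -/
  right : 𝟙 A ⟶ run A ≫ (𝟙 A ⊠₁ j) ≫ p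

/-- The five axioms of a left skew-monoidal structure. -/
structure SkewMonoidalData.IsLeftSkewMonoidal {A : B} (S : SkewMonoidalData A) : Prop where
  /-- the pentagon -/
  pentagon :
    𝟙 (((S.p ⊠₁ 𝟙 A) ⊠₁ 𝟙 A) ≫ (S.p ⊠₁ 𝟙 A) ≫ S.p) ⊗≫
      ((fuseRight (S.p ⊠₁ 𝟙 A) S.p A).hom ≫ S.assoc ⊠₂ 𝟙 (𝟙 A) ≫
        (fuseRight (asc A A A) ((𝟙 A ⊠₁ S.p) ≫ S.p) A).inv ≫
        (asc A A A ⊠₁ 𝟙 A) ◁ (fuseRight (𝟙 A ⊠₁ S.p) S.p A).inv) ▷ S.p ⊗≫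
      ((asc A A A ⊠₁ 𝟙 A) ≫ ((𝟙 A ⊠₁ S.p) ⊠₁ 𝟙 A)) ◁ S.assoc ⊗≫
      (asc A A A ⊠₁ 𝟙 A) ◁ (ascNat (𝟙 A) S.p (𝟙 A)).hom ▷ ((𝟙 A ⊠₁ S.p) ≫ S.p) ⊗≫
      ((asc A A A ⊠₁ 𝟙 A) ≫ asc A (A ⊠ A) A) ◁
        ((fuseLeft A (S.p ⊠₁ 𝟙 A) S.p).hom ≫ 𝟙 (𝟙 A) ⊠₂ S.assoc ≫
          (fuseLeft A (asc A A A) ((𝟙 A ⊠₁ S.p) ≫ S.p)).inv ≫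
          (𝟙 A ⊠₁ asc A A A) ◁ (fuseLeft A (𝟙 A ⊠₁ S.p) S.p).inv) ▷ S.p ⊗≫
      (MonoidalBicategory.pent A A A A).hom ▷ ((𝟙 A ⊠₁ (𝟙 A ⊠₁ S.p)) ≫ (𝟙 A ⊠₁ S.p) ≫ S.p) ⊗≫
    𝟙 (asc (A ⊠ A) A A ≫ asc A A (A ⊠ A) ≫ (𝟙 A ⊠₁ (𝟙 A ⊠₁ S.p)) ≫ (𝟙 A ⊠₁ S.p) ≫ S.p) =
    𝟙 (((S.p ⊠₁ 𝟙 A) ⊠₁ 𝟙 A) ≫ (S.p ⊠₁ 𝟙 A) ≫ S.p) ⊗≫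
      ((S.p ⊠₁ 𝟙 A) ⊠₁ 𝟙 A) ◁ S.assoc ⊗≫
      ((ascNat S.p (𝟙 A) (𝟙 A)).hom ≫ asc (A ⊠ A) A A ◁ (𝟙 S.p ⊠₂ (tensorId A A).hom)) ▷
        ((𝟙 A ⊠₁ S.p) ≫ S.p) ⊗≫
      asc (A ⊠ A) A A ◁ (interchange S.p S.p).hom ▷ S.p ⊗≫
      (asc (A ⊠ A) A A ≫ (𝟙 (A ⊠ A) ⊠₁ S.p)) ◁ S.assoc ⊗≫
      asc (A ⊠ A) A A ◁ (((tensorId A A).inv ⊠₂ 𝟙 S.p) ▷ asc A A A ≫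
        (ascNat (𝟙 A) (𝟙 A) S.p).hom) ▷ ((𝟙 A ⊠₁ S.p) ≫ S.p) ⊗≫
    𝟙 (asc (A ⊠ A) A A ≫ asc A A (A ⊠ A) ≫ (𝟙 A ⊠₁ (𝟙 A ⊠₁ S.p)) ≫ (𝟙 A ⊠₁ S.p) ≫ S.p)
  /-- the compatibility of both unit constraints with the associativity constraint -/
  middle_unit :
    𝟙 S.p ⊗≫
      ((tensorId A A).inv ≫ S.right ⊠₂ 𝟙 (𝟙 A) ≫ (fuseRight (run A) ((𝟙 A ⊠₁ S.j) ≫ S.p) A).inv ≫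
        (run A ⊠₁ 𝟙 A) ◁ (fuseRight (𝟙 A ⊠₁ S.j) S.p A).inv) ▷ S.p ⊗≫
      ((run A ⊠₁ 𝟙 A) ≫ ((𝟙 A ⊠₁ S.j) ⊠₁ 𝟙 A)) ◁ S.assoc ⊗≫
      (run A ⊠₁ 𝟙 A) ◁ (ascNat (𝟙 A) S.j (𝟙 A)).hom ▷ ((𝟙 A ⊠₁ S.p) ≫ S.p) ⊗≫
      ((run A ⊠₁ 𝟙 A) ≫ asc A (unitObj B) A) ◁
        ((fuseLeft A (S.j ⊠₁ 𝟙 A) S.p).hom ≫ 𝟙 (𝟙 A) ⊠₂ S.left) ▷ S.p ⊗≫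
      (MonoidalBicategory.mid A A).hom ▷ S.p ⊗≫
    𝟙 S.p = 𝟙 S.p
  /-- the compatibility of the left unit constraint with the associativity constraint -/
  left_unit :
    𝟙 (((S.j ⊠₁ 𝟙 A) ⊠₁ 𝟙 A) ≫ (S.p ⊠₁ 𝟙 A) ≫ S.p) ⊗≫
      ((S.j ⊠₁ 𝟙 A) ⊠₁ 𝟙 A) ◁ S.assoc ⊗≫
      ((ascNat S.j (𝟙 A) (𝟙 A)).hom ≫
          asc (unitObj B) A A ◁ (𝟙 S.j ⊠₂ (tensorId A A).hom)) ▷ ((𝟙 A ⊠₁ S.p) ≫ S.p) ⊗≫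
      asc (unitObj B) A A ◁ (interchange S.j S.p).hom ▷ S.p ⊗≫
      (asc (unitObj B) A A ≫ (𝟙 (unitObj B) ⊠₁ S.p)) ◁ S.left ⊗≫
      asc (unitObj B) A A ◁ (lunNat S.p).hom ⊗≫
      (MonoidalBicategory.left A A).inv ▷ S.p ⊗≫
    𝟙 ((lun A ⊠₁ 𝟙 A) ≫ S.p) =
    𝟙 (((S.j ⊠₁ 𝟙 A) ⊠₁ 𝟙 A) ≫ (S.p ⊠₁ 𝟙 A) ≫ S.p) ⊗≫
      ((fuseRight (S.j ⊠₁ 𝟙 A) S.p A).hom ≫ S.left ⊠₂ 𝟙 (𝟙 A)) ▷ S.p ⊗≫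
    𝟙 ((lun A ⊠₁ 𝟙 A) ≫ S.p)
  /-- the compatibility of the right unit constraint with the associativity constraint -/
  right_unit :
    𝟙 S.p ⊗≫
      S.p ◁ S.right ⊗≫
      (runNat S.p).hom ▷ ((𝟙 A ⊠₁ S.j) ≫ S.p) ⊗≫
      run (A ⊠ A) ◁ (interchange S.p S.j).hom ▷ S.p ⊗≫
      (run (A ⊠ A) ≫ (𝟙 (A ⊠ A) ⊠₁ S.j)) ◁ S.assoc ⊗≫
      run (A ⊠ A) ◁ (((tensorId A A).inv ⊠₂ 𝟙 S.j) ▷ asc A A A ≫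
        (ascNat (𝟙 A) (𝟙 A) S.j).hom) ▷ ((𝟙 A ⊠₁ S.p) ≫ S.p) ⊗≫
      (MonoidalBicategory.right A A).inv ▷
        ((𝟙 A ⊠₁ (𝟙 A ⊠₁ S.j)) ≫ (𝟙 A ⊠₁ S.p) ≫ S.p) ⊗≫
    𝟙 ((𝟙 A ⊠₁ run A) ≫ (𝟙 A ⊠₁ (𝟙 A ⊠₁ S.j)) ≫ (𝟙 A ⊠₁ S.p) ≫ S.p) =
    𝟙 S.p ⊗≫
      ((tensorId A A).inv ≫ 𝟙 (𝟙 A) ⊠₂ S.right ≫ (fuseLeft A (run A) ((𝟙 A ⊠₁ S.j) ≫ S.p)).inv ≫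
        (𝟙 A ⊠₁ run A) ◁ (fuseLeft A (𝟙 A ⊠₁ S.j) S.p).inv) ▷ S.p ⊗≫
    𝟙 ((𝟙 A ⊠₁ run A) ≫ (𝟙 A ⊠₁ (𝟙 A ⊠₁ S.j)) ≫ (𝟙 A ⊠₁ S.p) ≫ S.p)
  /-- the compatibility of the two unit constraints with each other -/
  unit_unit :
    𝟙 S.j ⊗≫
      S.j ◁ S.right ⊗≫
      (runNat S.j).hom ▷ ((𝟙 A ⊠₁ S.j) ≫ S.p) ⊗≫
      run (unitObj B) ◁ (interchange S.j S.j).hom ▷ S.p ⊗≫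
      (run (unitObj B) ≫ (𝟙 (unitObj B) ⊠₁ S.j)) ◁ S.left ⊗≫
      run (unitObj B) ◁ (lunNat S.j).hom ⊗≫
      (unitCell B).hom ▷ S.j ⊗≫
    𝟙 S.j = 𝟙 S.j

/-- A left skew-monoidal structure on an object `A`; with it, `A` is a left skew monoidale. -/
structure LeftSkewMonoidale (A : B) extends SkewMonoidalData A where
  isLeftSkewMonoidal : toSkewMonoidalData.IsLeftSkewMonoidal

/-! ### Opmonoidal morphisms -/

/-- `(f, ψ₀, ψ)` is an opmonoidal morphism `(A, p, j) ⟶ (A', p', j')`. -/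
structure IsOpmonoidalMorphism {A A' : B} (S : SkewMonoidalData A) (S' : SkewMonoidalData A')
    (f : A ⟶ A') (ψ₀ : S.j ≫ f ⟶ S'.j) (ψ : S.p ≫ f ⟶ (f ⊠₁ f) ≫ S'.p) : Prop where
  /-- compatibility with the associativity constraints -/
  comp_assoc :
    𝟙 ((S.p ⊠₁ 𝟙 A) ≫ S.p ≫ f) ⊗≫
      S.assoc ▷ f ⊗≫
      (asc A A A ≫ (𝟙 A ⊠₁ S.p)) ◁ ψ ⊗≫
      asc A A A ◁ ((fuse (λ_ f) (Iso.refl (S.p ≫ f))).hom ≫ 𝟙 f ⊠₂ ψ) ▷ S'.p ⊗≫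
    𝟙 (asc A A A ≫ (f ⊠₁ ((f ⊠₁ f) ≫ S'.p)) ≫ S'.p) =
    𝟙 ((S.p ⊠₁ 𝟙 A) ≫ S.p ≫ f) ⊗≫
      (S.p ⊠₁ 𝟙 A) ◁ ψ ⊗≫
      ((fuse (Iso.refl (S.p ≫ f)) (λ_ f)).hom ≫ ψ ⊠₂ 𝟙 f ≫
        (fuse (Iso.refl ((f ⊠₁ f) ≫ S'.p)) (ρ_ f)).inv) ▷ S'.p ⊗≫
      ((f ⊠₁ f) ⊠₁ f) ◁ S'.assoc ⊗≫
      (ascNat f f f).hom ▷ ((𝟙 A' ⊠₁ S'.p) ≫ S'.p) ⊗≫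
      asc A A A ◁ (fuse (ρ_ f) (Iso.refl ((f ⊠₁ f) ≫ S'.p))).hom ▷ S'.p ⊗≫
    𝟙 (asc A A A ≫ (f ⊠₁ ((f ⊠₁ f) ≫ S'.p)) ≫ S'.p)
  /-- compatibility with the left unit constraints -/
  comp_left :
    𝟙 ((S.j ⊠₁ 𝟙 A) ≫ S.p ≫ f) ⊗≫
      (S.j ⊠₁ 𝟙 A) ◁ ψ ⊗≫
      ((fuse (Iso.refl (S.j ≫ f)) (λ_ f)).hom ≫ ψ₀ ⊠₂ 𝟙 f ≫ (fuse (λ_ S'.j) (ρ_ f)).inv) ▷ S'.p ⊗≫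
      (𝟙 (unitObj B) ⊠₁ f) ◁ S'.left ⊗≫
      (lunNat f).hom ⊗≫
    𝟙 (lun A ≫ f) =
    𝟙 ((S.j ⊠₁ 𝟙 A) ≫ S.p ≫ f) ⊗≫ S.left ▷ f ⊗≫ 𝟙 (lun A ≫ f)
  /-- compatibility with the right unit constraints -/
  comp_right :
    𝟙 f ⊗≫
      S.right ▷ f ⊗≫
      (run A ≫ (𝟙 A ⊠₁ S.j)) ◁ ψ ⊗≫
      run A ◁ ((fuse (λ_ f) (Iso.refl (S.j ≫ f))).hom ≫ 𝟙 f ⊠₂ ψ₀) ▷ S'.p ⊗≫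
    𝟙 (run A ≫ (f ⊠₁ S'.j) ≫ S'.p) =
    𝟙 f ⊗≫
      f ◁ S'.right ⊗≫
      (runNat f).hom ▷ ((𝟙 A' ⊠₁ S'.j) ≫ S'.p) ⊗≫
      run A ◁ (fuse (ρ_ f) (λ_ S'.j)).hom ▷ S'.p ⊗≫
    𝟙 (run A ≫ (f ⊠₁ S'.j) ≫ S'.p)

/-! ### Skew left warpings -/

/-- A skew left warping `(t, k, v, v₀, κ)` of a left skew monoidale.  For `Cat` with the cartesian
product the five axioms are the commutativity of the diagrams
* `T(T(TA⊗B)⊗C) ⟶ TA⊗(TB⊗TC)`,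
* `T(TK⊗B) ⟶ TB`,
* `TA ⟶ TA⊗I`,
* `TA⊗B ⟶ TA⊗(TB⊗K)`,
* `K ⟶ K`. -/
structure SkewLeftWarping {A : B} (S : LeftSkewMonoidale A) where
  t : A ⟶ A
  k : unitObj B ⟶ A
  v : ((t ⊠₁ 𝟙 A) ≫ S.p) ≫ t ⟶ (t ⊠₁ t) ≫ S.p
  v₀ : k ≫ t ⟶ S.j
  κ : 𝟙 A ⟶ run A ≫ (t ⊠₁ k) ≫ S.p
  warp_assoc :
    𝟙 ((((t ⊠₁ 𝟙 A) ≫ S.p) ⊠₁ 𝟙 A) ≫ (t ⊠₁ 𝟙 A) ≫ S.p ≫ t) ⊗≫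
      (((t ⊠₁ 𝟙 A) ≫ S.p) ⊠₁ 𝟙 A) ◁ v ⊗≫
      ((fuse (Iso.refl (((t ⊠₁ 𝟙 A) ≫ S.p) ≫ t)) (λ_ t)).hom ≫ v ⊠₂ 𝟙 t ≫
        (fuse (Iso.refl ((t ⊠₁ t) ≫ S.p)) (ρ_ t)).inv) ▷ S.p ⊗≫
      ((t ⊠₁ t) ⊠₁ t) ◁ S.assoc ⊗≫
      (ascNat t t t).hom ▷ ((𝟙 A ⊠₁ S.p) ≫ S.p) ⊗≫
    𝟙 (asc A A A ≫ (t ⊠₁ (t ⊠₁ t)) ≫ (𝟙 A ⊠₁ S.p) ≫ S.p) =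
    𝟙 ((((t ⊠₁ 𝟙 A) ≫ S.p) ⊠₁ 𝟙 A) ≫ (t ⊠₁ 𝟙 A) ≫ S.p ≫ t) ⊗≫
      ((fuseRight ((t ⊠₁ 𝟙 A) ≫ S.p) t A).hom ≫ v ⊠₂ 𝟙 (𝟙 A) ≫
        (fuseRight (t ⊠₁ t) S.p A).inv) ▷ (S.p ≫ t) ⊗≫
      ((t ⊠₁ t) ⊠₁ 𝟙 A) ◁ S.assoc ▷ t ⊗≫
      (ascNat t t (𝟙 A)).hom ▷ ((𝟙 A ⊠₁ S.p) ≫ S.p ≫ t) ⊗≫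
      asc A A A ◁ ((fuse (ρ_ t) (Iso.refl ((t ⊠₁ 𝟙 A) ≫ S.p))).hom ≫
        (fuse (λ_ t) (ρ_ ((t ⊠₁ 𝟙 A) ≫ S.p))).inv) ▷ (S.p ≫ t) ⊗≫
      (asc A A A ≫ (𝟙 A ⊠₁ ((t ⊠₁ 𝟙 A) ≫ S.p))) ◁ v ⊗≫
      asc A A A ◁ ((fuse (λ_ t) (Iso.refl (((t ⊠₁ 𝟙 A) ≫ S.p) ≫ t))).hom ≫ 𝟙 t ⊠₂ v ≫
        (fuse (ρ_ t) (Iso.refl ((t ⊠₁ t) ≫ S.p))).inv) ▷ S.p ⊗≫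
    𝟙 (asc A A A ≫ (t ⊠₁ (t ⊠₁ t)) ≫ (𝟙 A ⊠₁ S.p) ≫ S.p)
  warp_left :
    𝟙 ((k ⊠₁ 𝟙 A) ≫ (t ⊠₁ 𝟙 A) ≫ S.p ≫ t) ⊗≫
      (k ⊠₁ 𝟙 A) ◁ v ⊗≫
      ((fuse (Iso.refl (k ≫ t)) (λ_ t)).hom ≫ v₀ ⊠₂ 𝟙 t ≫ (fuse (λ_ S.j) (ρ_ t)).inv) ▷ S.p ⊗≫
      (𝟙 (unitObj B) ⊠₁ t) ◁ S.left ⊗≫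
      (lunNat t).hom ⊗≫
    𝟙 (lun A ≫ t) =
    𝟙 ((k ⊠₁ 𝟙 A) ≫ (t ⊠₁ 𝟙 A) ≫ S.p ≫ t) ⊗≫
      ((fuseRight k t A).hom ≫ v₀ ⊠₂ 𝟙 (𝟙 A)) ▷ (S.p ≫ t) ⊗≫
      S.left ▷ t ⊗≫
    𝟙 (lun A ≫ t)
  warp_right :
    𝟙 t ⊗≫
      κ ▷ t ⊗≫
      run A ◁ (fuse (λ_ t) (ρ_ k)).inv ▷ (S.p ≫ t) ⊗≫
      (run A ≫ (𝟙 A ⊠₁ k)) ◁ v ⊗≫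
      run A ◁ ((fuse (λ_ t) (Iso.refl (k ≫ t))).hom ≫ 𝟙 t ⊠₂ v₀) ▷ S.p ⊗≫
    𝟙 (run A ≫ (t ⊠₁ S.j) ≫ S.p) =
    𝟙 t ⊗≫
      t ◁ S.right ⊗≫
      (runNat t).hom ▷ ((𝟙 A ⊠₁ S.j) ≫ S.p) ⊗≫
      run A ◁ (fuse (ρ_ t) (λ_ S.j)).hom ▷ S.p ⊗≫
    𝟙 (run A ≫ (t ⊠₁ S.j) ≫ S.p)
  warp_tensor :
    𝟙 ((t ⊠₁ 𝟙 A) ≫ S.p) ⊗≫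
      ((t ⊠₁ 𝟙 A) ≫ S.p) ◁ κ ⊗≫
      (runNat ((t ⊠₁ 𝟙 A) ≫ S.p)).hom ▷ ((t ⊠₁ k) ≫ S.p) ⊗≫
      run (A ⊠ A) ◁ ((fuse (Iso.refl (((t ⊠₁ 𝟙 A) ≫ S.p) ≫ t)) (λ_ k)).hom ≫ v ⊠₂ 𝟙 k ≫
        (fuse (Iso.refl ((t ⊠₁ t) ≫ S.p)) (ρ_ k)).inv) ▷ S.p ⊗≫
      (run (A ⊠ A) ≫ ((t ⊠₁ t) ⊠₁ k)) ◁ S.assoc ⊗≫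
      run (A ⊠ A) ◁ (ascNat t t k).hom ▷ ((𝟙 A ⊠₁ S.p) ≫ S.p) ⊗≫
      (MonoidalBicategory.right A A).inv ▷ ((t ⊠₁ (t ⊠₁ k)) ≫ (𝟙 A ⊠₁ S.p) ≫ S.p) ⊗≫
    𝟙 ((𝟙 A ⊠₁ run A) ≫ (t ⊠₁ (t ⊠₁ k)) ≫ (𝟙 A ⊠₁ S.p) ≫ S.p) =
    𝟙 ((t ⊠₁ 𝟙 A) ≫ S.p) ⊗≫
      (𝟙 t ⊠₂ κ ≫ (fuse (λ_ t) (Iso.refl (run A ≫ (t ⊠₁ k) ≫ S.p))).inv ≫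
        (𝟙 A ⊠₁ run A) ◁ (fuse (ρ_ t) (Iso.refl ((t ⊠₁ k) ≫ S.p))).inv) ▷ S.p ⊗≫
    𝟙 ((𝟙 A ⊠₁ run A) ≫ (t ⊠₁ (t ⊠₁ k)) ≫ (𝟙 A ⊠₁ S.p) ≫ S.p)
  warp_unit :
    𝟙 k ⊗≫
      k ◁ κ ⊗≫
      (runNat k).hom ▷ ((t ⊠₁ k) ≫ S.p) ⊗≫
      run (unitObj B) ◁ ((fuse (Iso.refl (k ≫ t)) (λ_ k)).hom ≫ v₀ ⊠₂ 𝟙 k ≫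
        (fuse (λ_ S.j) (ρ_ k)).inv) ▷ S.p ⊗≫
      (run (unitObj B) ≫ (𝟙 (unitObj B) ⊠₁ k)) ◁ S.left ⊗≫
      run (unitObj B) ◁ (lunNat k).hom ⊗≫
      (unitCell B).hom ▷ k ⊗≫
    𝟙 k = 𝟙 k

namespace SkewLeftWarping

variable {A : B} {S : LeftSkewMonoidale A} (W : SkewLeftWarping S)

/-- The data of the new left skew-monoidal structure determined by a skew left warping. -/
def newData : SkewMonoidalData A where
  p := (W.t ⊠₁ 𝟙 A) ≫ S.p
  j := W.k
  assoc :=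
    𝟙 ((((W.t ⊠₁ 𝟙 A) ≫ S.p) ⊠₁ 𝟙 A) ≫ (W.t ⊠₁ 𝟙 A) ≫ S.p) ⊗≫
      ((fuseRight ((W.t ⊠₁ 𝟙 A) ≫ S.p) W.t A).hom ≫ W.v ⊠₂ 𝟙 (𝟙 A) ≫
        (fuseRight (W.t ⊠₁ W.t) S.p A).inv) ▷ S.p ⊗≫
      ((W.t ⊠₁ W.t) ⊠₁ 𝟙 A) ◁ S.assoc ⊗≫
      (ascNat W.t W.t (𝟙 A)).hom ▷ ((𝟙 A ⊠₁ S.p) ≫ S.p) ⊗≫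
      asc A A A ◁ ((fuse (ρ_ W.t) (Iso.refl ((W.t ⊠₁ 𝟙 A) ≫ S.p))).hom ≫
        (fuse (λ_ W.t) (ρ_ ((W.t ⊠₁ 𝟙 A) ≫ S.p))).inv) ▷ S.p ⊗≫
    𝟙 (asc A A A ≫ (𝟙 A ⊠₁ ((W.t ⊠₁ 𝟙 A) ≫ S.p)) ≫ (W.t ⊠₁ 𝟙 A) ≫ S.p)
  left :=
    𝟙 ((W.k ⊠₁ 𝟙 A) ≫ (W.t ⊠₁ 𝟙 A) ≫ S.p) ⊗≫
      ((fuseRight W.k W.t A).hom ≫ W.v₀ ⊠₂ 𝟙 (𝟙 A)) ▷ S.p ⊗≫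
      S.left
  right := W.κ ≫ run A ◁ ((fuse (λ_ W.t) (ρ_ W.k)).inv ▷ S.p ≫ (α_ _ _ _).hom)

end SkewLeftWarping

end Skew

end SkewWarp

namespace SkewWarp

/-! ### Coherence for the tensor product -/

section TensorCoherence

variable {B : Type u} [Bicategory.{w, v} B] [TensorBicategory B]

/-! In element notation, write `xy` for the product given by `p`. A warping supplies `v : t(tx·y) →
tx·ty`, `v₀ : tk → j` and `κ : x → tx·k`, and the new product of `x` and `y` is `tx·y`. The new
associativity `t(tx·y)·z → (tx·ty)·z → tx·(ty·z)` is `v` followed by `α`; the new unit constraints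
are `v₀` followed by `λ`, and `κ`. The axioms are then short diagram chases. For the pentagon, both
sides reduce to the same composite of `v`'s (by `warp_assoc`) followed by the old pentagon at `tx,
ty, tz, w`. The left unit axiom comes from `warp_left` and the old one at `tx, y`; the middle axiom
comes from `warp_right` and the old one at `tx, y`. The right unit axiom is `warp_tensor` and the
last axiom is `warp_unit`, once the new constraints are unfolded. The opmonoidal axioms for `t` are
`warp_assoc`, `warp_left` and `warp_right`.

To make such chases legitimate in a monoidal bicategory, elements are read as 1-cells `X ⟶ A`. The
constraints at generalised elements (`assocAt`, `leftAt`, `rightAt`, `vAt`, `kappaAt`) are obtained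
by whiskering and pseudonaturality. They are parametrised by invertible 2-cells naming the
composites, so that `1 ≫ f` can be called `f` and few unitors or associators remain.

Two kinds of lemma carry the argument. The first passes from the axioms, which concern identity
elements, to arbitrary elements: `pentagonLeft_eq_pentagonRight`, `assocAt_leftAt`,
`rightAt_leftAt`; here the structural modifications enter through their naturality. The second
computes the new constraints at elements in terms of the old ones: `warped_assocAt`,
`warped_leftAt`, `warped_rightAt`. What remains after these is bicategorical coherence. -/

theorem tensorHom₂_comp {X X' Y Y' : B} {f f' f'' : X ⟶ X'} {g g' g'' : Y ⟶ Y'} (η : f ⟶ f')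
    (η' : f' ⟶ f'') (θ : g ⟶ g') (θ' : g' ⟶ g'') :
    (η ≫ η') ⊠₂ (θ ≫ θ') = η ⊠₂ θ ≫ η' ⊠₂ θ' :=
  (TensorBicategory.tensor (B := B)).map₂_comp (a := (X, Y)) (b := (X', Y')) (f := (f, g))
    (g := (f', g')) (h := (f'', g'')) (η, θ) (η', θ')

theorem tensorHom₂_id {X X' Y Y' : B} (f : X ⟶ X') (g : Y ⟶ Y') :
    𝟙 f ⊠₂ 𝟙 g = 𝟙 (f ⊠₁ g) :=
  (TensorBicategory.tensor (B := B)).map₂_id (a := (X, Y)) (b := (X', Y')) (f, g)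

theorem tensorHom₂_whiskerLeft {X X' X'' Y Y' Y'' : B} (f : X ⟶ X') {h h' : X' ⟶ X''}
    (η : h ⟶ h') (g : Y ⟶ Y') {k k' : Y' ⟶ Y''} (θ : k ⟶ k') :
    (f ◁ η) ⊠₂ (g ◁ θ) =
      (tensorComp f h g k).hom ≫ (f ⊠₁ g) ◁ (η ⊠₂ θ) ≫ (tensorComp f h' g k').inv :=
  (TensorBicategory.tensor (B := B)).map₂_whisker_left (a := (X, Y)) (b := (X', Y'))
    (c := (X'', Y'')) (f, g) (g := (h, k)) (h := (h', k')) (η, θ)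

theorem tensorHom₂_whiskerRight {X X' X'' Y Y' Y'' : B} {f f' : X ⟶ X'} (η : f ⟶ f')
    (h : X' ⟶ X'') {g g' : Y ⟶ Y'} (θ : g ⟶ g') (k : Y' ⟶ Y'') :
    (η ▷ h) ⊠₂ (θ ▷ k) =
      (tensorComp f h g k).hom ≫ (η ⊠₂ θ) ▷ (h ⊠₁ k) ≫ (tensorComp f' h g' k).inv :=
  (TensorBicategory.tensor (B := B)).map₂_whisker_right (a := (X, Y)) (b := (X', Y'))
    (c := (X'', Y'')) (f := (f, g)) (g := (f', g')) (η, θ) (h, k)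

theorem tensorHom₂_associator {X₀ X₁ X₂ X₃ Y₀ Y₁ Y₂ Y₃ : B} (f : X₀ ⟶ X₁) (f' : X₁ ⟶ X₂)
    (f'' : X₂ ⟶ X₃) (g : Y₀ ⟶ Y₁) (g' : Y₁ ⟶ Y₂) (g'' : Y₂ ⟶ Y₃) :
    (α_ f f' f'').hom ⊠₂ (α_ g g' g'').hom =
      (tensorComp (f ≫ f') f'' (g ≫ g') g'').hom ≫ (tensorComp f f' g g').hom ▷ (f'' ⊠₁ g'') ≫
        (α_ (f ⊠₁ g) (f' ⊠₁ g') (f'' ⊠₁ g'')).hom ≫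
        (f ⊠₁ g) ◁ (tensorComp f' f'' g' g'').inv ≫ (tensorComp f (f' ≫ f'') g (g' ≫ g'')).inv :=
  (TensorBicategory.tensor (B := B)).map₂_associator (a := (X₀, Y₀)) (b := (X₁, Y₁))
    (c := (X₂, Y₂)) (d := (X₃, Y₃)) (f, g) (f', g') (f'', g'')

theorem tensorHom₂_leftUnitor {X X' Y Y' : B} (f : X ⟶ X') (g : Y ⟶ Y') :
    (λ_ f).hom ⊠₂ (λ_ g).hom =
      (tensorComp (𝟙 X) f (𝟙 Y) g).hom ≫ (tensorId X Y).hom ▷ (f ⊠₁ g) ≫ (λ_ (f ⊠₁ g)).hom :=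
  (TensorBicategory.tensor (B := B)).map₂_left_unitor (a := (X, Y)) (b := (X', Y')) (f, g)

theorem tensorHom₂_rightUnitor {X X' Y Y' : B} (f : X ⟶ X') (g : Y ⟶ Y') :
    (ρ_ f).hom ⊠₂ (ρ_ g).hom =
      (tensorComp f (𝟙 X') g (𝟙 Y')).hom ≫ (f ⊠₁ g) ◁ (tensorId X' Y').hom ≫ (ρ_ (f ⊠₁ g)).hom :=
  (TensorBicategory.tensor (B := B)).map₂_right_unitor (a := (X, Y)) (b := (X', Y')) (f, g)

theorem fuse_hom {X X' X'' Y Y' Y'' : B} {f : X ⟶ X'} {f' : X' ⟶ X''} {g : Y ⟶ Y'} {g' : Y' ⟶ Y''}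
    {h : X ⟶ X''} {k : Y ⟶ Y''} (e : f ≫ f' ≅ h) (e' : g ≫ g' ≅ k) :
    (fuse e e').hom = (tensorComp f f' g g').inv ≫ e.hom ⊠₂ e'.hom :=
  rfl

theorem fuse_trans {X X' X'' Y Y' Y'' : B} {f : X ⟶ X'} {f' : X' ⟶ X''} {g : Y ⟶ Y'}
    {g' : Y' ⟶ Y''} {h h' : X ⟶ X''} {k k' : Y ⟶ Y''} (e : f ≫ f' ≅ h) (e' : g ≫ g' ≅ k)
    (i : h ≅ h') (i' : k ≅ k') :
    (fuse (e ≪≫ i) (e' ≪≫ i')).hom = (fuse e e').hom ≫ i.hom ⊠₂ i'.hom := by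
  simp only [fuse_hom, Iso.trans_hom, tensorHom₂_comp, Category.assoc]

/-- Naturality of the composition constraint of `⊗`. The hypotheses `w` and `w'` let the composites
in each factor be replaced by isomorphic 1-cells. -/
theorem fuse_naturality_left {X X' X'' Y Y' Y'' : B} {f₁ f₂ : X ⟶ X'} {f' : X' ⟶ X''}
    {g₁ g₂ : Y ⟶ Y'} {g' : Y' ⟶ Y''} {h₁ h₂ : X ⟶ X''} {k₁ k₂ : Y ⟶ Y''} (e₁ : f₁ ≫ f' ≅ h₁)
    (e₁' : g₁ ≫ g' ≅ k₁) (e₂ : f₂ ≫ f' ≅ h₂) (e₂' : g₂ ≫ g' ≅ k₂) {η : f₁ ⟶ f₂} {θ : g₁ ⟶ g₂}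
    {φ : h₁ ⟶ h₂} {ψ : k₁ ⟶ k₂} (w : η ▷ f' ≫ e₂.hom = e₁.hom ≫ φ)
    (w' : θ ▷ g' ≫ e₂'.hom = e₁'.hom ≫ ψ) :
    (η ⊠₂ θ) ▷ (f' ⊠₁ g') ≫ (fuse e₂ e₂').hom = (fuse e₁ e₁').hom ≫ φ ⊠₂ ψ := by
  have h := congrArg₂ (fun a b => (tensorComp f₁ f' g₁ g').inv ≫ a ⊠₂ b) w w'
  simpa only [tensorHom₂_comp, tensorHom₂_whiskerRight, Category.assoc, Iso.inv_hom_id_assoc,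
    fuse_hom] using h

theorem fuse_naturality_right {X X' X'' Y Y' Y'' : B} {f : X ⟶ X'} {f₁ f₂ : X' ⟶ X''}
    {g : Y ⟶ Y'} {g₁ g₂ : Y' ⟶ Y''} {h₁ h₂ : X ⟶ X''} {k₁ k₂ : Y ⟶ Y''} (e₁ : f ≫ f₁ ≅ h₁)
    (e₁' : g ≫ g₁ ≅ k₁) (e₂ : f ≫ f₂ ≅ h₂) (e₂' : g ≫ g₂ ≅ k₂) {η : f₁ ⟶ f₂} {θ : g₁ ⟶ g₂}
    {φ : h₁ ⟶ h₂} {ψ : k₁ ⟶ k₂} (w : f ◁ η ≫ e₂.hom = e₁.hom ≫ φ)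
    (w' : g ◁ θ ≫ e₂'.hom = e₁'.hom ≫ ψ) :
    (f ⊠₁ g) ◁ (η ⊠₂ θ) ≫ (fuse e₂ e₂').hom = (fuse e₁ e₁').hom ≫ φ ⊠₂ ψ := by
  have h := congrArg₂ (fun a b => (tensorComp f f₁ g g₁).inv ≫ a ⊠₂ b) w w'
  simpa only [tensorHom₂_comp, tensorHom₂_whiskerLeft, Category.assoc, Iso.inv_hom_id_assoc,
    fuse_hom] using h

/-- The associativity axiom of the pseudofunctor `⊗`, applied to equations that say, factor by
factor, that the chosen names of the composites are coherent. -/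
theorem fuse_assoc {X₀ X₁ X₂ X₃ Y₀ Y₁ Y₂ Y₃ : B} {f : X₀ ⟶ X₁} {f' : X₁ ⟶ X₂} {f'' : X₂ ⟶ X₃}
    {g : Y₀ ⟶ Y₁} {g' : Y₁ ⟶ Y₂} {g'' : Y₂ ⟶ Y₃} {h : X₀ ⟶ X₂} {h' : X₁ ⟶ X₃} {h'' : X₀ ⟶ X₃}
    {k : Y₀ ⟶ Y₂} {k' : Y₁ ⟶ Y₃} {k'' : Y₀ ⟶ Y₃}
    (e : f ≫ f' ≅ h) (e' : f' ≫ f'' ≅ h') (i : h ≫ f'' ≅ h'') (i' : f ≫ h' ≅ h'')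
    (d : g ≫ g' ≅ k) (d' : g' ≫ g'' ≅ k') (j : k ≫ g'' ≅ k'') (j' : g ≫ k' ≅ k'')
    (w : e.hom ▷ f'' ≫ i.hom = (α_ f f' f'').hom ≫ f ◁ e'.hom ≫ i'.hom)
    (w' : d.hom ▷ g'' ≫ j.hom = (α_ g g' g'').hom ≫ g ◁ d'.hom ≫ j'.hom) :
    (fuse e d).hom ▷ (f'' ⊠₁ g'') ≫ (fuse i j).hom =
      (α_ _ _ _).hom ≫ (f ⊠₁ g) ◁ (fuse e' d').hom ≫ (fuse i' j').hom := by
  have h := congrArg₂ (fun a b => (tensorComp f f' g g').inv ▷ (f'' ⊠₁ g'') ≫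
    (tensorComp (f ≫ f') f'' (g ≫ g') g'').inv ≫ a ⊠₂ b) w w'
  simpa only [tensorHom₂_comp, tensorHom₂_whiskerLeft, tensorHom₂_whiskerRight,
    tensorHom₂_associator, Category.assoc, Iso.inv_hom_id_assoc, fuse_hom, comp_whiskerRight,
    whiskerLeft_comp, inv_hom_whiskerRight_assoc] using h

theorem fuse_leftUnitor {X X' Y Y' : B} (f : X ⟶ X') (g : Y ⟶ Y') :
    (fuse (λ_ f) (λ_ g)).hom = (tensorId X Y).hom ▷ (f ⊠₁ g) ≫ (λ_ (f ⊠₁ g)).hom := by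
  rw [fuse_hom, tensorHom₂_leftUnitor, Iso.inv_hom_id_assoc]

theorem fuse_rightUnitor {X X' Y Y' : B} (f : X ⟶ X') (g : Y ⟶ Y') :
    (fuse (ρ_ f) (ρ_ g)).hom = (f ⊠₁ g) ◁ (tensorId X' Y').hom ≫ (ρ_ (f ⊠₁ g)).hom := by
  rw [fuse_hom, tensorHom₂_rightUnitor, Iso.inv_hom_id_assoc]

theorem fuse_refl_refl {X X' X'' Y Y' Y'' : B} (f : X ⟶ X') (f' : X' ⟶ X'') (g : Y ⟶ Y')
    (g' : Y' ⟶ Y'') : fuse (Iso.refl (f ≫ f')) (Iso.refl (g ≫ g')) = (tensorComp f f' g g').symm := by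
  ext
  rw [fuse_hom, Iso.refl_hom, Iso.refl_hom, tensorHom₂_id, Category.comp_id]
  rfl

end TensorCoherence

/-! ### Pseudonaturality of the associativity and left unit constraints -/

section ConstraintCoherence

variable {B : Type u} [Bicategory.{w, v} B] [PremonoidalBicategory B]

theorem ascNat_naturality {X X' Y Y' Z Z' : B} {f f' : X ⟶ X'} {g g' : Y ⟶ Y'} {h h' : Z ⟶ Z'}
    (η : f ⟶ f') (θ : g ⟶ g') (ζ : h ⟶ h') :
    ((η ⊠₂ θ) ⊠₂ ζ) ▷ asc X' Y' Z' ≫ (ascNat f' g' h').hom =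
      (ascNat f g h).hom ≫ asc X Y Z ◁ (η ⊠₂ (θ ⊠₂ ζ)) :=
  (PremonoidalBicategory.assoc (B := B)).naturality_naturality (a := ((X, Y), Z))
    (b := ((X', Y'), Z')) (f := ((f, g), h)) (g := ((f', g'), h')) ((η, θ), ζ)

theorem lunNat_naturality {X X' : B} {f f' : X ⟶ X'} (η : f ⟶ f') :
    (𝟙 (𝟙 (unitObj B)) ⊠₂ η) ▷ lun X' ≫ (lunNat f').hom = (lunNat f).hom ≫ lun X ◁ η :=
  (PremonoidalBicategory.leftUnit (B := B)).naturality_naturality η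

theorem ascNat_comp {X X' X'' Y Y' Y'' Z Z' Z'' : B} (f : X ⟶ X') (f' : X' ⟶ X'') (g : Y ⟶ Y')
    (g' : Y' ⟶ Y'') (h : Z ⟶ Z') (h' : Z' ⟶ Z'') :
    (ascNat (f ≫ f') (g ≫ g') (h ≫ h')).hom ≫ asc X Y Z ◁
        (𝟙 (f ≫ f') ⊠₂ (tensorComp g g' h h').hom ≫
          (tensorComp f f' (g ⊠₁ h) (g' ⊠₁ h')).hom) =
      ((tensorComp f f' g g').hom ⊠₂ 𝟙 (h ≫ h') ≫
        (tensorComp (f ⊠₁ g) (f' ⊠₁ g') h h').hom) ▷ asc X'' Y'' Z'' ≫ (α_ _ _ _).hom ≫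
        ((f ⊠₁ g) ⊠₁ h) ◁ (ascNat f' g' h').hom ≫ (α_ _ _ _).inv ≫
        (ascNat f g h).hom ▷ (f' ⊠₁ (g' ⊠₁ h')) ≫ (α_ _ _ _).hom := by
  -- The strict pseudofunctor `prodAssoc` contributes an image of identity 2-cells, which is then
  -- removed.
  have key : (ascNat (f ≫ f') (g ≫ g') (h ≫ h')).hom ≫ asc X Y Z ◁
      (𝟙 (f ≫ f') ⊠₂ (𝟙 (g ≫ g') ⊠₂ 𝟙 (h ≫ h')) ≫ 𝟙 (f ≫ f') ⊠₂ (tensorComp g g' h h').hom ≫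
        (tensorComp f f' (g ⊠₁ h) (g' ⊠₁ h')).hom) = _ :=
    (PremonoidalBicategory.assoc (B := B)).naturality_comp (a := ((X, Y), Z))
      (b := ((X', Y'), Z')) (c := ((X'', Y''), Z'')) ((f, g), h) ((f', g'), h')
  rw [tensorHom₂_id, tensorHom₂_id, Category.id_comp] at key
  exact key

theorem lunNat_comp {X X' X'' : B} (f : X ⟶ X') (f' : X' ⟶ X'') :
    (lunNat (f ≫ f')).hom = ((fuse (λ_ (𝟙 (unitObj B))) (Iso.refl (f ≫ f'))).inv ▷ lun X'') ≫
      (α_ _ _ _).hom ≫ (𝟙 (unitObj B) ⊠₁ f) ◁ (lunNat f').hom ≫ (α_ _ _ _).inv ≫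
      (lunNat f).hom ▷ f' ≫ (α_ _ _ _).hom := by
  -- The section at the unit object merges `𝟙 ≫ 𝟙` by a right unitor; it agrees with the left unitor
  -- used in `fuse`.
  have key : (lunNat (f ≫ f')).hom ≫ lun X ◁ 𝟙 (f ≫ f') =
      ((ρ_ (𝟙 (unitObj B))).inv ⊠₂ 𝟙 (f ≫ f') ≫
        (tensorComp (𝟙 (unitObj B)) (𝟙 (unitObj B)) f f').hom) ▷ lun X'' ≫ _ :=
    (PremonoidalBicategory.leftUnit (B := B)).naturality_comp f f'
  rw [whiskerLeft_id, Category.comp_id, ← unitors_inv_equal] at key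
  exact key

theorem ascNat_id (X Y Z : B) :
    (ascNat (𝟙 X) (𝟙 Y) (𝟙 Z)).hom ≫
        asc X Y Z ◁ (𝟙 (𝟙 X) ⊠₂ (tensorId Y Z).hom ≫ (tensorId X (Y ⊠ Z)).hom) =
      ((tensorId X Y).hom ⊠₂ 𝟙 (𝟙 Z) ≫ (tensorId (X ⊠ Y) Z).hom) ▷ asc X Y Z ≫
        (λ_ (asc X Y Z)).hom ≫ (ρ_ (asc X Y Z)).inv := by
  have key : (ascNat (𝟙 X) (𝟙 Y) (𝟙 Z)).hom ≫
      asc X Y Z ◁ (𝟙 (𝟙 X) ⊠₂ (𝟙 (𝟙 Y) ⊠₂ 𝟙 (𝟙 Z)) ≫ 𝟙 (𝟙 X) ⊠₂ (tensorId Y Z).hom ≫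
        (tensorId X (Y ⊠ Z)).hom) = _ :=
    (PremonoidalBicategory.assoc (B := B)).naturality_id ((X, Y), Z)
  rw [tensorHom₂_id, tensorHom₂_id, Category.id_comp] at key
  exact key

theorem lunNat_id (X : B) :
    (lunNat (𝟙 X)).hom = (tensorId (unitObj B) X).hom ▷ lun X ≫ (λ_ _).hom ≫ (ρ_ _).inv := by
  have key : (lunNat (𝟙 X)).hom ≫ lun X ◁ 𝟙 (𝟙 X) =
      (𝟙 (𝟙 (unitObj B)) ⊠₂ 𝟙 (𝟙 X) ≫ (tensorId (unitObj B) X).hom) ▷ lun X ≫ _ :=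
    (PremonoidalBicategory.leftUnit (B := B)).naturality_id X
  rw [whiskerLeft_id, Category.comp_id, tensorHom₂_id, Category.id_comp] at key
  exact key

/-- Moving two triples of 1-cells past `a` one after the other amounts to moving their composite.
This is what makes constraints at generalised elements stable under precomposition. -/
theorem ascNat_fuse {X X' X'' Y Y' Y'' Z Z' Z'' : B} {f : X ⟶ X'} {f' : X' ⟶ X''} {f'' : X ⟶ X''}
    {g : Y ⟶ Y'} {g' : Y' ⟶ Y''} {g'' : Y ⟶ Y''} {h : Z ⟶ Z'} {h' : Z' ⟶ Z''} {h'' : Z ⟶ Z''}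
    (e : f ≫ f' ≅ f'') (d : g ≫ g' ≅ g'') (c : h ≫ h' ≅ h'') :
    ((f ⊠₁ g) ⊠₁ h) ◁ (ascNat f' g' h').hom ≫ (α_ _ _ _).inv ≫
        (ascNat f g h).hom ▷ (f' ⊠₁ (g' ⊠₁ h')) ≫ (α_ _ _ _).hom ≫
        asc X Y Z ◁ (fuse e (fuse d c)).hom =
      (α_ _ _ _).inv ≫ (fuse (fuse e d) c).hom ▷ asc X'' Y'' Z'' ≫ (ascNat f'' g'' h'').hom := by
  have h₁ : (fuse (fuse e d) c).hom = ((tensorComp (f ⊠₁ g) (f' ⊠₁ g') h h').inv ≫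
      (tensorComp f f' g g').inv ⊠₂ 𝟙 _) ≫ (e.hom ⊠₂ d.hom) ⊠₂ c.hom := by
    rw [fuse_hom, fuse_hom, Category.assoc, ← tensorHom₂_comp, Category.id_comp]
  have h₂ : (fuse e (fuse d c)).hom = ((tensorComp f f' (g ⊠₁ h) (g' ⊠₁ h')).inv ≫
      𝟙 _ ⊠₂ (tensorComp g g' h h').inv) ≫ e.hom ⊠₂ (d.hom ⊠₂ c.hom) := by
    rw [fuse_hom, fuse_hom, Category.assoc, ← tensorHom₂_comp, Category.id_comp]
  have h₃ := (Iso.eq_comp_inv (whiskerLeftIso (asc X Y Z)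
    (tensorIso (Iso.refl (f ≫ f')) (tensorComp g g' h h') ≪≫
      tensorComp f f' (g ⊠₁ h) (g' ⊠₁ h')))).2 (ascNat_comp f f' g g' h h')
  have h₄ : (tensorComp f f' g g').inv ⊠₂ 𝟙 (h ≫ h') ≫ (tensorComp f f' g g').hom ⊠₂ 𝟙 (h ≫ h') =
      𝟙 _ := by
    rw [← tensorHom₂_comp, Iso.inv_hom_id, Category.id_comp, tensorHom₂_id]
  have h₅ : ((tensorComp (f ⊠₁ g) (f' ⊠₁ g') h h').inv ≫ (tensorComp f f' g g').inv ⊠₂ 𝟙 _) ≫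
      (tensorComp f f' g g').hom ⊠₂ 𝟙 (h ≫ h') ≫ (tensorComp (f ⊠₁ g) (f' ⊠₁ g') h h').hom =
        𝟙 _ := by
    rw [Category.assoc, reassoc_of% h₄, Iso.inv_hom_id]
  rw [h₁, comp_whiskerRight, Category.assoc (f := _ ▷ asc X'' Y'' Z''), ascNat_naturality, h₃, h₂,
    whiskerLeft_comp (asc X Y Z)]
  simp only [Category.assoc]
  rw [← comp_whiskerRight_assoc, h₅, id_whiskerRight, Category.id_comp, Iso.inv_hom_id_assoc]
  rfl

theorem lunNat_fuse {X X' X'' : B} {f : X ⟶ X'} {f' : X' ⟶ X''} {f'' : X ⟶ X''}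
    (e : f ≫ f' ≅ f'') :
    (𝟙 (unitObj B) ⊠₁ f) ◁ (lunNat f').hom ≫ (α_ _ _ _).inv ≫ (lunNat f).hom ▷ f' ≫
        (α_ _ _ _).hom ≫ lun X ◁ e.hom =
      (α_ _ _ _).inv ≫ (fuse (λ_ (𝟙 (unitObj B))) e).hom ▷ lun X'' ≫ (lunNat f'').hom := by
  have h₁ : (fuse (λ_ (𝟙 (unitObj B))) e).hom =
      (fuse (λ_ (𝟙 (unitObj B))) (Iso.refl (f ≫ f'))).hom ≫ 𝟙 _ ⊠₂ e.hom := by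
    rw [fuse_hom, fuse_hom, Category.assoc, ← tensorHom₂_comp, Category.comp_id, Iso.refl_hom,
      Category.id_comp]
  rw [h₁, comp_whiskerRight, Category.assoc, lunNat_naturality, lunNat_comp]
  simp

end ConstraintCoherence

/-! ### Generalised elements

For `p : M ⊗ N ⟶ K`, the product of `f : X ⟶ M` and `g : Y ⟶ N` is `(f ⊗ g) p : X ⊗ Y ⟶ K`. -/

section Product

variable {B : Type u} [Bicategory.{w, v} B] [TensorBicategory B] {M N K : B}

/-- Precomposition of a product of generalised elements. -/
def precomp (p : M ⊠ N ⟶ K) {X X' Y Y' : B} {x : X ⟶ X'} {y : Y ⟶ Y'} {f : X' ⟶ M} {g : Y' ⟶ N}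
    {h : X ⟶ M} {k : Y ⟶ N} (e : x ≫ f ≅ h) (e' : y ≫ g ≅ k) :
    (x ⊠₁ y) ≫ (f ⊠₁ g) ≫ p ≅ (h ⊠₁ k) ≫ p :=
  (α_ _ _ _).symm ≪≫ whiskerRightIso (fuse e e') p

theorem precomp_hom (p : M ⊠ N ⟶ K) {X X' Y Y' : B} {x : X ⟶ X'} {y : Y ⟶ Y'} {f : X' ⟶ M}
    {g : Y' ⟶ N} {h : X ⟶ M} {k : Y ⟶ N} (e : x ≫ f ≅ h) (e' : y ≫ g ≅ k) :
    (precomp p e e').hom = (α_ _ _ _).inv ≫ (fuse e e').hom ▷ p :=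
  rfl

theorem precomp_inv (p : M ⊠ N ⟶ K) {X X' Y Y' : B} {x : X ⟶ X'} {y : Y ⟶ Y'} {f : X' ⟶ M}
    {g : Y' ⟶ N} {h : X ⟶ M} {k : Y ⟶ N} (e : x ≫ f ≅ h) (e' : y ≫ g ≅ k) :
    (precomp p e e').inv = (fuse e e').inv ▷ p ≫ (α_ _ _ _).hom :=
  rfl

theorem precomp_naturality_right (p : M ⊠ N ⟶ K) {X X' Y Y' : B} {x : X ⟶ X'} {y : Y ⟶ Y'}
    {f₁ f₂ : X' ⟶ M} {g₁ g₂ : Y' ⟶ N} {h₁ h₂ : X ⟶ M} {k₁ k₂ : Y ⟶ N} (e₁ : x ≫ f₁ ≅ h₁)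
    (e₁' : y ≫ g₁ ≅ k₁) (e₂ : x ≫ f₂ ≅ h₂) (e₂' : y ≫ g₂ ≅ k₂) {η : f₁ ⟶ f₂} {θ : g₁ ⟶ g₂}
    {φ : h₁ ⟶ h₂} {ψ : k₁ ⟶ k₂} (w : x ◁ η ≫ e₂.hom = e₁.hom ≫ φ)
    (w' : y ◁ θ ≫ e₂'.hom = e₁'.hom ≫ ψ) :
    (x ⊠₁ y) ◁ (η ⊠₂ θ) ▷ p ≫ (precomp p e₂ e₂').hom = (precomp p e₁ e₁').hom ≫ (φ ⊠₂ ψ) ▷ p := by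
  rw [precomp_hom, precomp_hom, Category.assoc, ← comp_whiskerRight,
    ← fuse_naturality_right e₁ e₁' e₂ e₂' w w']
  simp

theorem precomp_naturality_left (p : M ⊠ N ⟶ K) {X X' Y Y' : B} {x₁ x₂ : X ⟶ X'} {y₁ y₂ : Y ⟶ Y'}
    {f : X' ⟶ M} {g : Y' ⟶ N} {h₁ h₂ : X ⟶ M} {k₁ k₂ : Y ⟶ N} (e₁ : x₁ ≫ f ≅ h₁)
    (e₁' : y₁ ≫ g ≅ k₁) (e₂ : x₂ ≫ f ≅ h₂) (e₂' : y₂ ≫ g ≅ k₂) {η : x₁ ⟶ x₂} {θ : y₁ ⟶ y₂}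
    {φ : h₁ ⟶ h₂} {ψ : k₁ ⟶ k₂} (w : η ▷ f ≫ e₂.hom = e₁.hom ≫ φ)
    (w' : θ ▷ g ≫ e₂'.hom = e₁'.hom ≫ ψ) :
    (η ⊠₂ θ) ▷ ((f ⊠₁ g) ≫ p) ≫ (precomp p e₂ e₂').hom =
      (precomp p e₁ e₁').hom ≫ (φ ⊠₂ ψ) ▷ p := by
  rw [precomp_hom, precomp_hom, Category.assoc, ← comp_whiskerRight,
    ← fuse_naturality_left e₁ e₁' e₂ e₂' w w']
  simp

/-- Precomposing twice is precomposing once with the composite, by `fuse_assoc`. Special choices of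
the eight isomorphisms account for most of the later bookkeeping. -/
theorem precomp_precomp (p : M ⊠ N ⟶ K) {X X' X'' Y Y' Y'' : B} {x : X ⟶ X'} {x' : X' ⟶ X''}
    {x'' : X ⟶ X''} {y : Y ⟶ Y'} {y' : Y' ⟶ Y''} {y'' : Y ⟶ Y''} {f : X'' ⟶ M} {g : Y'' ⟶ N}
    {f' : X' ⟶ M} {f'' : X ⟶ M} {g' : Y' ⟶ N} {g'' : Y ⟶ N}
    (e : x' ≫ f ≅ f') (i : x ≫ f' ≅ f'') (c : x ≫ x' ≅ x'') (j : x'' ≫ f ≅ f'')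
    (e' : y' ≫ g ≅ g') (i' : y ≫ g' ≅ g'') (c' : y ≫ y' ≅ y'') (j' : y'' ≫ g ≅ g'')
    (w : x ◁ e.hom ≫ i.hom = (α_ _ _ _).inv ≫ c.hom ▷ f ≫ j.hom)
    (w' : y ◁ e'.hom ≫ i'.hom = (α_ _ _ _).inv ≫ c'.hom ▷ g ≫ j'.hom) :
    (x ⊠₁ y) ◁ (precomp p e e').hom ≫ (precomp p i i').hom =
      (α_ _ _ _).inv ≫ (fuse c c').hom ▷ ((f ⊠₁ g) ≫ p) ≫ (precomp p j j').hom := by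
  have h := fuse_assoc c e j i c' e' j' i' (by rw [w, Iso.hom_inv_id_assoc])
    (by rw [w', Iso.hom_inv_id_assoc])
  have h' := congrArg (fun a => a ▷ p) h
  simp only [comp_whiskerRight, whisker_assoc, Category.assoc] at h'
  simp only [precomp_hom, whiskerLeft_comp, whiskerRight_comp, Category.assoc]
  rw [Iso.hom_inv_id_assoc]
  rw [h']
  simp

theorem precomp_leftUnitor (p : M ⊠ N ⟶ K) {X Y : B} (f : X ⟶ M) (g : Y ⟶ N) :
    (precomp p (λ_ f) (λ_ g)).hom = (tensorId X Y).hom ▷ ((f ⊠₁ g) ≫ p) ≫ (λ_ _).hom := by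
  rw [precomp_hom, fuse_leftUnitor]
  simp

end Product

/-! ### Moving 1-cells past the constraints -/

section Moves

/-- Pasting an invertible square and a 1-cell. -/
def squareMove {B : Type u} [Bicategory.{w, v} B] {X X' Y Y' K : B} {f : X ⟶ X'} {g : Y ⟶ Y'}
    {x : X ⟶ Y} {x' : X' ⟶ Y'} (s : f ≫ x' ≅ x ≫ g) (m : Y' ⟶ K) : f ≫ x' ≫ m ≅ x ≫ g ≫ m :=
  (α_ _ _ _).symm ≪≫ whiskerRightIso s m ≪≫ α_ _ _ _

section Square

variable {B : Type u} [Bicategory.{w, v} B] {X X' Y Y' K : B}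

theorem squareMove_hom {f : X ⟶ X'} {g : Y ⟶ Y'} {x : X ⟶ Y} {x' : X' ⟶ Y'}
    (s : f ≫ x' ≅ x ≫ g) (m : Y' ⟶ K) :
    (squareMove s m).hom = (α_ _ _ _).inv ≫ s.hom ▷ m ≫ (α_ _ _ _).hom :=
  rfl

theorem squareMove_naturality_right {f : X ⟶ X'} {g : Y ⟶ Y'} {x : X ⟶ Y} {x' : X' ⟶ Y'}
    (s : f ≫ x' ≅ x ≫ g) {m m' : Y' ⟶ K} (μ : m ⟶ m') :
    f ◁ x' ◁ μ ≫ (squareMove s m').hom = (squareMove s m).hom ≫ x ◁ g ◁ μ := by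
  rw [squareMove_hom, squareMove_hom, associator_inv_naturality_right_assoc,
    whisker_exchange_assoc]
  simp

theorem squareMove_naturality_left {f₁ f₂ : X ⟶ X'} {g₁ g₂ : Y ⟶ Y'} {x : X ⟶ Y} {x' : X' ⟶ Y'}
    (s₁ : f₁ ≫ x' ≅ x ≫ g₁) (s₂ : f₂ ≫ x' ≅ x ≫ g₂) {η : f₁ ⟶ f₂} {θ : g₁ ⟶ g₂}
    (w : η ▷ x' ≫ s₂.hom = s₁.hom ≫ x ◁ θ) (m : Y' ⟶ K) :
    η ▷ (x' ≫ m) ≫ (squareMove s₂ m).hom = (squareMove s₁ m).hom ≫ x ◁ θ ▷ m := by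
  have := congrArg (fun a => a ▷ m) w
  simp only [comp_whiskerRight, whisker_assoc] at this
  simp only [squareMove_hom, whiskerRight_comp, Category.assoc, Iso.hom_inv_id_assoc,
    reassoc_of% this]
  simp

/-- The hypothesis `w` has the shape of `ascNat_fuse`; only reassociation is needed to extend it
along `m`. -/
theorem squareMove_comp {X'' Y'' : B} {f : X ⟶ X'} {f' : X' ⟶ X''} {f'' : X ⟶ X''} {g : Y ⟶ Y'}
    {g' : Y' ⟶ Y''} {g'' : Y ⟶ Y''} {x : X ⟶ Y} {x' : X' ⟶ Y'} {x'' : X'' ⟶ Y''}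
    {s : f ≫ x' ≅ x ≫ g} {s' : f' ≫ x'' ≅ x' ≫ g'} {s'' : f'' ≫ x'' ≅ x ≫ g''}
    {d : f ≫ f' ≅ f''} {c : g ≫ g' ≅ g''}
    (w : f ◁ s'.hom ≫ (α_ _ _ _).inv ≫ s.hom ▷ g' ≫ (α_ _ _ _).hom ≫ x ◁ c.hom =
      (α_ _ _ _).inv ≫ d.hom ▷ x'' ≫ s''.hom) (m : Y'' ⟶ K) :
    f ◁ (squareMove s' m).hom ≫ (squareMove s (g' ≫ m)).hom ≫ x ◁ ((α_ _ _ _).inv ≫ c.hom ▷ m) =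
      (α_ _ _ _).inv ≫ d.hom ▷ (x'' ≫ m) ≫ (squareMove s'' m).hom := by
  have h := congrArg (fun a => f ◁ (α_ f' x'' m).inv ≫ (α_ _ _ _).inv ≫ a ▷ m ≫ (α_ _ _ _).hom) w
  have h₁ : f ◁ (squareMove s' m).hom ≫ (squareMove s (g' ≫ m)).hom ≫
      x ◁ ((α_ _ _ _).inv ≫ c.hom ▷ m) = f ◁ (α_ f' x'' m).inv ≫ (α_ _ _ _).inv ≫
      (f ◁ s'.hom ≫ (α_ _ _ _).inv ≫ s.hom ▷ g' ≫ (α_ _ _ _).hom ≫ x ◁ c.hom) ▷ m ≫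
        (α_ _ _ _).hom := by
    simp only [squareMove_hom]
    bicategory
  rw [h₁]
  refine h.trans ?_
  simp only [squareMove_hom]
  bicategory

end Square

variable {B : Type u} [Bicategory.{w, v} B] [PremonoidalBicategory B]

/-- Moving a tensor product of three 1-cells past the associativity constraint. -/
abbrev ascMove {X X' Y Y' Z Z' K : B} (f : X ⟶ X') (g : Y ⟶ Y') (h : Z ⟶ Z')
    (m : X' ⊠ (Y' ⊠ Z') ⟶ K) :
    ((f ⊠₁ g) ⊠₁ h) ≫ asc X' Y' Z' ≫ m ≅ asc X Y Z ≫ (f ⊠₁ (g ⊠₁ h)) ≫ m :=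
  squareMove (ascNat f g h) m

/-- Moving a 1-cell past the right unit constraint. -/
abbrev runMove {X X' K : B} (f : X ⟶ X') (m : X' ⊠ unitObj B ⟶ K) :
    f ≫ run X' ≫ m ≅ run X ≫ (f ⊠₁ 𝟙 (unitObj B)) ≫ m :=
  squareMove (runNat f) m

end Moves

/-! ### Constraints at generalised elements -/

section Elements

variable {B : Type u} [Bicategory.{w, v} B] [MonoidalBicategory B] {A : B} (S : SkewMonoidalData A)

/-- The associativity constraint at three generalised elements. -/
def SkewMonoidalData.assocAt {X Y Z : B} {f : X ⟶ A} {g : Y ⟶ A} {h : Z ⟶ A} {u : X ⊠ Y ⟶ A}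
    {n : Y ⊠ Z ⟶ A} (e : (f ⊠₁ g) ≫ S.p ≅ u) (e' : (g ⊠₁ h) ≫ S.p ≅ n) :
    (u ⊠₁ h) ≫ S.p ⟶ asc X Y Z ≫ (f ⊠₁ n) ≫ S.p :=
  (precomp S.p e (ρ_ h)).inv ≫ ((f ⊠₁ g) ⊠₁ h) ◁ S.assoc ≫ (ascMove f g h _).hom ≫
    asc X Y Z ◁ (precomp S.p (ρ_ f) e').hom

/-- The left unit constraint at a generalised element. -/
def SkewMonoidalData.leftAt {X : B} (f : X ⟶ A) : (S.j ⊠₁ f) ≫ S.p ⟶ lun X ≫ f :=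
  (precomp S.p (λ_ S.j) (ρ_ f)).inv ≫ (𝟙 (unitObj B) ⊠₁ f) ◁ S.left ≫ (lunNat f).hom

/-- The right unit constraint at a generalised element. -/
def SkewMonoidalData.rightAt {X : B} (f : X ⟶ A) : f ⟶ run X ≫ (f ⊠₁ S.j) ≫ S.p :=
  (ρ_ f).inv ≫ f ◁ S.right ≫ (runMove f _).hom ≫ run X ◁ (precomp S.p (ρ_ f) (λ_ S.j)).hom

/-- Allows 2-cells between elements, in practice `v` and `v₀`, to slide through the associativity
constraint. -/
theorem SkewMonoidalData.assocAt_naturality {X Y Z : B} {f₁ f₂ : X ⟶ A} {g₁ g₂ : Y ⟶ A}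
    {h₁ h₂ : Z ⟶ A} {u₁ u₂ : X ⊠ Y ⟶ A} {n₁ n₂ : Y ⊠ Z ⟶ A}
    (e₁ : (f₁ ⊠₁ g₁) ≫ S.p ≅ u₁) (e₁' : (g₁ ⊠₁ h₁) ≫ S.p ≅ n₁)
    (e₂ : (f₂ ⊠₁ g₂) ≫ S.p ≅ u₂) (e₂' : (g₂ ⊠₁ h₂) ≫ S.p ≅ n₂) {η : f₁ ⟶ f₂} {θ : g₁ ⟶ g₂}
    {ζ : h₁ ⟶ h₂} {μ : u₁ ⟶ u₂} {ν : n₁ ⟶ n₂} (w : (η ⊠₂ θ) ▷ S.p ≫ e₂.hom = e₁.hom ≫ μ)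
    (w' : (θ ⊠₂ ζ) ▷ S.p ≫ e₂'.hom = e₁'.hom ≫ ν) :
    (μ ⊠₂ ζ) ▷ S.p ≫ S.assocAt e₂ e₂' =
      S.assocAt e₁ e₁' ≫ asc X Y Z ◁ (η ⊠₂ ν) ▷ S.p := by
  have h₁ : (μ ⊠₂ ζ) ▷ S.p ≫ (precomp S.p e₂ (ρ_ h₂)).inv =
      (precomp S.p e₁ (ρ_ h₁)).inv ≫ ((η ⊠₂ θ) ⊠₂ ζ) ▷ _ := by
    rw [Iso.eq_inv_comp, ← Category.assoc, Iso.comp_inv_eq,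
      precomp_naturality_left S.p e₁ (ρ_ _) e₂ (ρ_ _) w (rightUnitor_naturality ζ)]
  have h₂ := precomp_naturality_left S.p (ρ_ _) e₁' (ρ_ _) e₂' (rightUnitor_naturality η) w'
  rw [assocAt, assocAt, reassoc_of% h₁, ← whisker_exchange_assoc,
    reassoc_of% squareMove_naturality_left _ _ (ascNat_naturality η θ ζ), ← whiskerLeft_comp, h₂]
  simp

/-- Substitution: restricting the constraint at `f, g, h` along `x, y, z` gives the constraint at
the composites. It rests on `ascNat_fuse`; the hypotheses `w` and `w'` match the chosen names of the
two inner products. -/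
theorem SkewMonoidalData.assocAt_precomp {X Y Z X' Y' Z' : B} {x : X' ⟶ X} {y : Y' ⟶ Y}
    {z : Z' ⟶ Z} {f : X ⟶ A} {g : Y ⟶ A} {h : Z ⟶ A} {f' : X' ⟶ A} {g' : Y' ⟶ A} {h' : Z' ⟶ A}
    {u : X ⊠ Y ⟶ A} {n : Y ⊠ Z ⟶ A} {u' : X' ⊠ Y' ⟶ A} {n' : Y' ⊠ Z' ⟶ A}
    (e : (f ⊠₁ g) ≫ S.p ≅ u) (d : (g ⊠₁ h) ≫ S.p ≅ n) (e' : (f' ⊠₁ g') ≫ S.p ≅ u')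
    (d' : (g' ⊠₁ h') ≫ S.p ≅ n') (a : x ≫ f ≅ f') (b : y ≫ g ≅ g') (c : z ≫ h ≅ h')
    (i : (x ⊠₁ y) ≫ u ≅ u') (k : (y ⊠₁ z) ≫ n ≅ n')
    (w : (x ⊠₁ y) ◁ e.hom ≫ i.hom = (precomp S.p a b).hom ≫ e'.hom)
    (w' : (y ⊠₁ z) ◁ d.hom ≫ k.hom = (precomp S.p b c).hom ≫ d'.hom) :
    ((x ⊠₁ y) ⊠₁ z) ◁ S.assocAt e d ≫ (ascMove x y z _).hom ≫
        asc X' Y' Z' ◁ (precomp S.p a k).hom =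
      (precomp S.p i c).hom ≫ S.assocAt e' d' := by
  have h₁ := precomp_precomp S.p (ρ_ f) a a (ρ_ f') d k (fuse b c) d' (by simp)
    (by rw [w', precomp_hom, Category.assoc])
  have h₂ := precomp_precomp S.p e i (fuse a b) e' (ρ_ h) c c (ρ_ h')
    (by rw [w, precomp_hom, Category.assoc]) (by simp)
  have h₃ := squareMove_comp (ascNat_fuse a b c) ((𝟙 A ⊠₁ S.p) ≫ S.p)
  have h₄ : ((x ⊠₁ y) ⊠₁ z) ◁ (precomp S.p e (ρ_ h)).inv ≫ (α_ _ _ _).inv ≫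
      (fuse (fuse a b) c).hom ▷ ((S.p ⊠₁ 𝟙 A) ≫ S.p) =
        (precomp S.p i c).hom ≫ (precomp S.p e' (ρ_ h')).inv := by
    rw [Iso.eq_comp_inv, Category.assoc, Category.assoc, ← h₂, ← whiskerLeft_comp_assoc]
    simp
  simp only [SkewMonoidalData.assocAt, whiskerLeft_comp, Category.assoc]
  rw [reassoc_of% squareMove_naturality_right, ← whiskerLeft_comp, h₁]
  simp only [whiskerLeft_comp] at h₃ ⊢
  rw [reassoc_of% h₃, associator_inv_naturality_right_assoc, whisker_exchange_assoc,
    reassoc_of% h₄]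

end Elements

/-! ### Pasting lemmas for squares -/

section SquareLemmas

variable {B : Type u} [Bicategory.{w, v} B]

theorem squareMove_pasteSquare [TensorBicategory B] {X X' Y Y' Z Z' K : B} {f : X ⟶ X'}
    {g : Y ⟶ Y'} {h : Z ⟶ Z'} {x : X ⟶ Y} {x' : X' ⟶ Y'} {y : Y ⟶ Z} {y' : Y' ⟶ Z'}
    (s : f ≫ x' ≅ x ≫ g) (t : g ≫ y' ≅ y ≫ h) (m : Z' ⟶ K) :
    (squareMove (pasteSquare s t) m).hom =
      f ◁ (α_ _ _ _).hom ≫ (squareMove s (y' ≫ m)).hom ≫ x ◁ (squareMove t m).hom ≫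
        (α_ _ _ _).inv := by
  simp only [squareMove_hom, pasteSquare, Iso.trans_hom, Iso.symm_hom, whiskerLeftIso_hom,
    whiskerRightIso_hom]
  bicategory

theorem leftUnitor_id_eq (X : B) : λ_ (𝟙 X) = ρ_ (𝟙 X) := by
  ext
  exact unitors_equal

/-- The hypothesis `w` is the form taken by the naturality axioms of the modifications `pent`, `mid`
and `left`. -/
theorem squareMove_whisker {X X' Y Y' K : B} {f : X ⟶ X'} {g : Y ⟶ Y'} {x y : X ⟶ Y}
    {x' y' : X' ⟶ Y'} {s : f ≫ x' ≅ x ≫ g} {t : f ≫ y' ≅ y ≫ g} {π : x ⟶ y} {π' : x' ⟶ y'}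
    (w : f ◁ π' ≫ t.hom = s.hom ≫ π ▷ g) (m : Y' ⟶ K) :
    f ◁ π' ▷ m ≫ (squareMove t m).hom = (squareMove s m).hom ≫ π ▷ (g ≫ m) := by
  have h := congrArg (fun a => (α_ _ _ _).inv ≫ a ▷ m ≫ (α_ _ _ _).hom) w
  have h₁ : f ◁ π' ▷ m ≫ (squareMove t m).hom =
      (α_ _ _ _).inv ≫ (f ◁ π' ≫ t.hom) ▷ m ≫ (α_ _ _ _).hom := by
    simp only [squareMove_hom]
    bicategory
  rw [h₁]
  refine h.trans ?_
  simp only [squareMove_hom]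
  bicategory

/-- Both routes merge, by `precomp_precomp`, into a single precomposition whose factors agree by `w`
and `w'`. -/
theorem precomp_tensorSquare [TensorBicategory B] {M N K : B} (p : M ⊠ N ⟶ K)
    {X X' Y Y' Z Z' W W' : B} {f : X ⟶ X'} {g : Y ⟶ Y'} {x : X ⟶ Y} {x' : X' ⟶ Y'} {h : Z ⟶ Z'}
    {k : W ⟶ W'} {z : Z ⟶ W} {z' : Z' ⟶ W'} {s : f ≫ x' ≅ x ≫ g} {t : h ≫ z' ≅ z ≫ k}
    {a : Y' ⟶ M} {b : W' ⟶ N} {a' : X' ⟶ M} {b' : Z' ⟶ N} {a'' : Y ⟶ M} {b'' : W ⟶ N} {c : X ⟶ M}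
    {d : Z ⟶ N} {i : x' ≫ a ≅ a'} {i' : z' ≫ b ≅ b'} {j : f ≫ a' ≅ c} {j' : h ≫ b' ≅ d}
    {l : g ≫ a ≅ a''} {l' : k ≫ b ≅ b''} {r : x ≫ a'' ≅ c} {r' : z ≫ b'' ≅ d}
    (w : f ◁ i.hom ≫ j.hom = (squareMove s a).hom ≫ x ◁ l.hom ≫ r.hom)
    (w' : h ◁ i'.hom ≫ j'.hom = (squareMove t b).hom ≫ z ◁ l'.hom ≫ r'.hom) :
    (f ⊠₁ h) ◁ (precomp p i i').hom ≫ (precomp p j j').hom =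
      (squareMove (tensorSquare s t) _).hom ≫ (x ⊠₁ z) ◁ (precomp p l l').hom ≫
        (precomp p r r').hom := by
  rw [precomp_precomp p i j s (α_ _ _ _ ≪≫ whiskerLeftIso x l ≪≫ r) i' j' t
    (α_ _ _ _ ≪≫ whiskerLeftIso z l' ≪≫ r') (by simp [w, squareMove_hom])
    (by simp [w', squareMove_hom]),
    precomp_precomp p l r (Iso.refl _) (α_ _ _ _ ≪≫ whiskerLeftIso x l ≪≫ r) l' r' (Iso.refl _)
      (α_ _ _ _ ≪≫ whiskerLeftIso z l' ≪≫ r') (by simp) (by simp), fuse_refl_refl]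
  simp only [squareMove_hom, tensorSquare, Iso.trans_hom, Iso.symm_hom, comp_whiskerRight,
    Category.assoc, Iso.hom_inv_id_assoc]
  rw [hom_inv_whiskerRight_assoc]

end SquareLemmas

/-! ### Identity elements and the pentagon at identity elements -/

section Elements

variable {B : Type u} [Bicategory.{w, v} B] [MonoidalBicategory B] {A : B} (S : SkewMonoidalData A)

/-- The product of the identity elements. -/
def SkewMonoidalData.idProd : (𝟙 A ⊠₁ 𝟙 A) ≫ S.p ≅ S.p :=
  whiskerRightIso (tensorId A A) S.p ≪≫ λ_ S.p

theorem SkewMonoidalData.idProd_hom :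
    S.idProd.hom = (tensorId A A).hom ▷ S.p ≫ (λ_ S.p).hom :=
  rfl

theorem SkewMonoidalData.whiskerLeft_idProd {X Y : B} (f : X ⟶ A) (g : Y ⟶ A) :
    (f ⊠₁ g) ◁ S.idProd.hom = (precomp S.p (ρ_ f) (ρ_ g)).hom := by
  rw [precomp_hom, fuse_rightUnitor, S.idProd_hom]
  simp

/-- The identity of `A` is the universal element: this is the unit law of the pseudonatural
transformation `a`. The axioms can thus be read as statements about elements. -/
theorem SkewMonoidalData.assocAt_idProd : S.assocAt S.idProd S.idProd = S.assoc := by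
  have h₁ : (precomp S.p S.idProd (ρ_ (𝟙 A))).hom =
      ((tensorId A A).hom ⊠₂ 𝟙 (𝟙 A) ≫ (tensorId (A ⊠ A) A).hom) ▷ ((S.p ⊠₁ 𝟙 A) ≫ S.p) ≫
        (λ_ _).hom := by
    have := precomp_naturality_left S.p S.idProd (ρ_ (𝟙 A)) (λ_ S.p) (λ_ (𝟙 A))
      (η := (tensorId A A).hom) (θ := 𝟙 (𝟙 A)) (φ := 𝟙 _) (ψ := 𝟙 _)
      (by rw [Category.comp_id, S.idProd_hom]) (by simp [leftUnitor_id_eq])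
    rw [tensorHom₂_id, id_whiskerRight, Category.comp_id, precomp_leftUnitor] at this
    rw [← this, comp_whiskerRight, Category.assoc]
  have h₂ : (precomp S.p (ρ_ (𝟙 A)) S.idProd).hom =
      (𝟙 (𝟙 A) ⊠₂ (tensorId A A).hom ≫ (tensorId A (A ⊠ A)).hom) ▷ ((𝟙 A ⊠₁ S.p) ≫ S.p) ≫
        (λ_ _).hom := by
    have := precomp_naturality_left S.p (ρ_ (𝟙 A)) S.idProd (λ_ (𝟙 A)) (λ_ S.p)
      (θ := (tensorId A A).hom) (η := 𝟙 (𝟙 A)) (φ := 𝟙 _) (ψ := 𝟙 _)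
      (by simp [leftUnitor_id_eq]) (by rw [Category.comp_id, S.idProd_hom])
    rw [tensorHom₂_id, id_whiskerRight, Category.comp_id, precomp_leftUnitor] at this
    rw [← this, comp_whiskerRight, Category.assoc]
  rw [assocAt, Iso.inv_comp_eq, h₁, h₂, squareMove_hom]
  -- The unit law `ascNat_id`, pasted onto `S.assoc`; both ends then simplify by naturality of
  -- unitors and interchange.
  have h₃ := congrArg (fun a => ((𝟙 A ⊠₁ 𝟙 A) ⊠₁ 𝟙 A) ◁ S.assoc ≫ (α_ _ _ _).inv ≫
    a ▷ ((𝟙 A ⊠₁ S.p) ≫ S.p) ≫ (α_ _ _ _).hom ≫ asc A A A ◁ (λ_ _).hom) (ascNat_id A A A)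
  refine Eq.trans ?_ (h₃.trans ?_)
  · bicategory
  · rw [Category.assoc, ← leftUnitor_naturality S.assoc, ← whisker_exchange_assoc]
    bicategory

/-- Replacing the composite of constraints on one side of the associativity pentagon by the one on
the other side. -/
def pentMove (W X Y Z : B) {K : B} (m : W ⊠ X ⊠ Y ⊠ Z ⟶ K) :
    (asc W X Y ⊠₁ 𝟙 Z) ≫ asc W (X ⊠ Y) Z ≫ (𝟙 W ⊠₁ asc X Y Z) ≫ m ≅
      asc (W ⊠ X) Y Z ≫ asc W X (Y ⊠ Z) ≫ m :=
  whiskerLeftIso _ (α_ _ _ _).symm ≪≫ (α_ _ _ _).symm ≪≫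
    whiskerRightIso (MonoidalBicategory.pent W X Y Z) m ≪≫ α_ _ _ _

theorem pentMove_naturality (W X Y Z : B) {K : B} {m m' : W ⊠ X ⊠ Y ⊠ Z ⟶ K} (μ : m ⟶ m') :
    (asc W X Y ⊠₁ 𝟙 Z) ◁ asc W (X ⊠ Y) Z ◁ (𝟙 W ⊠₁ asc X Y Z) ◁ μ ≫ (pentMove W X Y Z m').hom =
      (pentMove W X Y Z m).hom ≫ asc (W ⊠ X) Y Z ◁ asc W X (Y ⊠ Z) ◁ μ := by
  have h := congrArg (fun a => (asc W X Y ⊠₁ 𝟙 Z) ◁ (α_ _ _ _).inv ≫ (α_ _ _ _).inv ≫ a ≫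
    (α_ _ _ _).hom) (whisker_exchange (MonoidalBicategory.pent W X Y Z).hom μ)
  simp only [pentMove, Iso.trans_hom, Iso.symm_hom, whiskerLeftIso_hom, whiskerRightIso_hom]
  refine Eq.trans ?_ (h.trans ?_) <;> bicategory

/-- Isolates the cell `1 ⊗ 1 ≅ 1`, which the axioms display explicitly. -/
theorem SkewMonoidalData.precomp_idProd_right {X X' : B} {x : X ⟶ X'} {f : X' ⟶ A} {f' : X ⟶ A}
    (a : x ≫ f ≅ f') :
    (precomp S.p a S.idProd).hom =
      (𝟙 x ⊠₂ (tensorId A A).hom) ▷ ((f ⊠₁ S.p) ≫ S.p) ≫ (precomp S.p a (λ_ S.p)).hom := by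
  rw [precomp_naturality_left S.p a S.idProd a (λ_ S.p) (φ := 𝟙 _) (ψ := 𝟙 _) (by simp)
    (by rw [Category.comp_id, S.idProd_hom]), tensorHom₂_id, id_whiskerRight, Category.comp_id]

theorem SkewMonoidalData.precomp_idProd_left {X X' : B} {x : X ⟶ X'} {f : X' ⟶ A} {f' : X ⟶ A}
    (a : x ≫ f ≅ f') :
    (precomp S.p S.idProd a).hom =
      ((tensorId A A).hom ⊠₂ 𝟙 x) ▷ ((S.p ⊠₁ f) ≫ S.p) ≫ (precomp S.p (λ_ S.p) a).hom := by
  rw [precomp_naturality_left S.p S.idProd a (λ_ S.p) a (φ := 𝟙 _) (ψ := 𝟙 _)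
    (by rw [Category.comp_id, S.idProd_hom]) (by simp), tensorHom₂_id, id_whiskerRight,
    Category.comp_id]

theorem SkewMonoidalData.precomp_idProd_left_inv {X X' : B} {x : X ⟶ X'} {f : X' ⟶ A} {f' : X ⟶ A}
    (a : x ≫ f ≅ f') :
    (precomp S.p S.idProd a).inv = (precomp S.p (λ_ S.p) a).inv ≫
      ((tensorId A A).inv ⊠₂ 𝟙 x) ▷ ((S.p ⊠₁ f) ≫ S.p) := by
  rw [← cancel_epi (precomp S.p S.idProd a).hom, Iso.hom_inv_id, S.precomp_idProd_left,
    Category.assoc, Iso.hom_inv_id_assoc, ← comp_whiskerRight, ← tensorHom₂_comp, Iso.hom_inv_id,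
    Category.comp_id, tensorHom₂_id, id_whiskerRight]

variable {W X Y Z : B} {f : W ⟶ A} {g : X ⟶ A} {h : Y ⟶ A} {k : Z ⟶ A} {m : W ⊠ X ⟶ A}
  {n : X ⊠ Y ⟶ A} {q : Y ⊠ Z ⟶ A}

/-- One side of the pentagon at four generalised elements. -/
def SkewMonoidalData.pentagonLeft (e : (f ⊠₁ g) ≫ S.p ≅ m) (e' : (g ⊠₁ h) ≫ S.p ≅ n)
    (e'' : (h ⊠₁ k) ≫ S.p ≅ q) :
    (((m ⊠₁ h) ≫ S.p) ⊠₁ k) ≫ S.p ⟶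
      asc (W ⊠ X) Y Z ≫ asc W X (Y ⊠ Z) ≫ (f ⊠₁ ((g ⊠₁ q) ≫ S.p)) ≫ S.p :=
  (S.assocAt e e' ⊠₂ 𝟙 k) ▷ S.p ≫ (precomp S.p (Iso.refl _) (λ_ k)).inv ≫
    (asc W X Y ⊠₁ 𝟙 Z) ◁ S.assocAt (Iso.refl _) (Iso.refl _) ≫
    (asc W X Y ⊠₁ 𝟙 Z) ◁ asc W (X ⊠ Y) Z ◁
      ((𝟙 f ⊠₂ S.assocAt e' e'') ▷ S.p ≫ (precomp S.p (λ_ f) (Iso.refl _)).inv) ≫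
    (pentMove W X Y Z _).hom

/-- The other side of the pentagon at four generalised elements. -/
def SkewMonoidalData.pentagonRight (e : (f ⊠₁ g) ≫ S.p ≅ m)
    (e'' : (h ⊠₁ k) ≫ S.p ≅ q) :
    (((m ⊠₁ h) ≫ S.p) ⊠₁ k) ≫ S.p ⟶
      asc (W ⊠ X) Y Z ≫ asc W X (Y ⊠ Z) ≫ (f ⊠₁ ((g ⊠₁ q) ≫ S.p)) ≫ S.p :=
  S.assocAt (Iso.refl _) e'' ≫ asc (W ⊠ X) Y Z ◁ S.assocAt e (Iso.refl _)

/-- Up to invertible 2-cells at the two ends, which are the same as in `pentagon_right_eq`, a side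
of the pentagon axiom is its element form at four identities. -/
theorem SkewMonoidalData.pentagon_left_eq :
    𝟙 (((S.p ⊠₁ 𝟙 A) ⊠₁ 𝟙 A) ≫ (S.p ⊠₁ 𝟙 A) ≫ S.p) ⊗≫
      ((fuseRight (S.p ⊠₁ 𝟙 A) S.p A).hom ≫ S.assoc ⊠₂ 𝟙 (𝟙 A) ≫
        (fuseRight (asc A A A) ((𝟙 A ⊠₁ S.p) ≫ S.p) A).inv ≫
        (asc A A A ⊠₁ 𝟙 A) ◁ (fuseRight (𝟙 A ⊠₁ S.p) S.p A).inv) ▷ S.p ⊗≫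
      ((asc A A A ⊠₁ 𝟙 A) ≫ ((𝟙 A ⊠₁ S.p) ⊠₁ 𝟙 A)) ◁ S.assoc ⊗≫
      (asc A A A ⊠₁ 𝟙 A) ◁ (ascNat (𝟙 A) S.p (𝟙 A)).hom ▷ ((𝟙 A ⊠₁ S.p) ≫ S.p) ⊗≫
      ((asc A A A ⊠₁ 𝟙 A) ≫ asc A (A ⊠ A) A) ◁
        ((fuseLeft A (S.p ⊠₁ 𝟙 A) S.p).hom ≫ 𝟙 (𝟙 A) ⊠₂ S.assoc ≫
          (fuseLeft A (asc A A A) ((𝟙 A ⊠₁ S.p) ≫ S.p)).inv ≫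
          (𝟙 A ⊠₁ asc A A A) ◁ (fuseLeft A (𝟙 A ⊠₁ S.p) S.p).inv) ▷ S.p ⊗≫
      (MonoidalBicategory.pent A A A A).hom ▷ ((𝟙 A ⊠₁ (𝟙 A ⊠₁ S.p)) ≫ (𝟙 A ⊠₁ S.p) ≫ S.p) ⊗≫
    𝟙 (asc (A ⊠ A) A A ≫ asc A A (A ⊠ A) ≫ (𝟙 A ⊠₁ (𝟙 A ⊠₁ S.p)) ≫ (𝟙 A ⊠₁ S.p) ≫ S.p) =
    (precomp S.p (Iso.refl _) (λ_ (𝟙 A))).hom ≫ S.pentagonLeft S.idProd S.idProd S.idProd ≫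
      asc (A ⊠ A) A A ◁ asc A A (A ⊠ A) ◁ (precomp S.p (λ_ (𝟙 A)) (Iso.refl _)).inv := by
  rw [pentagonLeft, S.assocAt_idProd]
  simp only [Category.assoc]
  rw [← pentMove_naturality]
  simp only [assocAt, fuseRight, fuseLeft, precomp_hom, precomp_inv, pentMove, squareMove_hom,
    Iso.trans_hom, Iso.symm_hom, whiskerLeftIso_hom, whiskerRightIso_hom, leftUnitor_id_eq]
  bicategory

theorem SkewMonoidalData.pentagon_right_eq :
    𝟙 (((S.p ⊠₁ 𝟙 A) ⊠₁ 𝟙 A) ≫ (S.p ⊠₁ 𝟙 A) ≫ S.p) ⊗≫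
      ((S.p ⊠₁ 𝟙 A) ⊠₁ 𝟙 A) ◁ S.assoc ⊗≫
      ((ascNat S.p (𝟙 A) (𝟙 A)).hom ≫ asc (A ⊠ A) A A ◁ (𝟙 S.p ⊠₂ (tensorId A A).hom)) ▷
        ((𝟙 A ⊠₁ S.p) ≫ S.p) ⊗≫
      asc (A ⊠ A) A A ◁ (interchange S.p S.p).hom ▷ S.p ⊗≫
      (asc (A ⊠ A) A A ≫ (𝟙 (A ⊠ A) ⊠₁ S.p)) ◁ S.assoc ⊗≫
      asc (A ⊠ A) A A ◁ (((tensorId A A).inv ⊠₂ 𝟙 S.p) ▷ asc A A A ≫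
        (ascNat (𝟙 A) (𝟙 A) S.p).hom) ▷ ((𝟙 A ⊠₁ S.p) ≫ S.p) ⊗≫
    𝟙 (asc (A ⊠ A) A A ≫ asc A A (A ⊠ A) ≫ (𝟙 A ⊠₁ (𝟙 A ⊠₁ S.p)) ≫ (𝟙 A ⊠₁ S.p) ≫ S.p) =
    (precomp S.p (Iso.refl _) (λ_ (𝟙 A))).hom ≫ S.pentagonRight S.idProd S.idProd ≫
      asc (A ⊠ A) A A ◁ asc A A (A ⊠ A) ◁ (precomp S.p (λ_ (𝟙 A)) (Iso.refl _)).inv := by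
  -- In the axiom the cell `1 ≅ 1 ⊗ 1` comes after the second associativity constraint, in `assocAt`
  -- before it; interchange reconciles the two.
  have h := congrArg (fun a => asc (A ⊠ A) A A ◁ a)
    (whisker_exchange ((tensorId A A).inv ⊠₂ 𝟙 S.p) S.assoc)
  have h' (i : (𝟙 A ⊠₁ (𝟙 A ⊠₁ S.p)) ≫ (𝟙 A ⊠₁ S.p) ≫ S.p ≅ (𝟙 A ⊠₁ ((𝟙 A ⊠₁ S.p) ≫ S.p)) ≫ S.p) :
      asc (A ⊠ A) A A ◁ asc A A (A ⊠ A) ◁ i.hom ≫ asc (A ⊠ A) A A ◁ asc A A (A ⊠ A) ◁ i.inv =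
        𝟙 _ := by
    rw [← whiskerLeft_comp, whiskerLeft_hom_inv, whiskerLeft_id]
  simp only [whiskerLeft_comp] at h
  rw [pentagonRight]
  simp only [assocAt, Category.assoc, whiskerLeft_comp, leftUnitor_id_eq, Iso.hom_inv_id_assoc,
    h', Category.comp_id, S.precomp_idProd_right, S.precomp_idProd_left_inv, ← reassoc_of% h]
  simp only [precomp_hom, precomp_inv, interchange, squareMove_hom, Iso.trans_hom, Iso.symm_hom]
  bicategory

end Elements

/-! ### The pentagon at arbitrary generalised elements -/

section Elements

variable {B : Type u} [Bicategory.{w, v} B] [MonoidalBicategory B] {A : B} (S : SkewMonoidalData A)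

/-- The modification axiom for `pent`, with the pasted squares split into successive moves. -/
theorem pentMove_square {W W' X X' Y Y' Z Z' K : B} (f : W ⟶ W') (g : X ⟶ X') (h : Y ⟶ Y')
    (k : Z ⟶ Z') (m : W' ⊠ X' ⊠ Y' ⊠ Z' ⟶ K) :
    (((f ⊠₁ g) ⊠₁ h) ⊠₁ k) ◁ (pentMove W' X' Y' Z' m).hom ≫ (ascMove (f ⊠₁ g) h k _).hom ≫
        asc (W ⊠ X) Y Z ◁ (ascMove f g (h ⊠₁ k) _).hom =
      (squareMove (tensorSquare (ascNat f g h) (idSquare k)) _).hom ≫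
        (asc W X Y ⊠₁ 𝟙 Z) ◁ (ascMove f (g ⊠₁ h) k _).hom ≫
        (asc W X Y ⊠₁ 𝟙 Z) ◁ asc W (X ⊠ Y) Z ◁
          (squareMove (tensorSquare (idSquare f) (ascNat g h k)) _).hom ≫
        (pentMove W X Y Z _).hom := by
  have h := squareMove_whisker (MonoidalBicategory.pent_naturality f g h k) m
  simp only [squareMove_pasteSquare, Category.assoc] at h
  have h' := congrArg (fun a => _ ◁ _ ◁ (α_ _ _ _).inv ≫ _ ◁ (α_ _ _ _).inv ≫ a ≫
    (α_ _ _ _).hom) h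
  simp only [pentMove, Iso.trans_hom, Iso.symm_hom, whiskerLeftIso_hom, whiskerRightIso_hom]
  refine Eq.trans ?_ (h'.trans ?_)
  · simp
  · simp only [squareMove_hom]
    bicategory

variable {W X Y Z : B} {f : W ⟶ A} {g : X ⟶ A} {h : Y ⟶ A} {k : Z ⟶ A} {m : W ⊠ X ⟶ A}
  {n : X ⊠ Y ⟶ A} {q : Y ⊠ Z ⟶ A}

theorem SkewMonoidalData.assocAt_idProd_precomp (e : (f ⊠₁ g) ≫ S.p ≅ m)
    (e' : (g ⊠₁ h) ≫ S.p ≅ n) :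
    ((f ⊠₁ g) ⊠₁ h) ◁ S.assocAt S.idProd S.idProd ≫ (ascMove f g h _).hom ≫
        asc W X Y ◁ (precomp S.p (ρ_ f) e').hom =
      (precomp S.p e (ρ_ h)).hom ≫ S.assocAt e e' :=
  S.assocAt_precomp S.idProd S.idProd e e' (ρ_ f) (ρ_ g) (ρ_ h) e e'
    (by rw [S.whiskerLeft_idProd]) (by rw [S.whiskerLeft_idProd])

theorem SkewMonoidalData.pentagonRight_precomp (e : (f ⊠₁ g) ≫ S.p ≅ m)
    (e'' : (h ⊠₁ k) ≫ S.p ≅ q) :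
    (((f ⊠₁ g) ⊠₁ h) ⊠₁ k) ◁ S.pentagonRight S.idProd S.idProd ≫
        (ascMove (f ⊠₁ g) h k _).hom ≫ asc (W ⊠ X) Y Z ◁ (ascMove f g (h ⊠₁ k) _).hom ≫
        asc (W ⊠ X) Y Z ◁ asc W X (Y ⊠ Z) ◁ (precomp S.p (ρ_ f) (precomp S.p (ρ_ g) e'')).hom =
      (precomp S.p (precomp S.p e (ρ_ h)) (ρ_ k)).hom ≫ S.pentagonRight e e'' := by
  have h₁ := S.assocAt_precomp (Iso.refl ((S.p ⊠₁ 𝟙 A) ≫ S.p)) S.idProd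
    (Iso.refl ((m ⊠₁ h) ≫ S.p)) e'' e (ρ_ h) (ρ_ k) (precomp S.p e (ρ_ h)) e'' (by simp)
    (by rw [S.whiskerLeft_idProd])
  have h₂ := congrArg (fun a => asc (W ⊠ X) Y Z ◁ a) (S.assocAt_precomp S.idProd
    (Iso.refl ((𝟙 A ⊠₁ S.p) ≫ S.p)) e (Iso.refl ((g ⊠₁ q) ≫ S.p)) (ρ_ f) (ρ_ g) e'' e
    (precomp S.p (ρ_ g) e'') (by rw [S.whiskerLeft_idProd]) (by simp))
  simp only [whiskerLeft_comp] at h₂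
  simp only [pentagonRight, whiskerLeft_comp, Category.assoc]
  rw [reassoc_of% squareMove_naturality_right, h₂, reassoc_of% h₁]

/-- The 1-cells `f, g, h, k` are pushed through the constraints one at a time: `pentMove_square` for
the pentagon of `a`, `assocAt_precomp` for each associativity constraint, and `precomp_tensorSquare`
where a square for `a` occurs inside a tensor factor. -/
theorem SkewMonoidalData.pentagonLeft_precomp (e : (f ⊠₁ g) ≫ S.p ≅ m) (e' : (g ⊠₁ h) ≫ S.p ≅ n)
    (e'' : (h ⊠₁ k) ≫ S.p ≅ q) :
    (((f ⊠₁ g) ⊠₁ h) ⊠₁ k) ◁ S.pentagonLeft S.idProd S.idProd S.idProd ≫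
        (ascMove (f ⊠₁ g) h k _).hom ≫ asc (W ⊠ X) Y Z ◁ (ascMove f g (h ⊠₁ k) _).hom ≫
        asc (W ⊠ X) Y Z ◁ asc W X (Y ⊠ Z) ◁ (precomp S.p (ρ_ f) (precomp S.p (ρ_ g) e'')).hom =
      (precomp S.p (precomp S.p e (ρ_ h)) (ρ_ k)).hom ≫ S.pentagonLeft e e' e'' := by
  -- These name the targets of the inner associativity constraints after substitution of `f, g, h`
  -- and of `g, h, k`.
  let i₁ := ascMove f g h _ ≪≫ whiskerLeftIso (asc W X Y) (precomp S.p (ρ_ f) e')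
  let i₂ := ascMove g h k _ ≪≫ whiskerLeftIso (asc X Y Z) (precomp S.p (ρ_ g) e'')
  have h₁ := precomp_naturality_right S.p (precomp S.p e (ρ_ h)) (ρ_ k) i₁ (ρ_ k)
    (θ := 𝟙 (𝟙 A)) (ψ := 𝟙 k) (S.assocAt_idProd_precomp e e') (by simp)
  have h₂ := precomp_tensorSquare S.p (s := ascNat f g h) (t := idSquare k)
    (i := Iso.refl _) (i' := λ_ (𝟙 A)) (j := i₁) (j' := ρ_ k)
    (l := precomp S.p (ρ_ f) e') (l' := ρ_ k) (r := Iso.refl _) (r' := λ_ k)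
    (by simp [i₁]) (by simp [squareMove_hom, idSquare])
  have h₃ := S.assocAt_precomp (Iso.refl ((𝟙 A ⊠₁ S.p) ≫ S.p)) (Iso.refl ((S.p ⊠₁ 𝟙 A) ≫ S.p))
    (Iso.refl ((f ⊠₁ n) ≫ S.p)) (Iso.refl ((n ⊠₁ k) ≫ S.p)) (ρ_ f) e' (ρ_ k)
    (precomp S.p (ρ_ f) e') (precomp S.p e' (ρ_ k)) (by simp) (by simp)
  have h₄ := precomp_naturality_right S.p (ρ_ f) (precomp S.p e' (ρ_ k)) (ρ_ f) i₂
    (η := 𝟙 (𝟙 A)) (φ := 𝟙 f) (by simp) (S.assocAt_idProd_precomp e' e'')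
  have h₅ := precomp_tensorSquare S.p (s := idSquare f) (t := ascNat g h k)
    (i := λ_ (𝟙 A)) (i' := Iso.refl _) (j := ρ_ f) (j' := i₂)
    (l := ρ_ f) (l' := precomp S.p (ρ_ g) e'') (r := λ_ f) (r' := Iso.refl _)
    (by simp [squareMove_hom, idSquare]) (by simp [i₂])
  have h₂' : (((f ⊠₁ g) ⊠₁ h) ⊠₁ k) ◁ (precomp S.p (Iso.refl _) (λ_ (𝟙 A))).inv ≫
      (squareMove (tensorSquare (ascNat f g h) (idSquare k)) _).hom ≫
      (asc W X Y ⊠₁ 𝟙 Z) ◁ (precomp S.p (precomp S.p (ρ_ f) e') (ρ_ k)).hom =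
      (precomp S.p i₁ (ρ_ k)).hom ≫ (precomp S.p (Iso.refl _) (λ_ k)).inv := by
    rw [Iso.eq_comp_inv, Category.assoc, Category.assoc, ← h₂, whiskerLeft_inv_hom_assoc]
  have h₅' : (f ⊠₁ ((g ⊠₁ h) ⊠₁ k)) ◁ (precomp S.p (λ_ (𝟙 A)) (Iso.refl _)).inv ≫
      (squareMove (tensorSquare (idSquare f) (ascNat g h k)) _).hom ≫
      (𝟙 W ⊠₁ asc X Y Z) ◁ (precomp S.p (ρ_ f) (precomp S.p (ρ_ g) e'')).hom =
      (precomp S.p (ρ_ f) i₂).hom ≫ (precomp S.p (λ_ f) (Iso.refl _)).inv := by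
    rw [Iso.eq_comp_inv, Category.assoc, Category.assoc, ← h₅, whiskerLeft_inv_hom_assoc]
  have h₃' := congrArg (fun a => (asc W X Y ⊠₁ 𝟙 Z) ◁ a) h₃
  have h₄' := congrArg (fun a => (asc W X Y ⊠₁ 𝟙 Z) ◁ asc W (X ⊠ Y) Z ◁ a) h₄
  have h₅'' := congrArg (fun a => (asc W X Y ⊠₁ 𝟙 Z) ◁ asc W (X ⊠ Y) Z ◁ a) h₅'
  have h₆ {u u' : A ⊠ (A ⊠ A) ⊠ A ⟶ A} (μ : u ⟶ u') := congrArg (fun a => (asc W X Y ⊠₁ 𝟙 Z) ◁ a)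
    (squareMove_naturality_right (ascNat f (g ⊠₁ h) k) μ)
  simp only [whiskerLeft_comp] at h₃' h₄' h₅'' h₆
  simp only [pentagonLeft, whiskerLeft_comp, Category.assoc]
  rw [reassoc_of% pentMove_square, ← pentMove_naturality, reassoc_of% squareMove_naturality_right,
    reassoc_of% squareMove_naturality_right, reassoc_of% squareMove_naturality_right,
    reassoc_of% h₆, reassoc_of% h₆, reassoc_of% h₅'', reassoc_of% h₄', reassoc_of% h₃',
    reassoc_of% h₂', reassoc_of% h₁]

/-- Both sides arise from the universal case by the same whiskering and the same invertible moves,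
and the remaining `precomp` is cancelled. -/
theorem SkewMonoidalData.pentagonLeft_eq_pentagonRight
    (H : S.pentagonLeft S.idProd S.idProd S.idProd = S.pentagonRight S.idProd S.idProd)
    (e : (f ⊠₁ g) ≫ S.p ≅ m) (e' : (g ⊠₁ h) ≫ S.p ≅ n) (e'' : (h ⊠₁ k) ≫ S.p ≅ q) :
    S.pentagonLeft e e' e'' = S.pentagonRight e e'' := by
  rw [← cancel_epi (precomp S.p (precomp S.p e (ρ_ h)) (ρ_ k)).hom, ← S.pentagonLeft_precomp,
    ← S.pentagonRight_precomp, H]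

end Elements

section Transport

variable {B : Type u} [Bicategory.{w, v} B] [TensorBicategory B] {M N K : B}

theorem precomp_trans (p : M ⊠ N ⟶ K) {X X' Y Y' : B} {x : X ⟶ X'} {y : Y ⟶ Y'}
    {f : X' ⟶ M} {g : Y' ⟶ N} {h h' : X ⟶ M} {k k' : Y ⟶ N} (e : x ≫ f ≅ h) (e' : y ≫ g ≅ k)
    (i : h ≅ h') (i' : k ≅ k') :
    (precomp p (e ≪≫ i) (e' ≪≫ i')).hom = (precomp p e e').hom ≫ (i.hom ⊠₂ i'.hom) ▷ p := by
  rw [precomp_hom, precomp_hom, fuse_trans, comp_whiskerRight, Category.assoc]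

end Transport

section Tensor

variable {B : Type u} [Bicategory.{w, v} B] [TensorBicategory B]

theorem comp_tensorHom₂_id {X X' Y Y' : B} {f f' f'' : X ⟶ X'} (η : f ⟶ f') (θ : f' ⟶ f'')
    (g : Y ⟶ Y') : (η ≫ θ) ⊠₂ 𝟙 g = η ⊠₂ 𝟙 g ≫ θ ⊠₂ 𝟙 g := by
  rw [← tensorHom₂_comp, Category.comp_id]

theorem id_tensorHom₂_comp {X X' Y Y' : B} (f : X ⟶ X') {g g' g'' : Y ⟶ Y'} (η : g ⟶ g')
    (θ : g' ⟶ g'') : 𝟙 f ⊠₂ (η ≫ θ) = 𝟙 f ⊠₂ η ≫ 𝟙 f ⊠₂ θ := by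
  rw [← tensorHom₂_comp, Category.comp_id]

end Tensor

/-! ### Comparing products for `p` and for `(t ⊗ 1) p` -/

section Twist

variable {B : Type u} [Bicategory.{w, v} B] [TensorBicategory B] {M M' N K : B}

theorem precomp_inv_whiskerLeft (p : M' ⊠ N ⟶ K) (t : M ⟶ M') {X Y : B} {y : X ⟶ Y} {x : Y ⟶ N}
    {x' : Y ⟶ N} (c : x ≫ 𝟙 N ≅ x') :
    (precomp ((t ⊠₁ 𝟙 N) ≫ p) (λ_ (𝟙 M)) (Iso.refl (y ≫ x))).inv ≫
        (𝟙 M ⊠₁ y) ◁ (precomp p (λ_ t) c).hom =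
      (precomp p (λ_ t) (α_ _ _ _ ≪≫ whiskerLeftIso y c)).hom ≫
        (precomp p (λ_ t) (Iso.refl (y ≫ x'))).inv := by
  have h := precomp_precomp p (λ_ t) (λ_ t) (λ_ (𝟙 M)) (λ_ t) c (Iso.refl _)
    (Iso.refl _) (α_ _ _ _ ≪≫ whiskerLeftIso y c) (by simp) (by simp)
  rw [Iso.eq_comp_inv, Category.assoc, h, precomp_inv]
  simp

/-- The new product applies `t` to its left factor. A 2-cell `ω` in that factor therefore appears as
`ω ▷ t`, and composes there with `β`. With `ω` the new associativity or right unit constraint, the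
combined cell is exactly one side of a warping axiom. -/
theorem precomp_inv_whiskerRight (p : M' ⊠ N ⟶ K) (t : M ⟶ M') {X Y : B} {u : X ⟶ M} {y : X ⟶ Y}
    {x : Y ⟶ M} {x' : Y ⟶ M'} (ω : u ⟶ y ≫ x) (β : x ≫ t ⟶ x') :
    (ω ⊠₂ 𝟙 (𝟙 N)) ▷ ((t ⊠₁ 𝟙 N) ≫ p) ≫
        (precomp ((t ⊠₁ 𝟙 N) ≫ p) (Iso.refl (y ≫ x)) (λ_ (𝟙 N))).inv ≫
        (y ⊠₁ 𝟙 N) ◁ (precomp p (Iso.refl (x ≫ t)) (ρ_ (𝟙 N))).hom ≫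
        (y ⊠₁ 𝟙 N) ◁ (β ⊠₂ 𝟙 (𝟙 N)) ▷ p =
      (precomp p (Iso.refl (u ≫ t)) (ρ_ (𝟙 N))).hom ≫
        ((ω ▷ t ≫ (α_ _ _ _).hom ≫ y ◁ β) ⊠₂ 𝟙 (𝟙 N)) ▷ p ≫
        (precomp p (Iso.refl (y ≫ x')) (λ_ (𝟙 N))).inv := by
  have h₁ := precomp_naturality_right p (x := y) (y := 𝟙 N) (Iso.refl _) (λ_ (𝟙 N))
    (Iso.refl _) (λ_ (𝟙 N)) (η := β) (θ := 𝟙 (𝟙 N)) (φ := y ◁ β) (ψ := 𝟙 (𝟙 N))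
    (by simp) (by simp)
  have h₂ := precomp_precomp p (Iso.refl (x ≫ t)) (Iso.refl _) (Iso.refl _) (α_ y x t)
    (ρ_ (𝟙 N)) (λ_ (𝟙 N)) (λ_ (𝟙 N)) (ρ_ (𝟙 N)) (by simp) (by simp [leftUnitor_id_eq])
  have h₃ := precomp_naturality_left p (Iso.refl _) (ρ_ (𝟙 N)) (α_ y x t)
    (ρ_ (𝟙 N)) (η := ω) (θ := 𝟙 (𝟙 N)) (φ := ω ▷ t ≫ (α_ _ _ _).hom) (ψ := 𝟙 _)
    (Category.id_comp _).symm (by simp)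
  have h₄ : (precomp ((t ⊠₁ 𝟙 N) ≫ p) (Iso.refl _) (λ_ (𝟙 N))).inv ≫
      (y ⊠₁ 𝟙 N) ◁ (precomp p (Iso.refl (x ≫ t)) (ρ_ (𝟙 N))).hom ≫
      (precomp p (Iso.refl _) (λ_ (𝟙 N))).hom = (precomp p (α_ y x t) (ρ_ (𝟙 N))).hom := by
    rw [h₂, precomp_inv]
    simp
  rw [← cancel_mono (precomp p (Iso.refl _) (λ_ (𝟙 N))).hom]
  simp only [Category.assoc, Iso.inv_hom_id, Category.comp_id]
  rw [h₁, reassoc_of% h₄, reassoc_of% h₃, ← comp_whiskerRight, ← comp_tensorHom₂_id,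
    Category.assoc]

end Twist

/-! ### The warped constraints at generalised elements -/

namespace SkewLeftWarping

variable {B : Type u} [Bicategory.{w, v} B] [MonoidalBicategory B] {A : B}
  {S : LeftSkewMonoidale A} (W : SkewLeftWarping S)

/-- The 2-cell `v` of a skew left warping at two generalised elements. -/
def vAt {X Y : B} {f f' : X ⟶ A} {g g' : Y ⟶ A} {u : X ⊠ Y ⟶ A}
    (e : (f ⊠₁ g) ≫ (W.t ⊠₁ 𝟙 A) ≫ S.p ≅ u) (a : f ≫ W.t ≅ f') (b : g ≫ W.t ≅ g') :
    u ≫ W.t ⟶ (f' ⊠₁ g') ≫ S.p :=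
  e.inv ▷ W.t ≫ (α_ _ _ _).hom ≫ (f ⊠₁ g) ◁ W.v ≫ (precomp S.p a b).hom

/-- The 2-cell `κ` of a skew left warping at a generalised element. -/
def kappaAt {X : B} {f f' : X ⟶ A} (a : f ≫ W.t ≅ f') : f ⟶ run X ≫ (f' ⊠₁ W.k) ≫ S.p :=
  (ρ_ f).inv ≫ f ◁ W.κ ≫ (runMove f _).hom ≫ run X ◁ (precomp S.p a (λ_ W.k)).hom

/-- The new left skew-monoidal structure determined by a skew left warping, in terms of generalised
elements. -/
abbrev warped : SkewMonoidalData A where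
  p := (W.t ⊠₁ 𝟙 A) ≫ S.p
  j := W.k
  assoc := (precomp S.p (Iso.refl _) (λ_ (𝟙 A))).hom ≫ (W.v ⊠₂ 𝟙 (𝟙 A)) ▷ S.p ≫
    S.assocAt (Iso.refl _) (Iso.refl _) ≫
    asc A A A ◁ (precomp S.p (λ_ W.t) (ρ_ ((W.t ⊠₁ 𝟙 A) ≫ S.p))).inv
  left := (precomp S.p (Iso.refl _) (λ_ (𝟙 A))).hom ≫ (W.v₀ ⊠₂ 𝟙 (𝟙 A)) ▷ S.p ≫ S.left
  right := W.κ ≫ run A ◁ (precomp S.p (λ_ W.t) (ρ_ W.k)).inv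

/-- The two presentations differ by bicategorical coherence only; the remaining arguments use
`warped`. -/
theorem newData_eq_warped : W.newData = W.warped := by
  refine SkewMonoidalData.ext rfl rfl (heq_of_eq ?_) (heq_of_eq ?_) HEq.rfl
  · simp only [newData, SkewMonoidalData.assocAt, precomp_hom, precomp_inv, squareMove_hom,
      fuseRight, leftUnitor_id_eq]
    bicategory
  · simp only [newData, precomp_hom, fuseRight]
    bicategory

theorem warped_leftAt {X : B} (f : X ⟶ A) : W.warped.leftAt f =
    (precomp S.p (Iso.refl _) (ρ_ f)).hom ≫ (W.v₀ ⊠₂ 𝟙 f) ▷ S.p ≫ S.leftAt f := by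
  have h₁ := precomp_precomp S.p (Iso.refl (W.k ≫ W.t)) (λ_ _) (λ_ W.k) (Iso.refl (W.k ≫ W.t))
    (λ_ (𝟙 A)) (ρ_ f) (ρ_ f) (ρ_ f) (by simp) (by simp [leftUnitor_id_eq])
  have h₂ := precomp_naturality_right S.p (λ_ _) (ρ_ f) (λ_ _) (ρ_ f)
    (leftUnitor_naturality W.v₀) (θ := 𝟙 (𝟙 A)) (ψ := 𝟙 f) (by simp)
  have h₃ : (precomp ((W.t ⊠₁ 𝟙 A) ≫ S.p) (λ_ W.k) (ρ_ f)).inv ≫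
      (𝟙 (unitObj B) ⊠₁ f) ◁ (precomp S.p (Iso.refl (W.k ≫ W.t)) (λ_ (𝟙 A))).hom =
      (precomp S.p (Iso.refl _) (ρ_ f)).hom ≫ (precomp S.p (λ_ _) (ρ_ f)).inv := by
    rw [Iso.eq_comp_inv, Category.assoc, h₁, precomp_inv]
    simp
  have h₂' := h₂
  rw [← Iso.eq_comp_inv, Category.assoc, ← Iso.inv_comp_eq] at h₂'
  simp only [SkewMonoidalData.leftAt, whiskerLeft_comp, Category.assoc]
  rw [reassoc_of% h₃, reassoc_of% h₂']

theorem warped_rightAt {X : B} {f f' : X ⟶ A} (a : f ≫ W.t ≅ f') :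
    W.warped.rightAt f ≫ run X ◁ (precomp S.p a (ρ_ W.k)).hom = W.kappaAt a := by
  have h₁ := precomp_precomp S.p (λ_ W.t) a (ρ_ f) a (ρ_ W.k) (λ_ W.k) (λ_ W.k) (ρ_ W.k) (by simp)
    (by simp)
  have h₃ : f ◁ run A ◁ (precomp S.p (λ_ W.t) (ρ_ W.k)).inv ≫ (runMove f _).hom ≫
      run X ◁ (precomp ((W.t ⊠₁ 𝟙 A) ≫ S.p) (ρ_ f) (λ_ W.k)).hom ≫
      run X ◁ (precomp S.p a (ρ_ W.k)).hom =
      (runMove f _).hom ≫ run X ◁ (precomp S.p a (λ_ W.k)).hom := by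
    rw [reassoc_of% squareMove_naturality_right, precomp_hom ((W.t ⊠₁ 𝟙 A) ≫ S.p)]
    simp only [← whiskerLeft_comp, Category.assoc]
    rw [← h₁, whiskerLeft_inv_hom_assoc]
  simp only [SkewMonoidalData.rightAt, kappaAt, whiskerLeft_comp, Category.assoc]
  rw [h₃]

/-- The new associativity at `f, g, h` is `v` at `f, g`, multiplied by `h`, followed by the old
associativity at `tf, tg, h`. The isomorphisms `a` and `b` name `tf` and `tg`; `c` absorbs the
factor `𝟙 A` of the new product. -/
theorem warped_assocAt {X Y Z : B} {f f' : X ⟶ A} {g g' : Y ⟶ A} {h : Z ⟶ A} {u : X ⊠ Y ⟶ A}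
    {n n' : Y ⊠ Z ⟶ A} (e : (f ⊠₁ g) ≫ (W.t ⊠₁ 𝟙 A) ≫ S.p ≅ u)
    (e₂ : (g ⊠₁ h) ≫ (W.t ⊠₁ 𝟙 A) ≫ S.p ≅ n) (a : f ≫ W.t ≅ f') (b : g ≫ W.t ≅ g')
    (c : n ≫ 𝟙 A ≅ n') (e₃ : (g' ⊠₁ h) ≫ S.p ≅ n')
    (w : e₂.hom ≫ (ρ_ n).inv ≫ c.hom = (precomp S.p b (ρ_ h)).hom ≫ e₃.hom) :
    W.warped.assocAt e e₂ ≫ asc X Y Z ◁ (precomp S.p a c).hom =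
      (precomp S.p (Iso.refl (u ≫ W.t)) (ρ_ h)).hom ≫ (W.vAt e a b ⊠₂ 𝟙 h) ▷ S.p ≫
        S.assocAt (Iso.refl _) e₃ := by
  let d := e₂ ≪≫ (ρ_ n).symm ≪≫ c
  let i := (α_ _ _ _).symm ≪≫ whiskerRightIso e W.t
  have h₁ := precomp_precomp S.p (λ_ W.t) a (ρ_ f) a (ρ_ ((W.t ⊠₁ 𝟙 A) ≫ S.p)) d e₂ c (by simp)
    (by simp [d])
  have h₁' : (f ⊠₁ (g ⊠₁ h)) ◁ (precomp S.p (λ_ W.t) (ρ_ ((W.t ⊠₁ 𝟙 A) ≫ S.p))).inv ≫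
      (precomp ((W.t ⊠₁ 𝟙 A) ≫ S.p) (ρ_ f) e₂).hom ≫ (precomp S.p a c).hom =
      (precomp S.p a d).hom := by
    rw [precomp_hom ((W.t ⊠₁ 𝟙 A) ≫ S.p), Category.assoc, ← h₁, whiskerLeft_inv_hom_assoc]
  have h₂ := S.assocAt_precomp (Iso.refl ((W.t ⊠₁ W.t) ≫ S.p)) (Iso.refl ((W.t ⊠₁ 𝟙 A) ≫ S.p))
    (Iso.refl ((f' ⊠₁ g') ≫ S.p)) e₃ a b (ρ_ h) (precomp S.p a b) d (by simp)
    (by simpa [d] using w)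
  have h₃ := precomp_naturality_right S.p i (ρ_ h) (precomp S.p a b) (ρ_ h) (η := W.v)
    (φ := W.vAt e a b) (θ := 𝟙 (𝟙 A)) (ψ := 𝟙 h) (by simp [i, vAt]) (by simp)
  have h₄ := precomp_precomp S.p (Iso.refl (((W.t ⊠₁ 𝟙 A) ≫ S.p) ≫ W.t)) i e (Iso.refl _)
    (λ_ (𝟙 A)) (ρ_ h) (ρ_ h) (ρ_ h) (by simp [i]) (by simp [leftUnitor_id_eq])
  have h₄' : (precomp ((W.t ⊠₁ 𝟙 A) ≫ S.p) e (ρ_ h)).inv ≫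
      ((f ⊠₁ g) ⊠₁ h) ◁ (precomp S.p (Iso.refl (((W.t ⊠₁ 𝟙 A) ≫ S.p) ≫ W.t)) (λ_ (𝟙 A))).hom ≫
      (precomp S.p i (ρ_ h)).hom = (precomp S.p (Iso.refl _) (ρ_ h)).hom := by
    rw [h₄, precomp_inv]
    simp
  have h₁'' := congrArg (fun z => asc X Y Z ◁ z) h₁'
  simp only [whiskerLeft_comp] at h₁''
  rw [← h₄', Category.assoc, Category.assoc, ← reassoc_of% h₃, ← h₂]
  simp only [SkewMonoidalData.assocAt, whiskerLeft_comp, Category.assoc]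
  rw [reassoc_of% squareMove_naturality_right, h₁'']

end SkewLeftWarping

/-! ### The warping axioms, the opmonoidal morphism and the warped pentagon -/

namespace SkewLeftWarping

variable {B : Type u} [Bicategory.{w, v} B] [MonoidalBicategory B] {A : B}
  {S : LeftSkewMonoidale A} (W : SkewLeftWarping S)

/-- The axiom `warp_assoc` with the new associativity constraint recognised inside it; this is also
the associativity axiom for the opmonoidal morphism. -/
theorem vAt_comp_assoc :
    W.warped.assoc ▷ W.t ≫ (α_ _ _ _).hom ≫ asc A A A ◁
        (W.vAt (Iso.refl _) (λ_ W.t) (Iso.refl _) ≫ (𝟙 W.t ⊠₂ W.v) ▷ S.p) =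
      W.vAt (Iso.refl _) (Iso.refl _) (λ_ W.t) ≫ (W.v ⊠₂ 𝟙 W.t) ▷ S.p ≫
        S.assocAt (Iso.refl _) (Iso.refl _) := by
  have h := congrArg (fun z => (α_ _ _ _).hom ≫ _ ◁ (α_ _ _ _).hom ≫ z ≫ asc A A A ◁
    ((α_ _ _ _).inv ≫ (fuse (ρ_ W.t) (Iso.refl ((W.t ⊠₁ W.t) ≫ S.p))).hom ▷ S.p)) W.warp_assoc
  -- The axiom ends by splitting `t ⊗ ((t ⊗ t) p)`; the inserted pair of inverse cells undoes this.
  have hc : (fuse (λ_ W.t) (Iso.refl (((W.t ⊠₁ 𝟙 A) ≫ S.p) ≫ W.t))).hom ≫ 𝟙 W.t ⊠₂ W.v =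
      ((fuse (λ_ W.t) (Iso.refl (((W.t ⊠₁ 𝟙 A) ≫ S.p) ≫ W.t))).hom ≫ 𝟙 W.t ⊠₂ W.v ≫
      (fuse (ρ_ W.t) (Iso.refl ((W.t ⊠₁ W.t) ≫ S.p))).inv) ≫
      (fuse (ρ_ W.t) (Iso.refl ((W.t ⊠₁ W.t) ≫ S.p))).hom := by
    simp
  have h₁ : W.vAt (Iso.refl _) (λ_ W.t) (Iso.refl _) ≫ (𝟙 W.t ⊠₂ W.v) ▷ S.p =
      (α_ _ _ _).hom ≫ _ ◁ W.v ≫ (α_ _ _ _).inv ≫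
        ((fuse (λ_ W.t) (Iso.refl (((W.t ⊠₁ 𝟙 A) ≫ S.p) ≫ W.t))).hom ≫ 𝟙 W.t ⊠₂ W.v) ▷ S.p := by
    simp [vAt, precomp_hom]
  rw [h₁, hc]
  simp only [vAt, SkewMonoidalData.assocAt, precomp_hom, precomp_inv, squareMove_hom,
    Iso.refl_inv, leftUnitor_id_eq]
  simp only [fuseRight, leftUnitor_id_eq] at h
  refine Eq.trans ?_ (h.symm.trans ?_) <;> bicategory

theorem vAt_comp_left :
    W.vAt (Iso.refl _) (Iso.refl _) (λ_ W.t) ≫ (W.v₀ ⊠₂ 𝟙 W.t) ▷ S.p ≫ S.leftAt W.t =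
      W.warped.left ▷ W.t := by
  have h := congrArg (fun z => (α_ _ _ _).hom ≫ _ ◁ (α_ _ _ _).hom ≫ z) W.warp_left
  simp only [vAt, SkewMonoidalData.leftAt, precomp_hom, precomp_inv, Iso.refl_inv]
  simp only [fuseRight] at h
  refine Eq.trans ?_ (h.trans ?_) <;> bicategory

theorem vAt_comp_right :
    W.warped.right ▷ W.t ≫ (α_ _ _ _).hom ≫ run A ◁
        (W.vAt (Iso.refl _) (λ_ W.t) (Iso.refl _) ≫ (𝟙 W.t ⊠₂ W.v₀) ▷ S.p) =
      (λ_ W.t).hom ≫ S.rightAt W.t := by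
  have h := congrArg (fun z => (λ_ W.t).hom ≫ z) W.warp_right
  simp only [vAt, SkewMonoidalData.rightAt, precomp_hom, precomp_inv, squareMove_hom,
    Iso.refl_inv]
  refine Eq.trans ?_ (h.trans ?_) <;> bicategory

theorem isOpmonoidalMorphism :
    IsOpmonoidalMorphism W.newData S.toSkewMonoidalData W.t W.v₀ W.v where
  comp_assoc := by
    have h := congrArg (fun z => (α_ _ _ _).inv ≫ z) W.vAt_comp_assoc
    simp only [vAt, SkewMonoidalData.assocAt, precomp_hom, precomp_inv, squareMove_hom,
      Iso.refl_inv, leftUnitor_id_eq] at h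
    simp only [newData, fuseRight, leftUnitor_id_eq]
    refine Eq.trans ?_ (h.trans ?_) <;> bicategory
  comp_left := by
    have h := congrArg (fun z => _ ◁ (α_ _ _ _).hom ≫ z) W.warp_left
    simp only [newData]
    refine Eq.trans ?_ (h.trans ?_) <;> bicategory
  comp_right := by
    simp only [newData]
    refine Eq.trans ?_ (W.warp_right.trans ?_) <;> bicategory

theorem warped_idProd_hom :
    W.warped.idProd.hom = (precomp S.p (λ_ W.t) (λ_ (𝟙 A))).hom := by
  rw [precomp_leftUnitor, SkewMonoidalData.idProd_hom]

theorem vAt_idProd : W.vAt W.warped.idProd (λ_ W.t) (λ_ W.t) = W.v := by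
  have h : W.warped.idProd.hom ▷ W.t ≫ W.v =
      (α_ _ _ _).hom ≫ (𝟙 A ⊠₁ 𝟙 A) ◁ W.v ≫ (precomp S.p (λ_ W.t) (λ_ W.t)).hom := by
    rw [precomp_leftUnitor, whisker_exchange_assoc, SkewMonoidalData.idProd_hom]
    simp
  rw [vAt, ← h, ← comp_whiskerRight_assoc, Iso.inv_hom_id, id_whiskerRight, Category.id_comp]

/-- The two new associativity constraints contribute a `v` each. Naturality of the old constraint
brings both to the front, leaving the old pentagon at `t, t, t, 1`. -/
theorem warped_pentagonRight_comp :
    W.warped.pentagonRight W.warped.idProd W.warped.idProd ≫ asc _ _ _ ◁ asc _ _ _ ◁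
        (precomp S.p (λ_ W.t) (ρ_ _ ≪≫ precomp S.p (λ_ W.t) (ρ_ ((W.t ⊠₁ 𝟙 A) ≫ S.p)))).hom =
      (precomp S.p (Iso.refl _) (ρ_ (𝟙 A))).hom ≫
        ((W.vAt (Iso.refl _) (Iso.refl _) (λ_ W.t) ≫ (W.v ⊠₂ 𝟙 W.t) ▷ S.p) ⊠₂ 𝟙 (𝟙 A)) ▷ S.p ≫
        S.pentagonRight (Iso.refl _) (Iso.refl _) := by
  have h₁ := W.warped_assocAt W.warped.idProd (Iso.refl _) (λ_ W.t) (λ_ W.t)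
    (ρ_ _ ≪≫ precomp S.p (λ_ W.t) (ρ_ ((W.t ⊠₁ 𝟙 A) ≫ S.p))) (Iso.refl _) (by simp)
  have h₂ := W.warped_assocAt (f := (W.t ⊠₁ 𝟙 A) ≫ S.p) (Iso.refl _) W.warped.idProd (Iso.refl _)
    (λ_ W.t) (ρ_ _) (Iso.refl _) (by simpa [leftUnitor_id_eq] using W.warped_idProd_hom)
  have h₃ := S.assocAt_naturality (Iso.refl _) (Iso.refl _) (Iso.refl _) (Iso.refl _) (η := W.v)
    (θ := 𝟙 W.t) (ζ := 𝟙 (𝟙 A)) (μ := (W.v ⊠₂ 𝟙 W.t) ▷ S.p) (ν := 𝟙 _) (by simp)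
    (by rw [tensorHom₂_id]; simp)
  have h₁' := congrArg (fun z => asc _ _ _ ◁ z) h₁
  rw [W.vAt_idProd] at h₁'
  simp only [whiskerLeft_comp] at h₁'
  rw [SkewMonoidalData.pentagonRight, SkewMonoidalData.pentagonRight, Category.assoc, h₁',
    reassoc_of% h₂, comp_tensorHom₂_id, comp_whiskerRight, Category.assoc, reassoc_of% h₃]

/-- Three new associativity constraints contribute a `v` each. All are moved into the left factor of
the first product, where `vAt_comp_assoc` replaces them by the initial segment of
`warped_pentagonRight_comp` together with an old associativity constraint. -/
theorem warped_pentagonLeft_comp :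
    W.warped.pentagonLeft W.warped.idProd W.warped.idProd W.warped.idProd ≫
        asc _ _ _ ◁ asc _ _ _ ◁
        (precomp S.p (λ_ W.t) (ρ_ _ ≪≫ precomp S.p (λ_ W.t) (ρ_ ((W.t ⊠₁ 𝟙 A) ≫ S.p)))).hom =
      (precomp S.p (Iso.refl _) (ρ_ (𝟙 A))).hom ≫
        ((W.vAt (Iso.refl _) (Iso.refl _) (λ_ W.t) ≫ (W.v ⊠₂ 𝟙 W.t) ▷ S.p) ⊠₂ 𝟙 (𝟙 A)) ▷ S.p ≫
        S.pentagonLeft (Iso.refl _) (Iso.refl _) (Iso.refl _) := by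
  let q := (W.t ⊠₁ 𝟙 A) ≫ S.p
  let x := (𝟙 A ⊠₁ q) ≫ q
  let x' := (W.t ⊠₁ q) ≫ S.p
  let c : x ≫ 𝟙 A ≅ x' := ρ_ _ ≪≫ precomp S.p (λ_ W.t) (ρ_ q)
  let d : ((q ⊠₁ 𝟙 A) ≫ q) ≫ 𝟙 A ≅ ((q ≫ W.t) ⊠₁ 𝟙 A) ≫ S.p :=
    ρ_ _ ≪≫ precomp S.p (Iso.refl _) (ρ_ (𝟙 A))
  have h₁ := precomp_inv_whiskerLeft S.p W.t (y := asc A A A) c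
  have hα : W.warped.assoc ▷ 𝟙 A ≫ (α_ _ _ _ ≪≫ whiskerLeftIso _ c).hom =
      d.hom ≫ (W.v ⊠₂ 𝟙 (𝟙 A)) ▷ S.p ≫ S.assocAt (Iso.refl _) (Iso.refl _) := by
    have h₀ : W.warped.assoc ≫ asc A A A ◁ (precomp S.p (λ_ W.t) (ρ_ q)).hom =
        (precomp S.p (Iso.refl _) (ρ_ (𝟙 A))).hom ≫ (W.v ⊠₂ 𝟙 (𝟙 A)) ▷ S.p ≫
          S.assocAt (Iso.refl _) (Iso.refl _) := by
      simp [q, leftUnitor_id_eq]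
    simp only [d, c, Iso.trans_hom, whiskerLeftIso_hom, whiskerLeft_comp, Category.assoc]
    rw [← h₀, whiskerLeft_rightUnitor_assoc, Iso.hom_inv_id_assoc, rightUnitor_naturality_assoc]
  have hβ := W.vAt_comp_assoc
  have hω := W.warped.assocAt_idProd
  -- The facts `hα`, `hβ` and `hω` suffice from here on, so the constraint is made opaque to keep
  -- rewriting from unfolding it.
  generalize W.warped.assoc = ω at *
  have h₂ := precomp_naturality_left S.p (λ_ W.t) d (λ_ W.t) _ (η := 𝟙 (𝟙 A)) (φ := 𝟙 W.t)
    (by simp) hα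
  have h₃ := W.warped_assocAt (f := 𝟙 A) (g := q) (h := 𝟙 A) (Iso.refl _) (Iso.refl _)
    (λ_ W.t) (Iso.refl (q ≫ W.t)) d (Iso.refl _) (by simp [d])
  -- Slides the `v` of the innermost constraint, which sits in the middle variable, to the front.
  have h₄ := S.assocAt_naturality (Iso.refl _) (Iso.refl _) (Iso.refl _) (Iso.refl _) (η := 𝟙 W.t)
    (θ := W.v) (ζ := 𝟙 (𝟙 A)) (μ := (𝟙 W.t ⊠₂ W.v) ▷ S.p) (ν := (W.v ⊠₂ 𝟙 (𝟙 A)) ▷ S.p) (by simp)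
    (by simp)
  have h₅ := precomp_inv_whiskerRight S.p W.t ω
    (W.vAt (Iso.refl _) (λ_ W.t) (Iso.refl _) ≫ (𝟙 W.t ⊠₂ W.v) ▷ S.p)
  rw [hβ] at h₅
  have h₁' := congrArg (fun z => (asc A A A ⊠₁ 𝟙 A) ◁ asc A (A ⊠ A) A ◁ z) h₁
  have h₂' := congrArg (fun z => (asc A A A ⊠₁ 𝟙 A) ◁ asc A (A ⊠ A) A ◁ z) h₂
  have h₃' := congrArg (fun z => (asc A A A ⊠₁ 𝟙 A) ◁ z) h₃
  have h₄' := congrArg (fun z => (asc A A A ⊠₁ 𝟙 A) ◁ z) h₄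
  simp only [comp_tensorHom₂_id, comp_whiskerRight, whiskerLeft_comp, Category.assoc] at h₅
  simp only [whiskerLeft_comp, id_tensorHom₂_comp, comp_whiskerRight] at h₁' h₂' h₃' h₄'
  simp only [SkewMonoidalData.pentagonLeft, hω, whiskerLeft_comp, comp_tensorHom₂_id,
    comp_whiskerRight, Category.assoc]
  rw [← pentMove_naturality, reassoc_of% h₁', reassoc_of% h₂', reassoc_of% h₃', ← reassoc_of% h₄',
    reassoc_of% h₅]

end SkewLeftWarping

section Pentagon

variable {B : Type u} [Bicategory.{w, v} B] [MonoidalBicategory B] {A : B}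

theorem SkewMonoidalData.IsLeftSkewMonoidal.pentagonLeft_idProd {S : SkewMonoidalData A}
    (h : S.IsLeftSkewMonoidal) :
    S.pentagonLeft S.idProd S.idProd S.idProd = S.pentagonRight S.idProd S.idProd := by
  have := S.pentagon_left_eq.symm.trans (h.pentagon.trans S.pentagon_right_eq)
  rw [cancel_epi] at this
  let i := whiskerLeftIso (asc (A ⊠ A) A A) (whiskerLeftIso (asc A A (A ⊠ A))
    (precomp S.p (λ_ (𝟙 A)) (Iso.refl ((𝟙 A ⊠₁ S.p) ≫ S.p))).symm)
  exact (cancel_mono i.hom).1 this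

namespace SkewLeftWarping

variable {S : LeftSkewMonoidale A} (W : SkewLeftWarping S)

/-- After an invertible 2-cell is appended, both sides share the same prefix of `v`'s, and the old
pentagon identifies the rest. -/
theorem warped_pentagonLeft_idProd :
    W.warped.pentagonLeft W.warped.idProd W.warped.idProd W.warped.idProd =
      W.warped.pentagonRight W.warped.idProd W.warped.idProd := by
  let i := whiskerLeftIso (asc (A ⊠ A) A A) (whiskerLeftIso (asc A A (A ⊠ A))
    (precomp S.p (λ_ W.t) (ρ_ _ ≪≫ precomp S.p (λ_ W.t) (ρ_ ((W.t ⊠₁ 𝟙 A) ≫ S.p)))))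
  refine (cancel_mono i.hom).1 (W.warped_pentagonLeft_comp.trans (Eq.trans ?_
    W.warped_pentagonRight_comp.symm))
  rw [S.pentagonLeft_eq_pentagonRight S.isLeftSkewMonoidal.pentagonLeft_idProd]

end SkewLeftWarping

end Pentagon

/-! ### The unit triangles -/

section UnitMoves

variable {B : Type u} [Bicategory.{w, v} B] [MonoidalBicategory B]

/-- Replacing the composite of constraints on one side of the left unit triangle by the one on the
other side. -/
def leftMove (X Y : B) {K : B} (m : X ⊠ Y ⟶ K) :
    (lun X ⊠₁ 𝟙 Y) ≫ m ≅ asc (unitObj B) X Y ≫ lun (X ⊠ Y) ≫ m :=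
  whiskerRightIso (MonoidalBicategory.left X Y) m ≪≫ α_ _ _ _

/-- Replacing the composite of constraints on one side of the right unit triangle by the one on the
other side. -/
def rightMove (X Y : B) {K : B} (m : X ⊠ Y ⊠ unitObj B ⟶ K) :
    (𝟙 X ⊠₁ run Y) ≫ m ≅ run (X ⊠ Y) ≫ asc X Y (unitObj B) ≫ m :=
  whiskerRightIso (MonoidalBicategory.right X Y) m ≪≫ α_ _ _ _

/-- Removing the composite of constraints in the middle unit triangle. -/
def midMove (X Y : B) {K : B} (m : X ⊠ Y ⟶ K) :
    (run X ⊠₁ 𝟙 Y) ≫ asc X (unitObj B) Y ≫ (𝟙 X ⊠₁ lun Y) ≫ m ≅ m :=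
  whiskerLeftIso _ (α_ _ _ _).symm ≪≫ (α_ _ _ _).symm ≪≫
    whiskerRightIso (MonoidalBicategory.mid X Y) m ≪≫ λ_ m

theorem leftMove_naturality (X Y : B) {K : B} {m m' : X ⊠ Y ⟶ K} (μ : m ⟶ m') :
    (lun X ⊠₁ 𝟙 Y) ◁ μ ≫ (leftMove X Y m').hom =
      (leftMove X Y m).hom ≫ asc (unitObj B) X Y ◁ lun (X ⊠ Y) ◁ μ := by
  simp only [leftMove, Iso.trans_hom, whiskerRightIso_hom]
  rw [whisker_exchange_assoc]
  simp

theorem rightMove_naturality (X Y : B) {K : B} {m m' : X ⊠ Y ⊠ unitObj B ⟶ K} (μ : m ⟶ m') :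
    (𝟙 X ⊠₁ run Y) ◁ μ ≫ (rightMove X Y m').hom =
      (rightMove X Y m).hom ≫ run (X ⊠ Y) ◁ asc X Y (unitObj B) ◁ μ := by
  simp only [rightMove, Iso.trans_hom, whiskerRightIso_hom]
  rw [whisker_exchange_assoc]
  simp

theorem leftMove_square {X X' Y Y' K : B} (f : X ⟶ X') (g : Y ⟶ Y') (m : X' ⊠ Y' ⟶ K) :
    ((𝟙 (unitObj B) ⊠₁ f) ⊠₁ g) ◁ (leftMove X' Y' m).hom ≫ (ascMove (𝟙 _) f g _).hom ≫
        asc (unitObj B) X Y ◁ (squareMove (lunNat (f ⊠₁ g)) m).hom =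
      (squareMove (tensorSquare (lunNat f) (idSquare g)) m).hom ≫ (leftMove X Y _).hom := by
  have h := squareMove_whisker (MonoidalBicategory.left_naturality f g) m
  simp only [squareMove_pasteSquare] at h
  have h' := congrArg (fun a => a ≫ (α_ _ _ _).hom) h
  simp only [leftMove, Iso.trans_hom, whiskerRightIso_hom]
  refine Eq.trans ?_ (h'.trans ?_) <;> simp

theorem midMove_square {X X' Y Y' K : B} (f : X ⟶ X') (g : Y ⟶ Y') (m : X' ⊠ Y' ⟶ K) :
    (f ⊠₁ g) ◁ (midMove X' Y' m).hom =
      (squareMove (tensorSquare (runNat f) (idSquare g)) _).hom ≫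
        (run X ⊠₁ 𝟙 Y) ◁ (ascMove f (𝟙 _) g _).hom ≫
        (run X ⊠₁ 𝟙 Y) ◁ asc X (unitObj B) Y ◁
          (squareMove (tensorSquare (idSquare f) (lunNat g)) m).hom ≫
        (midMove X Y _).hom := by
  have h := squareMove_whisker (MonoidalBicategory.mid_naturality f g) m
  simp only [squareMove_pasteSquare, Category.assoc] at h
  have h' := congrArg (fun a => _ ◁ _ ◁ (α_ _ _ _).inv ≫ _ ◁ (α_ _ _ _).inv ≫ a ≫
    (λ_ _).hom) h
  simp only [midMove, Iso.trans_hom, Iso.symm_hom, whiskerLeftIso_hom, whiskerRightIso_hom]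
  refine Eq.trans ?_ (h'.trans ?_)
  · simp only [squareMove_hom, idSquare, Iso.trans_hom, Iso.symm_hom]
    bicategory
  · simp only [squareMove_hom]
    bicategory

/-- The composition constraint that splits `x ⊗ z` off in the tensor square cancels against the one
in `precomp`. -/
theorem squareMove_tensorSquare_precomp {X X' Y Z Z' W M N K : B} (p : M ⊠ N ⟶ K)
    {f : X ⟶ X'} {g : Y ⟶ M} {x : X ⟶ Y} {x' : X' ⟶ M} {h : Z ⟶ Z'} {k : W ⟶ N} {z : Z ⟶ W}
    {z' : Z' ⟶ N} (s : f ≫ x' ≅ x ≫ g) (t : h ≫ z' ≅ z ≫ k) {c : X ⟶ M} {d : Z ⟶ N}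
    (r : x ≫ g ≅ c) (r' : z ≫ k ≅ d) :
    (squareMove (tensorSquare s t) p).hom ≫ (precomp p r r').hom =
      (precomp p (s ≪≫ r) (t ≪≫ r')).hom := by
  rw [precomp_trans, precomp_hom, precomp_hom, squareMove_hom, tensorSquare, fuse_hom r r']
  simp only [Iso.trans_hom, comp_whiskerRight, Category.assoc, Iso.hom_inv_id_assoc]
  rw [hom_inv_whiskerRight_assoc]

end UnitMoves

/-! ### The unit axioms in terms of elements -/

section Elements

variable {B : Type u} [Bicategory.{w, v} B] [MonoidalBicategory B] {A : B} (S : SkewMonoidalData A)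

/-- Substitution for the left unit constraint, resting on `lunNat_fuse`. -/
theorem SkewMonoidalData.leftAt_precomp {X Y : B} {x : X ⟶ Y} {f : Y ⟶ A} {f' : X ⟶ A}
    (a : x ≫ f ≅ f') :
    (𝟙 (unitObj B) ⊠₁ x) ◁ S.leftAt f ≫ (squareMove (lunNat x) f).hom ≫ lun X ◁ a.hom =
      (precomp S.p (λ_ S.j) a).hom ≫ S.leftAt f' := by
  have h₁ := precomp_precomp S.p (λ_ S.j) (λ_ S.j) (λ_ (𝟙 (unitObj B))) (λ_ S.j) (ρ_ f) a a (ρ_ f')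
    (by simp [leftUnitor_id_eq]) (by simp)
  have h₂ : (𝟙 (unitObj B) ⊠₁ x) ◁ (precomp S.p (λ_ S.j) (ρ_ f)).inv ≫ (α_ _ _ _).inv ≫
      (fuse (λ_ (𝟙 (unitObj B))) a).hom ▷ ((S.j ⊠₁ 𝟙 A) ≫ S.p) =
        (precomp S.p (λ_ S.j) a).hom ≫ (precomp S.p (λ_ S.j) (ρ_ f')).inv := by
    rw [Iso.eq_comp_inv, Category.assoc, Category.assoc, ← h₁, whiskerLeft_inv_hom_assoc]
  have h₃ := lunNat_fuse a
  simp only [SkewMonoidalData.leftAt, whiskerLeft_comp, squareMove_hom, Category.assoc]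
  rw [h₃, associator_inv_naturality_right_assoc, whisker_exchange_assoc, reassoc_of% h₂]

theorem SkewMonoidalData.leftAt_id : S.leftAt (𝟙 A) = S.left ≫ (ρ_ (lun A)).inv := by
  rw [leftAt, Iso.inv_comp_eq, ← leftUnitor_id_eq, precomp_leftUnitor, lunNat_id,
    whisker_exchange_assoc]
  simp

theorem SkewMonoidalData.left_unit_iff :
    (𝟙 (((S.j ⊠₁ 𝟙 A) ⊠₁ 𝟙 A) ≫ (S.p ⊠₁ 𝟙 A) ≫ S.p) ⊗≫
      ((S.j ⊠₁ 𝟙 A) ⊠₁ 𝟙 A) ◁ S.assoc ⊗≫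
      ((ascNat S.j (𝟙 A) (𝟙 A)).hom ≫
          asc (unitObj B) A A ◁ (𝟙 S.j ⊠₂ (tensorId A A).hom)) ▷ ((𝟙 A ⊠₁ S.p) ≫ S.p) ⊗≫
      asc (unitObj B) A A ◁ (interchange S.j S.p).hom ▷ S.p ⊗≫
      (asc (unitObj B) A A ≫ (𝟙 (unitObj B) ⊠₁ S.p)) ◁ S.left ⊗≫
      asc (unitObj B) A A ◁ (lunNat S.p).hom ⊗≫
      (MonoidalBicategory.left A A).inv ▷ S.p ⊗≫
    𝟙 ((lun A ⊠₁ 𝟙 A) ≫ S.p) =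
    𝟙 (((S.j ⊠₁ 𝟙 A) ⊠₁ 𝟙 A) ≫ (S.p ⊠₁ 𝟙 A) ≫ S.p) ⊗≫
      ((fuseRight (S.j ⊠₁ 𝟙 A) S.p A).hom ≫ S.left ⊠₂ 𝟙 (𝟙 A)) ▷ S.p ⊗≫
    𝟙 ((lun A ⊠₁ 𝟙 A) ≫ S.p)) ↔
    S.assocAt (Iso.refl _) S.idProd ≫ asc (unitObj B) A A ◁ S.leftAt S.p =
      (S.left ⊠₂ 𝟙 (𝟙 A)) ▷ S.p ≫ (leftMove A A S.p).hom := by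
  rw [← Iso.comp_inv_eq, ← cancel_epi (precomp S.p (Iso.refl _) (ρ_ (𝟙 A))).hom]
  refine Eq.congr ?_ ?_
  · simp only [assocAt, leftAt, Category.assoc, whiskerLeft_comp, Iso.hom_inv_id_assoc,
      S.precomp_idProd_right]
    simp only [precomp_hom, precomp_inv, interchange, squareMove_hom, leftMove, Iso.trans_hom,
      Iso.symm_hom, Iso.trans_inv, whiskerRightIso_inv]
    bicategory
  · simp only [precomp_hom, fuseRight, leftUnitor_id_eq]
    bicategory

theorem SkewMonoidalData.right_unit_iff :
    (𝟙 S.p ⊗≫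
      S.p ◁ S.right ⊗≫
      (runNat S.p).hom ▷ ((𝟙 A ⊠₁ S.j) ≫ S.p) ⊗≫
      run (A ⊠ A) ◁ (interchange S.p S.j).hom ▷ S.p ⊗≫
      (run (A ⊠ A) ≫ (𝟙 (A ⊠ A) ⊠₁ S.j)) ◁ S.assoc ⊗≫
      run (A ⊠ A) ◁ (((tensorId A A).inv ⊠₂ 𝟙 S.j) ▷ asc A A A ≫
        (ascNat (𝟙 A) (𝟙 A) S.j).hom) ▷ ((𝟙 A ⊠₁ S.p) ≫ S.p) ⊗≫
      (MonoidalBicategory.right A A).inv ▷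
        ((𝟙 A ⊠₁ (𝟙 A ⊠₁ S.j)) ≫ (𝟙 A ⊠₁ S.p) ≫ S.p) ⊗≫
    𝟙 ((𝟙 A ⊠₁ run A) ≫ (𝟙 A ⊠₁ (𝟙 A ⊠₁ S.j)) ≫ (𝟙 A ⊠₁ S.p) ≫ S.p) =
    𝟙 S.p ⊗≫
      ((tensorId A A).inv ≫ 𝟙 (𝟙 A) ⊠₂ S.right ≫ (fuseLeft A (run A) ((𝟙 A ⊠₁ S.j) ≫ S.p)).inv ≫
        (𝟙 A ⊠₁ run A) ◁ (fuseLeft A (𝟙 A ⊠₁ S.j) S.p).inv) ▷ S.p ⊗≫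
    𝟙 ((𝟙 A ⊠₁ run A) ≫ (𝟙 A ⊠₁ (𝟙 A ⊠₁ S.j)) ≫ (𝟙 A ⊠₁ S.p) ≫ S.p)) ↔
    S.rightAt S.p ≫ run (A ⊠ A) ◁ S.assocAt S.idProd (Iso.refl _) =
      S.idProd.inv ≫ (𝟙 (𝟙 A) ⊠₂ S.right) ▷ S.p ≫ (precomp S.p (λ_ (𝟙 A)) (Iso.refl _)).inv ≫
        (rightMove A A _).hom := by
  let i := precomp S.p (λ_ (𝟙 A)) (Iso.refl ((𝟙 A ⊠₁ S.j) ≫ S.p))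
  have h := congrArg (fun a => run (A ⊠ A) ◁ a)
    (whisker_exchange ((tensorId A A).inv ⊠₂ 𝟙 S.j) S.assoc)
  simp only [whiskerLeft_comp] at h
  have h' : run (A ⊠ A) ◁ asc A A (unitObj B) ◁ i.hom ≫ (rightMove A A _).inv ≫
      (𝟙 A ⊠₁ run A) ◁ i.inv = (rightMove A A _).inv := by
    have h'' : run (A ⊠ A) ◁ asc A A (unitObj B) ◁ i.hom ≫ (rightMove A A _).inv =
        (rightMove A A _).inv ≫ (𝟙 A ⊠₁ run A) ◁ i.hom := by
      rw [Iso.comp_inv_eq, Category.assoc, rightMove_naturality, Iso.inv_hom_id_assoc]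
    rw [reassoc_of% h'', ← whiskerLeft_comp, Iso.hom_inv_id, whiskerLeft_id, Category.comp_id]
  simp only [i] at h'
  -- The axiom ends in the fully split form over `𝟙 ⊗ r`; this invertible cell converts the target
  -- of the element form into it.
  rw [← cancel_mono ((rightMove A A _).inv ≫ (𝟙 A ⊠₁ run A) ◁ i.inv)]
  refine Eq.congr ?_ ?_
  · simp only [assocAt, rightAt, whiskerLeft_comp, Category.assoc, i, ← leftUnitor_id_eq]
    rw [h']
    simp only [S.precomp_idProd_left_inv, whiskerLeft_comp, Category.assoc, ← reassoc_of% h]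
    simp only [precomp_hom, precomp_inv, interchange, squareMove_hom, rightMove, Iso.trans_hom,
      Iso.symm_hom, Iso.trans_inv, whiskerRightIso_inv]
    bicategory
  · simp only [Category.assoc, Iso.hom_inv_id_assoc]
    simp only [i, idProd, Iso.trans_inv, whiskerRightIso_inv, precomp_inv, fuseLeft]
    bicategory

theorem SkewMonoidalData.unit_unit_eq :
    𝟙 S.j ⊗≫
      S.j ◁ S.right ⊗≫
      (runNat S.j).hom ▷ ((𝟙 A ⊠₁ S.j) ≫ S.p) ⊗≫
      run (unitObj B) ◁ (interchange S.j S.j).hom ▷ S.p ⊗≫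
      (run (unitObj B) ≫ (𝟙 (unitObj B) ⊠₁ S.j)) ◁ S.left ⊗≫
      run (unitObj B) ◁ (lunNat S.j).hom ⊗≫
      (unitCell B).hom ▷ S.j ⊗≫
    𝟙 S.j =
    S.rightAt S.j ≫ run (unitObj B) ◁ S.leftAt S.j ≫ (α_ _ _ _).inv ≫ (unitCell B).hom ▷ S.j ≫
      (λ_ S.j).hom := by
  simp only [rightAt, leftAt, precomp_hom, precomp_inv, interchange, squareMove_hom, Iso.trans_hom,
    Iso.symm_hom]
  bicategory

theorem SkewMonoidalData.middle_unit_iff :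
    (𝟙 S.p ⊗≫
      ((tensorId A A).inv ≫ S.right ⊠₂ 𝟙 (𝟙 A) ≫ (fuseRight (run A) ((𝟙 A ⊠₁ S.j) ≫ S.p) A).inv ≫
        (run A ⊠₁ 𝟙 A) ◁ (fuseRight (𝟙 A ⊠₁ S.j) S.p A).inv) ▷ S.p ⊗≫
      ((run A ⊠₁ 𝟙 A) ≫ ((𝟙 A ⊠₁ S.j) ⊠₁ 𝟙 A)) ◁ S.assoc ⊗≫
      (run A ⊠₁ 𝟙 A) ◁ (ascNat (𝟙 A) S.j (𝟙 A)).hom ▷ ((𝟙 A ⊠₁ S.p) ≫ S.p) ⊗≫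
      ((run A ⊠₁ 𝟙 A) ≫ asc A (unitObj B) A) ◁
        ((fuseLeft A (S.j ⊠₁ 𝟙 A) S.p).hom ≫ 𝟙 (𝟙 A) ⊠₂ S.left) ▷ S.p ⊗≫
      (MonoidalBicategory.mid A A).hom ▷ S.p ⊗≫
    𝟙 S.p = 𝟙 S.p) ↔
    (S.right ⊠₂ 𝟙 (𝟙 A)) ▷ S.p ≫ (precomp S.p (Iso.refl _) (λ_ (𝟙 A))).inv ≫
      (run A ⊠₁ 𝟙 A) ◁ S.assocAt (Iso.refl _) (Iso.refl _) ≫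
      (run A ⊠₁ 𝟙 A) ◁ asc A (unitObj B) A ◁ (𝟙 (𝟙 A) ⊠₂ S.left) ▷ S.p ≫ (midMove A A S.p).hom =
      S.idProd.hom := by
  rw [← Iso.inv_comp_eq_id]
  refine Eq.congr ?_ rfl
  simp only [assocAt, idProd, Iso.trans_inv, whiskerRightIso_inv, precomp_hom, precomp_inv,
    fuseLeft, fuseRight, squareMove_hom, midMove, Iso.trans_hom, Iso.symm_hom, whiskerLeftIso_hom,
    whiskerRightIso_hom, leftUnitor_id_eq]
  bicategory

end Elements

/-! ### The left and middle unit axioms at arbitrary generalised elements -/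

section Elements

variable {B : Type u} [Bicategory.{w, v} B] [MonoidalBicategory B] {A : B} (S : SkewMonoidalData A)

/-- The left unit axiom at two generalised elements. -/
theorem SkewMonoidalData.assocAt_leftAt
    (H : S.assocAt (Iso.refl _) S.idProd ≫ asc (unitObj B) A A ◁ S.leftAt S.p =
      (S.left ⊠₂ 𝟙 (𝟙 A)) ▷ S.p ≫ (leftMove A A S.p).hom)
    {X Y : B} {f : X ⟶ A} {g : Y ⟶ A} {n : X ⊠ Y ⟶ A} (e : (f ⊠₁ g) ≫ S.p ≅ n) :
    S.assocAt (Iso.refl _) e ≫ asc (unitObj B) X Y ◁ S.leftAt n =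
      (S.leftAt f ⊠₂ 𝟙 g) ▷ S.p ≫ (precomp S.p (Iso.refl _) (λ_ g)).inv ≫
        (lun X ⊠₁ 𝟙 Y) ◁ e.hom ≫ (leftMove X Y n).hom := by
  have h₁ := S.assocAt_precomp (Iso.refl _) S.idProd (Iso.refl _) e (λ_ S.j) (ρ_ f) (ρ_ g)
    (precomp S.p (λ_ S.j) (ρ_ f)) e (by simp) (by rw [S.whiskerLeft_idProd])
  have h₂ := congrArg (fun z => asc (unitObj B) X Y ◁ z) (S.leftAt_precomp e)
  have h₃ := precomp_naturality_right S.p (precomp S.p (λ_ S.j) (ρ_ f)) (ρ_ g) (lunNat f) (ρ_ g)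
    (η := S.left) (φ := S.leftAt f) (θ := 𝟙 (𝟙 A)) (ψ := 𝟙 g) (by simp [leftAt]) (by simp)
  have h₄ := squareMove_tensorSquare_precomp S.p (lunNat f) (idSquare g) (Iso.refl _) (λ_ g)
  have h₅ : lunNat f ≪≫ Iso.refl _ = lunNat f := Iso.trans_refl _
  have h₆ : idSquare g ≪≫ λ_ g = ρ_ g := by ext; simp [idSquare]
  rw [h₅, h₆, ← Iso.eq_comp_inv] at h₄
  have h₇ := leftMove_square f g S.p
  have h₈ := congrArg (fun z => ((𝟙 (unitObj B) ⊠₁ f) ⊠₁ g) ◁ z) H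
  simp only [whiskerLeft_comp] at h₂ h₈
  -- As for the pentagon: the axiom at identities is whiskered with `f` and `g`, which are then
  -- pushed through every constraint.
  rw [← cancel_epi (precomp S.p (precomp S.p (λ_ S.j) (ρ_ f)) (ρ_ g)).hom, ← reassoc_of% h₁, ← h₂,
    ← reassoc_of% squareMove_naturality_right, reassoc_of% h₈, reassoc_of% h₇,
    ← leftMove_naturality, reassoc_of% h₄, reassoc_of% h₃]

/-- The middle unit axiom at two generalised elements. -/
theorem SkewMonoidalData.rightAt_leftAt
    (H : (S.right ⊠₂ 𝟙 (𝟙 A)) ▷ S.p ≫ (precomp S.p (Iso.refl _) (λ_ (𝟙 A))).inv ≫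
      (run A ⊠₁ 𝟙 A) ◁ S.assocAt (Iso.refl _) (Iso.refl _) ≫
      (run A ⊠₁ 𝟙 A) ◁ asc A (unitObj B) A ◁ (𝟙 (𝟙 A) ⊠₂ S.left) ▷ S.p ≫ (midMove A A S.p).hom =
      S.idProd.hom)
    {X Y : B} (f : X ⟶ A) (g : Y ⟶ A) :
    (S.rightAt f ⊠₂ 𝟙 g) ▷ S.p ≫ (precomp S.p (Iso.refl _) (λ_ g)).inv ≫
      (run X ⊠₁ 𝟙 Y) ◁ S.assocAt (Iso.refl _) (Iso.refl _) ≫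
      (run X ⊠₁ 𝟙 Y) ◁ asc X (unitObj B) Y ◁ (𝟙 f ⊠₂ S.leftAt g) ▷ S.p ≫
      (run X ⊠₁ 𝟙 Y) ◁ asc X (unitObj B) Y ◁ (precomp S.p (λ_ f) (Iso.refl _)).inv ≫
      (midMove X Y _).hom = 𝟙 ((f ⊠₁ g) ≫ S.p) := by
  let i := precomp S.p (ρ_ f) (λ_ S.j)
  let r := runMove f ((𝟙 A ⊠₁ S.j) ≫ S.p) ≪≫ whiskerLeftIso (run X) i
  have h₁ := S.assocAt_precomp (Iso.refl _) (Iso.refl _) (Iso.refl _) (Iso.refl _) (ρ_ f) (λ_ S.j)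
    (ρ_ g) i (precomp S.p (λ_ S.j) (ρ_ g)) (by simp [i]) (by simp)
  have h₂ := precomp_naturality_right S.p (ρ_ f) (precomp S.p (λ_ S.j) (ρ_ g)) (ρ_ f) (lunNat g)
    (η := 𝟙 (𝟙 A)) (φ := 𝟙 f) (θ := S.left) (ψ := S.leftAt g) (by simp) (by simp [leftAt])
  have h₃ := squareMove_tensorSquare_precomp S.p (idSquare f) (lunNat g) (λ_ f) (Iso.refl _)
  have h₅ : lunNat g ≪≫ Iso.refl _ = lunNat g := Iso.trans_refl _
  have h₆ : idSquare f ≪≫ λ_ f = ρ_ f := by ext; simp [idSquare]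
  rw [h₅, h₆, ← Iso.eq_comp_inv] at h₃
  have h₄ := precomp_tensorSquare S.p (s := runNat f) (t := idSquare g) (i := Iso.refl _)
    (i' := λ_ (𝟙 A)) (j := r) (j' := ρ_ g) (l := i) (l' := ρ_ g) (r := Iso.refl _) (r' := λ_ g)
    (by simp [r]) (by simp [squareMove_hom, idSquare])
  have h₄' : (f ⊠₁ g) ◁ (precomp S.p (Iso.refl _) (λ_ (𝟙 A))).inv ≫
      (squareMove (tensorSquare (runNat f) (idSquare g)) _).hom ≫
      (run X ⊠₁ 𝟙 Y) ◁ (precomp S.p i (ρ_ g)).hom =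
      (precomp S.p r (ρ_ g)).hom ≫ (precomp S.p (Iso.refl _) (λ_ g)).inv := by
    rw [Iso.eq_comp_inv, Category.assoc, Category.assoc, ← h₄, whiskerLeft_inv_hom_assoc]
  have h₇ := precomp_naturality_right S.p (ρ_ f) (ρ_ g) r (ρ_ g) (η := S.right)
    (φ := S.rightAt f) (θ := 𝟙 (𝟙 A)) (ψ := 𝟙 g) (by simp [rightAt, r, i]) (by simp)
  have h₈ := congrArg (fun z => (f ⊠₁ g) ◁ z) H
  have h₁' := congrArg (fun z => (run X ⊠₁ 𝟙 Y) ◁ z) h₁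
  have h₂' := congrArg (fun z => (run X ⊠₁ 𝟙 Y) ◁ asc X (unitObj B) Y ◁ z) h₂
  have h₃' := congrArg (fun z => (run X ⊠₁ 𝟙 Y) ◁ asc X (unitObj B) Y ◁ z) h₃
  have h₉ {u u' : A ⊠ unitObj B ⊠ A ⟶ A} (μ : u ⟶ u') := congrArg (fun a => (run X ⊠₁ 𝟙 Y) ◁ a)
    (squareMove_naturality_right (ascNat f (𝟙 (unitObj B)) g) μ)
  simp only [whiskerLeft_comp] at h₁' h₂' h₃' h₈ h₉
  rw [S.whiskerLeft_idProd] at h₈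
  rw [← cancel_epi (precomp S.p (ρ_ f) (ρ_ g)).hom, Category.comp_id]
  refine Eq.trans ?_ h₈
  rw [← reassoc_of% h₇, ← reassoc_of% h₄', ← reassoc_of% h₁', ← reassoc_of% h₂', midMove_square]
  rw [reassoc_of% squareMove_naturality_right, reassoc_of% squareMove_naturality_right,
    reassoc_of% h₉, reassoc_of% h₃']

end Elements

/-! ### The unit axioms of the warped structure and the conclusion -/

namespace SkewLeftWarping

variable {B : Type u} [Bicategory.{w, v} B] [MonoidalBicategory B] {A : B}
  {S : LeftSkewMonoidale A} (W : SkewLeftWarping S)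

/-- The `v₀` in the new unit constraint slides to the front past the old associativity. The old left
unit axiom at `t, 1` leaves `v`, `v₀` and `λ` in the left factor, where `vAt_comp_left` applies. -/
theorem warped_left_unit :
    W.warped.assocAt (Iso.refl _) W.warped.idProd ≫
        asc (unitObj B) A A ◁ W.warped.leftAt W.warped.p =
      (W.warped.left ⊠₂ 𝟙 (𝟙 A)) ▷ W.warped.p ≫ (leftMove A A W.warped.p).hom := by
  have h₁ := W.warped_assocAt (f := W.k) (Iso.refl _) W.warped.idProd (Iso.refl _)
    (λ_ W.t) (ρ_ _) (Iso.refl _) (by simpa [leftUnitor_id_eq] using W.warped_idProd_hom)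
  have h₂ := S.assocAt_naturality (Iso.refl _) (Iso.refl _) (Iso.refl _) (Iso.refl _) (η := W.v₀)
    (θ := 𝟙 W.t) (ζ := 𝟙 (𝟙 A)) (μ := (W.v₀ ⊠₂ 𝟙 W.t) ▷ S.p) (ν := 𝟙 _) (by simp)
    (by rw [tensorHom₂_id]; simp)
  have h₃ := S.assocAt_leftAt (S.left_unit_iff.1 S.isLeftSkewMonoidal.left_unit) (f := W.t)
    (Iso.refl ((W.t ⊠₁ 𝟙 A) ≫ S.p))
  have h₄ := precomp_naturality_left S.p (Iso.refl _) (ρ_ (𝟙 A)) (Iso.refl _) (ρ_ (𝟙 A))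
    (η := W.warped.left) (φ := W.warped.left ▷ W.t) (θ := 𝟙 (𝟙 A)) (ψ := 𝟙 _)
    ((Category.comp_id _).trans (Category.id_comp _).symm) (by simp)
  rw [W.warped_leftAt, whiskerLeft_comp, whiskerLeft_comp, reassoc_of% h₁, ← reassoc_of% h₂, h₃]
  rw [← W.vAt_comp_left] at h₄
  rw [← comp_whiskerRight_assoc, ← comp_tensorHom₂_id, ← comp_whiskerRight_assoc,
    ← comp_tensorHom₂_id, Category.assoc, ← reassoc_of% h₄, leftUnitor_id_eq,
    Iso.hom_inv_id_assoc, Iso.refl_hom, whiskerLeft_id, Category.id_comp]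
  simp only [leftUnitor_id_eq]

/-- The axiom `warp_tensor`, with the three-fold product on the target merged by `e` and the right
unit triangle moved across. -/
theorem kappaAt_assocAt :
    W.kappaAt (Iso.refl (((W.t ⊠₁ 𝟙 A) ≫ S.p) ≫ W.t)) ≫ run (A ⊠ A) ◁ (W.v ⊠₂ 𝟙 W.k) ▷ S.p ≫
        run (A ⊠ A) ◁ S.assocAt (Iso.refl _) (Iso.refl _) =
      (𝟙 W.t ⊠₂ W.κ) ▷ S.p ≫ (precomp S.p (λ_ W.t) (Iso.refl _)).inv ≫ (rightMove A A _).hom := by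
  let e := precomp S.p (ρ_ W.t) (Iso.refl ((W.t ⊠₁ W.k) ≫ S.p))
  have h : (W.kappaAt (Iso.refl (((W.t ⊠₁ 𝟙 A) ≫ S.p) ≫ W.t)) ≫
      run (A ⊠ A) ◁ (W.v ⊠₂ 𝟙 W.k) ▷ S.p ≫
      run (A ⊠ A) ◁ ((precomp S.p (Iso.refl _) (ρ_ W.k)).inv ≫ ((W.t ⊠₁ W.t) ⊠₁ W.k) ◁ S.assoc ≫
        (ascMove W.t W.t W.k _).hom)) ≫ (rightMove A A _).inv =
      (𝟙 W.t ⊠₂ W.κ) ▷ S.p ≫ (precomp S.p (λ_ W.t) (Iso.refl _)).inv ≫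
        (𝟙 A ⊠₁ run A) ◁ e.inv := by
    refine Eq.trans ?_ (W.warp_tensor.trans ?_)
    · simp only [kappaAt, precomp_hom, precomp_inv, squareMove_hom, rightMove, Iso.trans_inv,
        whiskerRightIso_inv]
      bicategory
    · simp only [e, precomp_inv]
      bicategory
  rw [Iso.comp_inv_eq] at h
  have h' := congrArg (fun z => z ≫ run (A ⊠ A) ◁ asc A A (unitObj B) ◁ e.hom) h
  simp only [Category.assoc] at h'
  rw [← rightMove_naturality, whiskerLeft_inv_hom_assoc] at h'
  rw [← h']
  simp only [SkewMonoidalData.assocAt, e, whiskerLeft_comp, Category.assoc]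

theorem warped_right_unit :
    W.warped.rightAt W.warped.p ≫ run (A ⊠ A) ◁ W.warped.assocAt W.warped.idProd (Iso.refl _) =
      W.warped.idProd.inv ≫ (𝟙 (𝟙 A) ⊠₂ W.warped.right) ▷ W.warped.p ≫
        (precomp W.warped.p (λ_ (𝟙 A)) (Iso.refl _)).inv ≫ (rightMove A A _).hom := by
  let c : ((𝟙 A ⊠₁ W.k) ≫ (W.t ⊠₁ 𝟙 A) ≫ S.p) ≫ 𝟙 A ≅ (W.t ⊠₁ W.k) ≫ S.p :=
    ρ_ _ ≪≫ precomp S.p (λ_ W.t) (ρ_ W.k)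
  let i := whiskerLeftIso (run (A ⊠ A)) (whiskerLeftIso (asc A A (unitObj B))
    (precomp S.p (λ_ W.t) c))
  have h₁ := congrArg (fun z => run (A ⊠ A) ◁ z) (W.warped_assocAt W.warped.idProd (Iso.refl _)
    (λ_ W.t) (λ_ W.t) c (Iso.refl _) (by simp [c]))
  have h₂ := W.warped_rightAt (Iso.refl (((W.t ⊠₁ 𝟙 A) ≫ S.p) ≫ W.t))
  have h₃ := precomp_inv_whiskerLeft S.p W.t (y := run A) c
  have h₄ := precomp_naturality_left S.p (λ_ W.t) (λ_ (𝟙 A)) (λ_ W.t)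
    (α_ _ _ _ ≪≫ whiskerLeftIso (run A) c) (η := 𝟙 (𝟙 A)) (φ := 𝟙 W.t) (θ := W.warped.right)
    (ψ := W.κ) (by simp) (by
      simp only [c, Iso.trans_hom, whiskerLeftIso_hom, whiskerLeft_comp]
      rw [whiskerLeft_rightUnitor_assoc, Iso.hom_inv_id_assoc, rightUnitor_naturality_assoc,
        Category.assoc, ← whiskerLeft_comp, Iso.inv_hom_id, whiskerLeft_id, Category.comp_id,
        leftUnitor_id_eq])
  simp only [W.vAt_idProd, whiskerLeft_comp] at h₁
  -- Appending `i` puts the target in the form `tx·(ty·k)`, where the new constraints become `κ`,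
  -- `v` and the old associativity.
  rw [← cancel_mono i.hom]
  simp only [i, whiskerLeftIso_hom, Category.assoc]
  rw [h₁, reassoc_of% h₂, ← rightMove_naturality, reassoc_of% h₃, reassoc_of% h₄,
    ← W.warped_idProd_hom, Iso.inv_hom_id_assoc, W.kappaAt_assocAt]

theorem warped_unit_unit :
    W.warped.rightAt W.k ≫ run (unitObj B) ◁ W.warped.leftAt W.k ≫ (α_ _ _ _).inv ≫
      (unitCell B).hom ▷ W.k ≫ (λ_ W.k).hom = 𝟙 W.k := by
  rw [W.warped_leftAt, whiskerLeft_comp_assoc, reassoc_of% W.warped_rightAt (Iso.refl (W.k ≫ W.t))]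
  refine Eq.trans ?_ W.warp_unit
  simp only [kappaAt, SkewMonoidalData.leftAt, precomp_hom, precomp_inv, squareMove_hom]
  bicategory

/-- The `v₀` slides through the old associativity into the left factor, where `κ`, `v` and `v₀`
combine by `vAt_comp_right` into the old right unit constraint at `t`. The old middle axiom at `t,
1` finishes. -/
theorem warped_middle_unit :
    (W.warped.right ⊠₂ 𝟙 (𝟙 A)) ▷ W.warped.p ≫
      (precomp W.warped.p (Iso.refl _) (λ_ (𝟙 A))).inv ≫
      (run A ⊠₁ 𝟙 A) ◁ W.warped.assocAt (Iso.refl _) (Iso.refl _) ≫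
      (run A ⊠₁ 𝟙 A) ◁ asc A (unitObj B) A ◁ (𝟙 (𝟙 A) ⊠₂ W.warped.left) ▷ W.warped.p ≫
      (midMove A A W.warped.p).hom = W.warped.idProd.hom := by
  let c : ((W.k ⊠₁ 𝟙 A) ≫ (W.t ⊠₁ 𝟙 A) ≫ S.p) ≫ 𝟙 A ≅ ((W.k ≫ W.t) ⊠₁ 𝟙 A) ≫ S.p :=
    ρ_ _ ≪≫ precomp S.p (Iso.refl _) (ρ_ (𝟙 A))
  have h₁ := W.warped_assocAt (f := 𝟙 A) (g := W.k) (h := 𝟙 A) (Iso.refl _) (Iso.refl _) (λ_ W.t)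
    (Iso.refl (W.k ≫ W.t)) c (Iso.refl _) (by simp [c])
  have h₂ := S.assocAt_naturality (Iso.refl _) (Iso.refl _) (Iso.refl _) (Iso.refl _) (η := 𝟙 W.t)
    (θ := W.v₀) (ζ := 𝟙 (𝟙 A)) (μ := (𝟙 W.t ⊠₂ W.v₀) ▷ S.p) (ν := (W.v₀ ⊠₂ 𝟙 (𝟙 A)) ▷ S.p)
    (by simp) (by simp)
  have h₃ := precomp_naturality_left S.p (λ_ W.t) c (λ_ W.t) (ρ_ (lun A)) (η := 𝟙 (𝟙 A))
    (φ := 𝟙 W.t) (θ := W.warped.left) (ψ := (W.v₀ ⊠₂ 𝟙 (𝟙 A)) ▷ S.p ≫ S.left) (by simp)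
    (by simp [c, leftUnitor_id_eq])
  have h₄ := precomp_inv_whiskerRight S.p W.t W.warped.right
    (W.vAt (Iso.refl _) (λ_ W.t) (Iso.refl _) ≫ (𝟙 W.t ⊠₂ W.v₀) ▷ S.p)
  have h₅ := precomp_naturality_left S.p (Iso.refl _) (ρ_ (𝟙 A)) (λ_ W.t) (ρ_ (𝟙 A))
    (η := 𝟙 (𝟙 A)) (θ := 𝟙 (𝟙 A)) (φ := (λ_ W.t).hom) (ψ := 𝟙 (𝟙 A)) (by simp) (by simp)
  have h₆ := S.rightAt_leftAt (S.middle_unit_iff.1 S.isLeftSkewMonoidal.middle_unit) W.t (𝟙 A)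
  -- At the identity element, `leftAt` is `S.left` up to a right unitor, which the other choice of
  -- `precomp` absorbs.
  have h₇ : (𝟙 W.t ⊠₂ S.leftAt (𝟙 A)) ▷ S.p ≫ (precomp S.p (λ_ W.t) (Iso.refl _)).inv =
      (𝟙 W.t ⊠₂ S.left) ▷ S.p ≫ (precomp S.p (λ_ W.t) (ρ_ (lun A))).inv := by
    have h := precomp_naturality_left S.p (λ_ W.t) (Iso.refl _) (λ_ W.t) (ρ_ (lun A))
      (η := 𝟙 (𝟙 A)) (θ := 𝟙 (lun A)) (φ := 𝟙 W.t) (ψ := (ρ_ (lun A)).hom) (by simp) (by simp)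
    rw [tensorHom₂_id, id_whiskerRight, Category.id_comp] at h
    rw [Iso.eq_comp_inv, Category.assoc, h, Iso.inv_hom_id_assoc, ← comp_whiskerRight,
      ← id_tensorHom₂_comp, S.leftAt_id, Category.assoc, Iso.inv_hom_id, Category.comp_id]
  rw [W.vAt_comp_right] at h₄
  rw [← Iso.eq_comp_inv] at h₃
  -- Only `h₃` and `h₄` are needed about the new unit constraints; they are made opaque before
  -- normalising.
  generalize W.warped.left = ω at *
  generalize W.warped.right = ω' at *
  have h₁' := congrArg (fun z => (run A ⊠₁ 𝟙 A) ◁ z) h₁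
  have h₂' := congrArg (fun z => (run A ⊠₁ 𝟙 A) ◁ z) h₂
  have h₃' := congrArg (fun z => (run A ⊠₁ 𝟙 A) ◁ asc A (unitObj B) A ◁ z) h₃
  have h₇' := congrArg (fun z => (run A ⊠₁ 𝟙 A) ◁ asc A (unitObj B) A ◁ z) h₇
  simp only [whiskerLeft_comp, comp_tensorHom₂_id, id_tensorHom₂_comp, comp_whiskerRight,
    Category.assoc] at h₁' h₂' h₃' h₄ h₇'
  rw [h₃']
  simp only [Category.assoc]
  rw [reassoc_of% h₁', ← reassoc_of% h₂', reassoc_of% h₄, ← reassoc_of% h₇', h₆, ← reassoc_of% h₅]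
  rw [tensorHom₂_id, id_whiskerRight, Category.id_comp, Category.comp_id, W.warped_idProd_hom,
    leftUnitor_id_eq]

theorem warped_isLeftSkewMonoidal : W.warped.IsLeftSkewMonoidal where
  pentagon := by
    rw [SkewMonoidalData.pentagon_left_eq, SkewMonoidalData.pentagon_right_eq,
      W.warped_pentagonLeft_idProd]
  middle_unit := W.warped.middle_unit_iff.2 W.warped_middle_unit
  left_unit := W.warped.left_unit_iff.2 W.warped_left_unit
  right_unit := W.warped.right_unit_iff.2 W.warped_right_unit
  unit_unit := W.warped.unit_unit_eq.trans W.warped_unit_unit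

end SkewLeftWarping

end SkewWarp

theorem mainTheorem4 {B : Type u} [Bicategory.{w, v} B] [SkewWarp.MonoidalBicategory B] {A : B}
    (S : SkewWarp.LeftSkewMonoidale A) (W : SkewWarp.SkewLeftWarping S) :
    W.newData.IsLeftSkewMonoidal ∧
      SkewWarp.IsOpmonoidalMorphism W.newData S.toSkewMonoidalData W.t W.v₀ W.v :=
  ⟨W.newData_eq_warped ▸ W.warped_isLeftSkewMonoidal, W.isOpmonoidalMorphism⟩
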